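/- Let $\langle x,y\rangle_1=\sum_{i\le n+1}x_iy_i-x_{n+2}y_{n+2}$ on $\mathbb R^{n+2}$, let $\mathbb H^{n+1}=\{x:\langle x,x\rangle_1=-1,\ x_{n+2}>0\}$, and endow $\mathbb H^{n+1}\times\mathbb R$ with the Lorentzian metric $\bar g=\langle\cdot,\cdot\rangle_1-dt^2$. Let $\mathcal M$ be an $n$-dimensional manifold. For a $C^2$ immersion $\bar\varphi:\mathcal M\to\mathbb H^{n+1}\times\mathbb R$ with non-degenerate induced metric, let $h$ be its (normal-bundle valued) second fundamental form and $\vec H$ the trace of $h$ with respect to the induced metric. We say that $h$ is null if $\bar g(h(X,Y),h(X,Y))=0$ for all tangent $X,Y$, that $\bar\varphi$ is totally geodesic if $h=0$, and that $\bar\varphi$ is marginally trapped if $\bar g(\vec H,\vec H)=0$ identically. (1) If $n\ge2$, every such immersion with null second fundamental form is totally geodesic. (2) Let $\varphi:\mathcal M\to\mathbb H^{n+1}$ be a $C^4$ immersion with Gauss map (unit normal) $\nu$. At each point let $\kappa_1,\dots,\kappa_p$ be the distinct principal curvatures, i.e. the eigenvalues of the shape operator $A$ given by $d\varphi\circ A=-d\nu$,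 with multiplicities $m_i$, and $$P(s)=\sum_{i=1}^p m_i(\kappa_is-1)\prod_{j\ne i}(s-\kappa_j).$$ At each point where $P$ is not identically zero, it has at most $p$ distinct roots with $|s|>1$. If $s:\mathcal M\to\mathbb R$ is a $C^2$ function that is at each point a root of $P$ with $|s|>1$, then $$\bar\varphi_s=\Big(\operatorname{sgn}(s)\,\frac{s\varphi+\nu}{\sqrt{s^2-1}},\ \coth^{-1}s\Big)$$ is a spacelike marginally trapped immersion into $\mathbb H^{n+1}\times\mathbb R$. A continuous function $s$ that is at each point a simple root of $P$ with $|s|>1$ is automatically $C^2$, and each simple root with $|s|>1$ at a given point extends to a $C^2$ function $s$ near that point that is a root of $P$ with $|s|>1$. (3) Conversely, let $\bar\varphi:\mathcal M\to\mathbb H^{n+1}\times\mathbb R$ be a spacelike marginally trapped immersion of class $C^5$. Let $x\in\mathcal M$ be a point such that $\vec H(x)\neq0$ or, more generally, such that near $x$ the vector $\vec H$ is everywhere a multiple of one continuous nowhere vanishing null normal field. Then near $x$, after a vertical translation $(y,t)\mapsto(y,t+c)$, $\bar\varphi$ equals an immersion $\bar\varphi_s$ as in (2). The points near which $\bar\varphi$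 has such a form are dense in $\mathcal M$. (4) Let $n=2$ and let $\varphi$ be a $C^4$ immersion of a surface into $\mathbb H^3$ with Gauss map $\nu$ and principal curvatures $\kappa_1,\kappa_2$, such that $\kappa_1+\kappa_2\ne0$ and $a:=\frac{\kappa_1\kappa_2+1}{\kappa_1+\kappa_2}>1$ everywhere, and such that $\kappa_1<1$ at every umbilic point (for instance, $\varphi$ has no umbilic points). Then $$\bar\varphi=\Big(\frac{(a+\sqrt{a^2-1})\varphi+\nu}{\sqrt2\sqrt{a^2-1+a\sqrt{a^2-1}}},\ \tfrac12\coth^{-1}a\Big)$$ is a spacelike marginally trapped immersion into $\mathbb H^3\times\mathbb R$. Parts (1)-(4) hold likewise with $\mathcal M$ replaced by any of its open subsets. -/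

import Mathlib

open scoped Manifold ContDiff Topology Polynomial

noncomputable section

namespace TrappedHyp

/-- The vector space `ℝ^{n+2} = ℝ^{n+1} × ℝ`; the last coordinate is the timelike one. -/
abbrev Mink (n : ℕ) : Type := EuclideanSpace ℝ (Fin (n + 1)) × ℝ

/-- The Lorentzian form `dx₁² + ⋯ + dx_{n+1}² - dx_{n+2}²`. -/
def lor {n : ℕ} (x y : Mink n) : ℝ := inner ℝ x.1 y.1 - x.2 * y.2

/-- Hyperbolic space `ℍ^{n+1}`: the upper sheet of the hyperboloid `⟨x, x⟩ = -1`. -/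
def hyperbolicSpace (n : ℕ) : Set (Mink n) := {x | lor x x = -1 ∧ 0 < x.2}

/-- The flat space `ℝ^{n+2} × ℝ` that contains `ℍ^{n+1} × ℝ`. -/
abbrev Amb (n : ℕ) : Type := Mink n × ℝ

/-- The form `⟨·,·⟩ - dt²` on `ℝ^{n+2} × ℝ`; it restricts to the Lorentzian product metric on
`ℍ^{n+1} × ℝ`. -/
def amb {n : ℕ} (v w : Amb n) : ℝ := lor v.1 w.1 - v.2 * w.2

/-- The Lorentzian product `ℍ^{n+1} × ℝ` as a subset of `ℝ^{n+2} × ℝ`. -/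
def hypProd (n : ℕ) : Set (Amb n) := {p | p.1 ∈ hyperbolicSpace n}

/-- The inverse hyperbolic cotangent, for `|s| > 1`. -/
def arcoth (s : ℝ) : ℝ := Real.artanh s⁻¹

section Calculus

variable {n : ℕ} {M : Type*} [TopologicalSpace M] [ChartedSpace (EuclideanSpace ℝ (Fin n)) M]
  {F : Type*} [NormedAddCommGroup F] [NormedSpace ℝ F]

/-- The `i`-th coordinate vector of `T_x M`, in the chart at `x`. -/
def coordVec (i : Fin n) : EuclideanSpace ℝ (Fin n) := EuclideanSpace.single i 1

/-- The differential at `x` of a vector-valued map. -/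
def differential (f : M → F) (x : M) : EuclideanSpace ℝ (Fin n) →L[ℝ] F :=
  mfderiv (𝓡 n) 𝓘(ℝ, F) f x

/-- The second derivative at `x`, in the chart at `x`, of a vector-valued map. It is
`D_X (df (Y))` at `x` (with the flat connection of the target) for the coordinate-constant vector
field `Y`; another chart changes it only by a vector tangent to the map. -/
def secondDeriv (f : M → F) (x : M) :
    EuclideanSpace ℝ (Fin n) →L[ℝ] EuclideanSpace ℝ (Fin n) →L[ℝ] F :=
  fderiv ℝ (fderiv ℝ (f ∘ (extChartAt (𝓡 n) x).symm)) (extChartAt (𝓡 n) x x)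

/-- The Gram matrix at `x` of the pull-back by `f` of the form `B`. -/
def gram (B : F → F → ℝ) (f : M → F) (x : M) : Matrix (Fin n) (Fin n) ℝ :=
  Matrix.of fun i j => B (differential f x (coordVec i)) (differential f x (coordVec j))

end Calculus

section Submanifolds

variable {n : ℕ} {M : Type*} [TopologicalSpace M] [ChartedSpace (EuclideanSpace ℝ (Fin n)) M]

/-- `Φ` restricts to a `C²` immersion of the open set `U` into `ℍ^{n+1} × ℝ` whose first
fundamental form is non-degenerate. -/
structure IsNondegImmersionOn (Φ : M → Amb n) (U : Set M) : Prop where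
  mapsTo : ∀ x ∈ U, Φ x ∈ hypProd n
  contMDiffOn : ContMDiffOn (𝓡 n) 𝓘(ℝ, Amb n) 2 Φ U
  nondeg : ∀ x ∈ U, (gram amb Φ x : Matrix (Fin n) (Fin n) ℝ).det ≠ 0

/-- The first fundamental form of `Φ` is positive definite on `U`. -/
def IsSpacelikeOn (Φ : M → Amb n) (U : Set M) : Prop :=
  ∀ x ∈ U, ∀ v : EuclideanSpace ℝ (Fin n), v ≠ 0 →
    0 < amb (differential Φ x v) (differential Φ x v)

/-- `w` is a normal vector of `Φ` at `x`: it is tangent to `ℍ^{n+1} × ℝ` at `Φ x` and orthogonal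
to the image of the differential of `Φ`. -/
def IsNormalAt (Φ : M → Amb n) (x : M) (w : Amb n) : Prop :=
  lor w.1 (Φ x).1 = 0 ∧ ∀ v : EuclideanSpace ℝ (Fin n), amb w (differential Φ x v) = 0

/-- The orthogonal projection of `w` to the normal space of `Φ` at `x`: first the component along
the normal `(ψ, 0)` of `ℍ^{n+1} × ℝ` is removed (`⟨ψ, ψ⟩ = -1`), where `Φ x = (ψ, τ)`, and then the
component tangent to `Φ`. -/
def normalPart (Φ : M → Amb n) (x : M) (w : Amb n) : Amb n :=
  w + lor w.1 (Φ x).1 • ((Φ x).1, (0 : ℝ))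
    - ∑ i : Fin n, ∑ j : Fin n,
        ((gram amb Φ x)⁻¹ i j * amb w (differential Φ x (coordVec i))) •
          differential Φ x (coordVec j)

/-- The second fundamental form `h(X, Y) = (D_X Y)^⊥` of `Φ` in `ℍ^{n+1} × ℝ`. -/
def secondForm (Φ : M → Amb n) (x : M) (v w : EuclideanSpace ℝ (Fin n)) : Amb n :=
  normalPart Φ x (secondDeriv Φ x v w)

/-- The mean curvature vector: the trace of the second fundamental form with respect to the
induced metric. -/
def meanCurv (Φ : M → Amb n) (x : M) : Amb n :=
  ∑ i : Fin n, ∑ j : Fin n, (gram amb Φ x)⁻¹ i j • secondForm Φ x (coordVec i) (coordVec j)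

/-- The second fundamental form takes values in null vectors. -/
def HasNullSecondFormOn (Φ : M → Amb n) (U : Set M) : Prop :=
  ∀ x ∈ U, ∀ v w, amb (secondForm Φ x v w) (secondForm Φ x v w) = 0

/-- The second fundamental form vanishes. -/
def IsTotallyGeodesicOn (Φ : M → Amb n) (U : Set M) : Prop :=
  ∀ x ∈ U, ∀ v w, secondForm Φ x v w = 0

/-- `Φ` is a marginally trapped immersion on `U`: a `C²` immersion with non-degenerate first
fundamental form and null mean curvature vector. -/
structure IsMarginallyTrappedOn (Φ : M → Amb n) (U : Set M) : Prop
    extends IsNondegImmersionOn Φ U where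
  null : ∀ x ∈ U, amb (meanCurv Φ x) (meanCurv Φ x) = 0

/-- Near `x` the mean curvature vector is a multiple of one continuous, nowhere vanishing null
normal field. -/
def HasNullDirectionAt (Φ : M → Amb n) (x : M) : Prop :=
  ∃ (V : Set M) (N : M → Amb n), IsOpen V ∧ x ∈ V ∧ ContinuousOn N V ∧
    ∀ y ∈ V, N y ≠ 0 ∧ amb (N y) (N y) = 0 ∧ IsNormalAt Φ y (N y) ∧
      ∃ c : ℝ, meanCurv Φ y = c • N y

end Submanifolds

section Hypersurfaces

variable {n : ℕ} {M : Type*} [TopologicalSpace M] [ChartedSpace (EuclideanSpace ℝ (Fin n)) M]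

/-- `φ` restricts to a `C⁴` immersion of the open set `U` into `ℍ^{n+1}`, with Gauss map `ν`
(a unit normal field, which is then of class `C³`). -/
structure IsHypersurfaceOn (φ ν : M → Mink n) (U : Set M) : Prop where
  mapsTo : ∀ x ∈ U, φ x ∈ hyperbolicSpace n
  contMDiffOn : ContMDiffOn (𝓡 n) 𝓘(ℝ, Mink n) 4 φ U
  immersion : ∀ x ∈ U, Function.Injective
    (differential φ x : EuclideanSpace ℝ (Fin n) → Mink n)
  gauss_contMDiffOn : ContMDiffOn (𝓡 n) 𝓘(ℝ, Mink n) 3 ν U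
  gauss_unit : ∀ x ∈ U, lor (ν x) (ν x) = 1
  gauss_tangent : ∀ x ∈ U, lor (ν x) (φ x) = 0
  gauss_normal : ∀ x ∈ U, ∀ v : EuclideanSpace ℝ (Fin n), lor (ν x) (differential φ x v) = 0

/-- The shape operator `A` at `x`, with `dφ (A v) = - dν (v)`. Its matrix in the coordinate basis
is `G⁻¹ L`, where `G` is the Gram matrix of `φ` and `L i j = - ⟨dφ (e i), dν (e j)⟩`. -/
def shapeOperator (φ ν : M → Mink n) (x : M) : Module.End ℝ (EuclideanSpace ℝ (Fin n)) :=
  Matrix.toLin (EuclideanSpace.basisFun (Fin n) ℝ).toBasis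
    (EuclideanSpace.basisFun (Fin n) ℝ).toBasis
    ((gram lor φ x)⁻¹ * Matrix.of fun i j =>
      - lor (differential φ x (coordVec i)) (differential ν x (coordVec j)))

/-- The set of the distinct principal curvatures at `x`: the eigenvalues of the shape operator. -/
def principalCurvatures (φ ν : M → Mink n) (x : M) : Finset ℝ :=
  (shapeOperator φ ν x).charpoly.roots.toFinset

/-- The multiplicity of the principal curvature `k` at `x`. -/
def multiplicity (φ ν : M → Mink n) (x : M) (k : ℝ) : ℕ :=
  Module.finrank ℝ ((shapeOperator φ ν x).eigenspace k)

/-- The polynomial `P(s) = ∑ i, m i * (κ i * s - 1) * ∏ j ≠ i, (s - κ j)` at `x`, over the distinct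
principal curvatures `κ i` at `x` with multiplicities `m i`. -/
def trapPoly (φ ν : M → Mink n) (x : M) : ℝ[X] :=
  ∑ k ∈ principalCurvatures φ ν x,
    (multiplicity φ ν x k : ℝ[X]) * (Polynomial.C k * Polynomial.X - 1) *
      ∏ l ∈ (principalCurvatures φ ν x).erase k, (Polynomial.X - Polynomial.C l)

/-- `s` selects, at each point of `U`, a root of `P` of absolute value larger than one. -/
def IsRootOn (φ ν : M → Mink n) (s : M → ℝ) (U : Set M) : Prop :=
  ∀ x ∈ U, (trapPoly φ ν x).IsRoot (s x) ∧ 1 < |s x|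

/-- The map `(± (s φ + ν) / √(s² - 1), coth⁻¹ s)`, where the sign is that of `s`; the sign puts the
first component on the upper sheet also when `s < -1`. -/
def trapMap (φ ν : M → Mink n) (s : M → ℝ) (x : M) : Amb n :=
  ((Real.sign (s x) / √(s x ^ 2 - 1)) • (s x • φ x + ν x), arcoth (s x))

/-- The immersion of the case `n = 2`, for the function `a`. -/
def surfaceTrapMap (φ ν : M → Mink n) (a : M → ℝ) (x : M) : Amb n :=
  ((√2 * √(a x ^ 2 - 1 + a x * √(a x ^ 2 - 1)))⁻¹ •
      ((a x + √(a x ^ 2 - 1)) • φ x + ν x),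
    (1 / 2) * arcoth (a x))

/-- Near `x`, up to a vertical translation of `ℍ^{n+1} × ℝ`, the map `Φ` is the immersion given by
some `C⁴` hypersurface of `ℍ^{n+1}` and some `C²` root `s` of its polynomial with `|s| > 1`. -/
def IsLocallyTrapMapAt (Φ : M → Amb n) (x : M) : Prop :=
  ∃ (V : Set M) (φ ν : M → Mink n) (s : M → ℝ) (c : ℝ), IsOpen V ∧ x ∈ V ∧
    IsHypersurfaceOn φ ν V ∧ ContMDiffOn (𝓡 n) 𝓘(ℝ, ℝ) 2 s V ∧ IsRootOn φ ν s V ∧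
    ∀ y ∈ V, Φ y + ((0 : Mink n), c) = trapMap φ ν s y

end Hypersurfaces

end TrappedHyp

end

/-! Write a map into ℍ^{n+1} × ℝ as Φ = (ψ, τ). A nonzero null normal can be scaled to (η, 1), where
η is a unit vector orthogonal to ψ. Following the null geodesics in this direction down to a
horizontal slice gives φ = cosh τ ψ - sinh τ η and ν = cosh τ η - sinh τ ψ. Where φ is an immersion,
it is a hypersurface of ℍ^{n+1} with Gauss map ν. The inverse hyperbolic rotation is ψ = cosh τ φ +
sinh τ ν, η = sinh τ φ + cosh τ ν (`IsRotationOn`, `rotate_unrotated`), and with s = coth τ it is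
`trapMap` (`trapMap_eq`).

In these terms the term -dτ² of the metric cancels the square of the component dτ η of dψ. The
induced metric is therefore the pull-back of the Lorentzian form by dφ ∘ (cosh τ - sinh τ A), as if
τ were constant (`IsRotationOn.amb_fderiv`). Differentiating the orthogonality of (η, 1) and dΦ
gives ⟨h(v, w), (η, 1)⟩ = -⟨dψ w, dη v⟩ (`amb_secondForm_null_normal`). Taking the trace, ⟨H, (η,
1)⟩ = tr((s - A)⁻¹ (s A - 1)) = P(s) / ∏ (s - κ_i) (`trace_rotate_eq_zero_iff`). A normal vector
orthogonal to a null normal is null, so P(s) = 0 makes H null. Moreover P(κ_i) = m_i (κ_i² - 1) ∏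
(κ_i - κ_j), so a root with |s| > 1 is never a principal curvature and the immersion is spacelike.

The coefficients of P can jump where principal curvatures merge. Regularity of roots is therefore
read off from tr(adj(s - A)(s A - 1)), which is polynomial in s and A and differs from P, away from
the spectrum, by a nonvanishing factor. The implicit function theorem applies to it at simple roots
(`exists_root_function`).

For the converse, a continuous null direction of H is upgraded to a C⁴ field η by the implicit
function theorem, and a small positive distance makes the parallel hypersurface immersed
(`exists_hypersurface_of_null_normal`). Where H ≠ 0 the direction is H itself; where H vanishes on
an open set any null normal field serves. This gives density.

If h is null and nonzero at a point, polarization makes all its values orthogonal to one null field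
(η, 1). Then dη = dτ ψ, and d² = 0 yields dτ ∧ dψ = 0, hence dτ = 0 when n ≥ 2. So h has no vertical
component, although nonzero null normals do.

For surfaces P(s) = 0 reduces, off the principal curvatures, to s² - 2 a s + 1 = 0, and a = coth 2t
when s = coth t. -/

noncomputable section

namespace TrappedHyp

/-! ### Linear algebra of the Lorentzian form. -/

section LorentzForm

variable {n : ℕ}

/-- The Lorentzian form as a continuous bilinear map. -/
def lorL (n : ℕ) : Mink n →L[ℝ] Mink n →L[ℝ] ℝ :=
  (innerSL ℝ (E := EuclideanSpace ℝ (Fin (n + 1)))).bilinearComp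
      (ContinuousLinearMap.fst ℝ _ _) (ContinuousLinearMap.fst ℝ _ _) -
    (ContinuousLinearMap.mul ℝ ℝ).bilinearComp
      (ContinuousLinearMap.snd ℝ _ _) (ContinuousLinearMap.snd ℝ _ _)

lemma lorL_apply (x y : Mink n) : lorL n x y = lor x y := by
  simp [lorL, lor]

/-- The ambient form as a continuous bilinear map. -/
def ambL (n : ℕ) : Amb n →L[ℝ] Amb n →L[ℝ] ℝ :=
  (lorL n).bilinearComp (ContinuousLinearMap.fst ℝ _ _) (ContinuousLinearMap.fst ℝ _ _) -
    (ContinuousLinearMap.mul ℝ ℝ).bilinearComp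
      (ContinuousLinearMap.snd ℝ _ _) (ContinuousLinearMap.snd ℝ _ _)

lemma ambL_apply (x y : Amb n) : ambL n x y = amb x y := by
  simp [ambL, amb, lorL_apply]

lemma lor_comm (x y : Mink n) : lor x y = lor y x := by
  simp only [lor, real_inner_comm, mul_comm]

lemma lor_add_left (x y z : Mink n) : lor (x + y) z = lor x z + lor y z := by
  simp [← lorL_apply]

lemma lor_add_right (x y z : Mink n) : lor x (y + z) = lor x y + lor x z := by
  simp [← lorL_apply]

lemma lor_sub_left (x y z : Mink n) : lor (x - y) z = lor x z - lor y z := by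
  simp [← lorL_apply]

lemma lor_sub_right (x y z : Mink n) : lor x (y - z) = lor x y - lor x z := by
  simp [← lorL_apply]

lemma lor_smul_left (c : ℝ) (x y : Mink n) : lor (c • x) y = c * lor x y := by
  simp [← lorL_apply]

lemma lor_smul_right (c : ℝ) (x y : Mink n) : lor x (c • y) = c * lor x y := by
  simp [← lorL_apply]

lemma lor_zero_left (y : Mink n) : lor 0 y = 0 := by
  simp [← lorL_apply]

lemma amb_comm (x y : Amb n) : amb x y = amb y x := by
  simp only [amb, lor_comm x.1, mul_comm]

lemma amb_add_left (x y z : Amb n) : amb (x + y) z = amb x z + amb y z := by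
  simp [← ambL_apply]

lemma amb_add_right (x y z : Amb n) : amb x (y + z) = amb x y + amb x z := by
  simp [← ambL_apply]

lemma amb_sub_left (x y z : Amb n) : amb (x - y) z = amb x z - amb y z := by
  simp [← ambL_apply]

lemma amb_smul_left (c : ℝ) (x y : Amb n) : amb (c • x) y = c * amb x y := by
  simp [← ambL_apply]

lemma amb_smul_right (c : ℝ) (x y : Amb n) : amb x (c • y) = c * amb x y := by
  simp [← ambL_apply]

lemma amb_sum_left {ι : Type*} (s : Finset ι) (f : ι → Amb n) (y : Amb n) :
    amb (∑ i ∈ s, f i) y = ∑ i ∈ s, amb (f i) y := by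
  simp [← ambL_apply]

lemma amb_zero_left (y : Amb n) : amb 0 y = 0 := by
  simp [← ambL_apply]

/-- The form is positive definite on the orthogonal complement of a timelike unit vector. -/
lemma lor_self_pos {p y : Mink n} (hp : lor p p = -1) (hpy : lor y p = 0) (hy : y ≠ 0) :
    0 < lor y y := by
  simp only [lor, real_inner_self_eq_norm_sq] at *
  have hcs := abs_real_inner_le_norm y.1 p.1
  have hcs2 : (inner ℝ y.1 p.1) ^ 2 ≤ ‖y.1‖ ^ 2 * ‖p.1‖ ^ 2 := by
    rw [← mul_pow, ← sq_abs]
    exact pow_le_pow_left₀ (abs_nonneg _) hcs 2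
  have h1 : inner ℝ y.1 p.1 = y.2 * p.2 := by linarith
  rw [h1] at hcs2
  by_cases h2 : y.2 = 0
  · have : y.1 ≠ 0 := fun h => hy (Prod.ext h h2)
    rw [h2]
    have := norm_pos_iff.mpr this
    nlinarith
  · have h3 : 0 < y.2 ^ 2 := by positivity
    by_contra hcon
    have h4 : ‖y.1‖ ^ 2 ≤ y.2 ^ 2 := by nlinarith
    have h5 : ‖p.1‖ ^ 2 = p.2 ^ 2 - 1 := by nlinarith
    -- Cauchy–Schwarz would give (y₂ p₂)² ≤ ‖y₁‖² ‖p₁‖² ≤ y₂² (p₂² - 1), impossible for y₂ ≠ 0.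
    have h6 := mul_le_mul_of_nonneg_right h4 (sq_nonneg ‖p.1‖)
    rw [h5] at hcs2 h6
    nlinarith

lemma eq_zero_of_lor_self {p y : Mink n} (hp : lor p p = -1) (hpy : lor y p = 0)
    (hy : lor y y = 0) : y = 0 := by
  by_contra h
  exact (lor_self_pos hp hpy h).ne' hy

lemma eq_zero_of_lor_eq_zero {u : Mink n} (h : ∀ z, lor u z = 0) : u = 0 := by
  -- Against the time-reflected vector the form becomes the Euclidean square of u.
  have h1 := h (u.1, -u.2)
  simp only [lor, real_inner_self_eq_norm_sq] at h1
  have h2 : ‖u.1‖ ^ 2 = 0 := by nlinarith [sq_nonneg ‖u.1‖, sq_nonneg u.2]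
  have h3 : u.2 ^ 2 = 0 := by nlinarith
  exact Prod.ext (by simpa using h2) (by simpa using h3)

/-- A timelike unit vector in the same half of the light cone as a point of hyperbolic space lies
in hyperbolic space. -/
lemma mem_hyperbolicSpace_of_lor_neg {p q : Mink n} (hp : p ∈ hyperbolicSpace n)
    (hq : lor q q = -1) (hpq : lor q p < 0) : q ∈ hyperbolicSpace n := by
  refine ⟨hq, ?_⟩
  obtain ⟨hp1, hp2⟩ := hp
  simp only [lor, real_inner_self_eq_norm_sq] at *
  have hcs := abs_real_inner_le_norm q.1 p.1
  by_contra hcon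
  have h1 : ‖p.1‖ ≤ p.2 := by
    apply le_of_sq_le_sq _ hp2.le
    nlinarith
  have h2 : ‖q.1‖ ≤ -q.2 := by
    apply le_of_sq_le_sq _ (by linarith)
    nlinarith
  have h3 : ‖q.1‖ * ‖p.1‖ ≤ (-q.2) * p.2 :=
    mul_le_mul h2 h1 (norm_nonneg _) (by linarith)
  have := abs_le.mp (hcs.trans h3)
  linarith [this.1]

/-- A vector orthogonal to a timelike unit vector, a spacelike unit vector and a complementary
`n`-plane vanishes. -/
lemma eq_zero_of_orthogonal_frame {p q u : Mink n} {X : EuclideanSpace ℝ (Fin n) →L[ℝ] Mink n}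
    (hp : lor p p = -1) (hq : lor q q = 1) (hqp : lor q p = 0)
    (hX : ∀ v, X v = 0 → v = 0) (hXp : ∀ v, lor (X v) p = 0) (hXq : ∀ v, lor (X v) q = 0)
    (hup : lor u p = 0) (huq : lor u q = 0) (huX : ∀ v, lor u (X v) = 0) : u = 0 := by
  -- Pairing with p and q reads off the coefficients a and b, so T is injective. Both sides have
  -- dimension n + 2, hence p, q and the plane span everything, and the form is non-degenerate.
  let T : (ℝ × ℝ) × EuclideanSpace ℝ (Fin n) →ₗ[ℝ] Mink n :=
    ((LinearMap.toSpanSingleton ℝ _ p).coprod (LinearMap.toSpanSingleton ℝ _ q)).coprod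
      (X : EuclideanSpace ℝ (Fin n) →ₗ[ℝ] Mink n)
  have hT : ∀ a b v, T ((a, b), v) = a • p + b • q + X v := by
    intro a b v; simp [T]
  have hinj : Function.Injective T := by
    rw [← LinearMap.ker_eq_bot, LinearMap.ker_eq_bot']
    rintro ⟨⟨a, b⟩, v⟩ h
    rw [hT] at h
    have h1 : lor (a • p + b • q + X v) p = 0 := by rw [h, lor_zero_left]
    have h2 : lor (a • p + b • q + X v) q = 0 := by rw [h, lor_zero_left]
    simp only [lor_add_left, lor_smul_left, hp, hq, hqp, hXp, hXq, lor_comm p q] at h1 h2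
    have ha : a = 0 := by linarith
    have hb : b = 0 := by linarith
    subst ha; subst hb
    have := hX v (by simpa using h)
    simp [this]
  have hdim : Module.finrank ℝ ((ℝ × ℝ) × EuclideanSpace ℝ (Fin n)) =
      Module.finrank ℝ (Mink n) := by
    simp; omega
  have hsurj := (LinearMap.injective_iff_surjective_of_finrank_eq_finrank hdim).mp hinj
  apply eq_zero_of_lor_eq_zero
  intro z
  obtain ⟨⟨⟨a, b⟩, v⟩, rfl⟩ := hsurj z
  rw [hT]
  simp [lor_add_right, lor_smul_right, hup, huq, huX]

/-- The components of nonzero null vectors orthogonal to a timelike unit vector. -/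
lemma snd_ne_zero_of_null {p : Mink n} {w : Amb n} (hp : lor p p = -1) (hwp : lor w.1 p = 0)
    (hw : amb w w = 0) (hw0 : w ≠ 0) : w.2 ≠ 0 := by
  intro h
  apply hw0
  refine Prod.ext (eq_zero_of_lor_self hp hwp ?_) h
  simpa [amb, h] using hw

/-- Orthogonal null vectors of a Lorentzian space are parallel: w₁ - w₂ q is orthogonal to p and has
square zero, because ⟨w₁, q⟩ = w₂ and ⟨w₁, w₁⟩ = w₂². -/
lemma eq_smul_of_null_of_amb_eq_zero {p q : Mink n} {w : Amb n} (hp : lor p p = -1)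
    (hq : lor q q = 1) (hqp : lor q p = 0) (hwp : lor w.1 p = 0) (hw : amb w w = 0)
    (hwq : amb w (q, 1) = 0) : w = w.2 • (q, (1 : ℝ)) := by
  have h : w.1 - w.2 • q = 0 := by
    apply eq_zero_of_lor_self hp
    · simp [lor_sub_left, lor_smul_left, hwp, hqp]
    · simp only [amb] at hw hwq
      simp only [lor_sub_left, lor_smul_left, lor_sub_right, lor_smul_right, hq, lor_comm q w.1]
      have h1 : lor w.1 q = w.2 := by linarith
      rw [h1]
      linarith
  refine Prod.ext ?_ (by simp)
  simpa [sub_eq_zero] using h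

end LorentzForm

/-! ### Gram matrices and change of basis. -/

section Gram

variable {n : ℕ} {F : Type*} [NormedAddCommGroup F] [NormedSpace ℝ F]

lemma sum_coordVec (v : EuclideanSpace ℝ (Fin n)) : ∑ i, v i • coordVec i = v := by
  ext j
  simp [coordVec, Finset.sum_apply, Pi.single_apply]

/-- The Gram matrix of a linear map. -/
def gramOf (B : F → F → ℝ) (D : EuclideanSpace ℝ (Fin n) →L[ℝ] F) : Matrix (Fin n) (Fin n) ℝ :=
  Matrix.of fun i j => B (D (coordVec i)) (D (coordVec j))

lemma eq_zero_of_forall_coordVec {D : EuclideanSpace ℝ (Fin n) →L[ℝ] F} {L : F →L[ℝ] ℝ}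
    (h : ∀ i, L (D (coordVec i)) = 0) (v : EuclideanSpace ℝ (Fin n)) : L (D v) = 0 := by
  rw [← sum_coordVec v]
  simp [h]

lemma eq_zero_of_gramOf_det_ne_zero {B : F →L[ℝ] F →L[ℝ] ℝ}
    {D : EuclideanSpace ℝ (Fin n) →L[ℝ] F} (hdet : (gramOf (fun x y => B x y) D).det ≠ 0)
    {v : EuclideanSpace ℝ (Fin n)} (hv : ∀ w, B (D w) (D v) = 0) : v = 0 := by
  by_contra hne
  apply hdet
  apply Matrix.exists_mulVec_eq_zero_iff.mp
  refine ⟨v, fun h => hne (by ext i; simpa using congrFun h i), ?_⟩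
  ext i
  have := hv (coordVec i)
  nth_rewrite 1 [← sum_coordVec v] at this
  simpa [Matrix.mulVec, dotProduct, gramOf, mul_comm] using this

/-- A kernel vector of the Gram matrix would be isotropic. -/
lemma gramOf_det_ne_zero {B : F →L[ℝ] F →L[ℝ] ℝ}
    {D : EuclideanSpace ℝ (Fin n) →L[ℝ] F}
    (h : ∀ v, v ≠ 0 → B (D v) (D v) ≠ 0) : (gramOf (fun x y => B x y) D).det ≠ 0 := by
  intro hdet
  obtain ⟨v, hv, hv0⟩ := Matrix.exists_mulVec_eq_zero_iff.mpr hdet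
  set v' : EuclideanSpace ℝ (Fin n) := WithLp.toLp 2 v
  have hv' : v' ≠ 0 := fun h => hv (by
    ext i; simpa [v'] using congrArg (fun z : EuclideanSpace ℝ (Fin n) => z i) h)
  apply h v' hv'
  have key : ∀ i, B (D (coordVec i)) (D v') = 0 := by
    intro i
    have := congrFun hv0 i
    rw [← sum_coordVec v']
    simpa [Matrix.mulVec, dotProduct, gramOf, mul_comm, v'] using this
  exact eq_zero_of_forall_coordVec (L := B.flip (D v')) (by simpa using key) v'

lemma gramOf_ambL {D : EuclideanSpace ℝ (Fin n) →L[ℝ] Amb n} :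
    gramOf (fun x y => ambL n x y) D = gramOf amb D := by
  simp [gramOf, ambL_apply]

lemma gramOf_lorL {D : EuclideanSpace ℝ (Fin n) →L[ℝ] Mink n} :
    gramOf (fun x y => lorL n x y) D = gramOf lor D := by
  simp [gramOf, lorL_apply]

lemma gramOf_lor_transpose {D : EuclideanSpace ℝ (Fin n) →L[ℝ] Mink n} :
    (gramOf lor D).transpose = gramOf lor D := by
  ext i j; simp [gramOf, lor_comm]

/-- The matrix of a linear endomorphism in the coordinate basis. -/
def coordMatrix (C : EuclideanSpace ℝ (Fin n) →L[ℝ] EuclideanSpace ℝ (Fin n)) :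
    Matrix (Fin n) (Fin n) ℝ := Matrix.of fun i j => C (coordVec j) i

lemma sum_coordMatrix (C : EuclideanSpace ℝ (Fin n) →L[ℝ] EuclideanSpace ℝ (Fin n)) (j : Fin n) :
    C (coordVec j) = ∑ i, coordMatrix C i j • coordVec i := by
  rw [← sum_coordVec (C (coordVec j))]
  simp [coordMatrix]

lemma coordMatrix_comp (C C' : EuclideanSpace ℝ (Fin n) →L[ℝ] EuclideanSpace ℝ (Fin n)) :
    coordMatrix (C.comp C') = coordMatrix C * coordMatrix C' := by
  ext i j
  simp only [coordMatrix, Matrix.of_apply, Matrix.mul_apply, ContinuousLinearMap.comp_apply]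
  conv_lhs => rw [← sum_coordVec (C' (coordVec j))]
  simp [mul_comm]

lemma coordMatrix_id :
    coordMatrix (ContinuousLinearMap.id ℝ (EuclideanSpace ℝ (Fin n))) = 1 := by
  ext i j
  simp [coordMatrix, coordVec, Matrix.one_apply]

lemma isUnit_coordMatrix {C : EuclideanSpace ℝ (Fin n) →L[ℝ] EuclideanSpace ℝ (Fin n)}
    (hC : C.IsInvertible) : IsUnit (coordMatrix C) := by
  obtain ⟨e, rfl⟩ := hC
  have h : coordMatrix (e : EuclideanSpace ℝ (Fin n) →L[ℝ] EuclideanSpace ℝ (Fin n)) *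
      coordMatrix (e.symm : EuclideanSpace ℝ (Fin n) →L[ℝ] EuclideanSpace ℝ (Fin n)) = 1 := by
    rw [← coordMatrix_comp, e.coe_comp_coe_symm, coordMatrix_id]
  exact IsUnit.of_mul_eq_one _ h

/-- The matrix of a bilinear pairing in the coordinate basis changes by congruence. -/
lemma bilin_comp_matrix (b : EuclideanSpace ℝ (Fin n) →L[ℝ] EuclideanSpace ℝ (Fin n) →L[ℝ] ℝ)
    (C C' : EuclideanSpace ℝ (Fin n) →L[ℝ] EuclideanSpace ℝ (Fin n)) :
    (Matrix.of fun i j => b (C (coordVec i)) (C' (coordVec j))) =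
      (coordMatrix C).transpose * (Matrix.of fun i j => b (coordVec i) (coordVec j)) *
        coordMatrix C' := by
  ext i j
  simp only [Matrix.of_apply, Matrix.mul_apply, Matrix.transpose_apply]
  rw [sum_coordMatrix C, sum_coordMatrix C']
  simp only [map_sum, map_smul, sum_apply, smul_apply,
    smul_eq_mul, Finset.mul_sum, Finset.sum_mul]
  refine Finset.sum_congr rfl fun k _ => Finset.sum_congr rfl fun l _ => by ring

lemma gramOf_comp {B : F →L[ℝ] F →L[ℝ] ℝ} (D : EuclideanSpace ℝ (Fin n) →L[ℝ] F)
    (C : EuclideanSpace ℝ (Fin n) →L[ℝ] EuclideanSpace ℝ (Fin n)) :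
    gramOf (fun x y => B x y) (D.comp C) =
      (coordMatrix C).transpose * gramOf (fun x y => B x y) D * coordMatrix C :=
  bilin_comp_matrix (B.bilinearComp D D) C C

/-- The trace of a symmetric bilinear map with respect to a Gram matrix is independent of the
basis. -/
lemma trace_gram_congr {W : Type*} [NormedAddCommGroup W] [NormedSpace ℝ W]
    (h : EuclideanSpace ℝ (Fin n) →ₗ[ℝ] EuclideanSpace ℝ (Fin n) →ₗ[ℝ] W)
    (C : EuclideanSpace ℝ (Fin n) →L[ℝ] EuclideanSpace ℝ (Fin n)) (hC : C.IsInvertible)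
    (g : Matrix (Fin n) (Fin n) ℝ) :
    (∑ i, ∑ j, ((coordMatrix C).transpose * g * coordMatrix C)⁻¹ i j •
        h (C (coordVec i)) (C (coordVec j))) =
      ∑ i, ∑ j, g⁻¹ i j • h (coordVec i) (coordVec j) := by
  have hu := isUnit_coordMatrix hC
  set P := coordMatrix C with hP
  have hdet : IsUnit P.det := (Matrix.isUnit_iff_isUnit_det _).mp hu
  have hinv : (P.transpose * g * P)⁻¹ = P⁻¹ * g⁻¹ * P.transpose⁻¹ := by
    rw [Matrix.mul_inv_rev, Matrix.mul_inv_rev, Matrix.mul_assoc]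
  set K := (P.transpose * g * P)⁻¹ with hK
  -- Reversal of inverses holds for the total matrix inverse, so g may be singular; only P has to be
  -- invertible.
  have hg : g⁻¹ = P * K * P.transpose := by
    rw [hinv]
    have h1 : P * P⁻¹ = 1 := Matrix.mul_nonsing_inv _ hdet
    have h2 : P.transpose⁻¹ * P.transpose = 1 :=
      Matrix.nonsing_inv_mul _ (by rwa [Matrix.det_transpose])
    calc g⁻¹ = (P * P⁻¹) * g⁻¹ * (P.transpose⁻¹ * P.transpose) := by rw [h1, h2]; simp
      _ = _ := by simp only [Matrix.mul_assoc]
  rw [hg]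
  simp only [sum_coordMatrix C, ← hP, map_sum, map_smul, LinearMap.sum_apply, LinearMap.smul_apply,
    Finset.smul_sum, smul_smul, Matrix.mul_apply, Matrix.transpose_apply, Finset.sum_smul,
    Finset.sum_mul]
  have e1 : ∀ f : Fin n → Fin n → Fin n → Fin n → W,
      ∑ i, ∑ j, ∑ k, ∑ l, f i j k l = ∑ k, ∑ l, ∑ j, ∑ i, f i j k l := by
    intro f
    calc ∑ i, ∑ j, ∑ k, ∑ l, f i j k l = ∑ i, ∑ k, ∑ j, ∑ l, f i j k l :=
          Finset.sum_congr rfl fun i _ => Finset.sum_comm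
      _ = ∑ k, ∑ i, ∑ j, ∑ l, f i j k l := Finset.sum_comm
      _ = ∑ k, ∑ l, ∑ j, ∑ i, f i j k l := by
          refine Finset.sum_congr rfl fun k _ => ?_
          calc ∑ i, ∑ j, ∑ l, f i j k l = ∑ i, ∑ l, ∑ j, f i j k l :=
                Finset.sum_congr rfl fun i _ => Finset.sum_comm
            _ = ∑ l, ∑ i, ∑ j, f i j k l := Finset.sum_comm
            _ = _ := Finset.sum_congr rfl fun l _ => Finset.sum_comm
  rw [e1]
  rw [Finset.sum_comm]
  refine Finset.sum_congr rfl fun k _ => Finset.sum_congr rfl fun l _ =>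
    Finset.sum_congr rfl fun j _ => Finset.sum_congr rfl fun i _ => ?_
  congr 1; ring

end Gram

/-! ### The polynomial P as a function of a characteristic polynomial. -/

section RootPolynomial

/-- The polynomial `∑ i, m i * (κ i * s - 1) * ∏ j ≠ i, (s - κ j)` over the roots `κ i` of `q` with
their multiplicities `m i`. -/
def rootPoly (q : ℝ[X]) : ℝ[X] :=
  ∑ k ∈ q.roots.toFinset, (q.rootMultiplicity k : ℝ[X]) * (Polynomial.C k * Polynomial.X - 1) *
    ∏ l ∈ q.roots.toFinset.erase k, (Polynomial.X - Polynomial.C l)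

lemma natDegree_rootPoly_le (q : ℝ[X]) : (rootPoly q).natDegree ≤ q.roots.toFinset.card := by
  refine Polynomial.natDegree_sum_le_of_forall_le _ _ fun k hk => ?_
  have h1 : (∏ l ∈ q.roots.toFinset.erase k, (Polynomial.X - Polynomial.C l)).natDegree =
      q.roots.toFinset.card - 1 := by
    rw [Polynomial.natDegree_prod_of_monic _ _ fun l _ => Polynomial.monic_X_sub_C l]
    simp [Finset.card_erase_of_mem hk]
  have h2 : ((q.rootMultiplicity k : ℝ[X]) * (Polynomial.C k * Polynomial.X - 1)).natDegree ≤
      1 := by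
    rw [← Polynomial.C_eq_natCast]
    compute_degree
  have h3 : 0 < q.roots.toFinset.card := Finset.card_pos.mpr ⟨k, hk⟩
  refine Polynomial.natDegree_mul_le.trans ?_
  omega

/-- At a root κ of q only the summand of κ survives, with value m (κ² - 1) ∏ (κ - κ_j). This keeps
the roots of P with |s| > 1 away from the principal curvatures. -/
lemma eval_rootPoly_of_isRoot {q : ℝ[X]} {s : ℝ} (hq : q ≠ 0) (hs : q.IsRoot s) (hs1 : 1 < |s|) :
    (rootPoly q).eval s ≠ 0 := by
  have hmem : s ∈ q.roots.toFinset := by simpa [hq] using hs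
  have h0 : (rootPoly q).eval s = q.rootMultiplicity s * (s * s - 1) *
      ∏ l ∈ q.roots.toFinset.erase s, (s - l) := by
    rw [rootPoly, Polynomial.eval_finsetSum, Finset.sum_eq_single_of_mem s hmem]
    · simp [Polynomial.eval_prod]
    · intro k hk hks
      rw [Polynomial.eval_mul, Polynomial.eval_prod,
        Finset.prod_eq_zero (Finset.mem_erase.mpr ⟨hks.symm, hmem⟩) (by simp), mul_zero]
  rw [h0]
  refine mul_ne_zero (mul_ne_zero ?_ ?_) ?_
  · have := (Polynomial.rootMultiplicity_pos hq).mpr hs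
    positivity
  · have : 1 < s ^ 2 := by rw [← sq_abs]; nlinarith
    nlinarith
  · refine Finset.prod_ne_zero_iff.mpr fun l hl => sub_ne_zero.mpr ?_
    exact (Finset.mem_erase.mp hl).1.symm

/-- Dividing by the product over the distinct roots leaves ∑ m_k (k s - 1) / (s - k). Grouping equal
entries of d turns the multiplicities into a plain sum over indices. -/
lemma eval_rootPoly_prod {n : ℕ} (d : Fin n → ℝ) {s : ℝ} (hs : ∀ i, s ≠ d i) :
    (rootPoly (∏ i, (Polynomial.X - Polynomial.C (d i)))).eval s =
      (∏ k ∈ (∏ i, (Polynomial.X - Polynomial.C (d i))).roots.toFinset, (s - k)) *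
        ∑ i, (d i * s - 1) / (s - d i) := by
  set q : ℝ[X] := ∏ i, (Polynomial.X - Polynomial.C (d i)) with hq
  have hroots : q.roots = Finset.univ.val.map d := by
    rw [hq, Polynomial.roots_prod _ _ (Finset.prod_ne_zero_iff.mpr fun i _ =>
      Polynomial.X_sub_C_ne_zero (d i))]
    simp
  have hS : q.roots.toFinset = Finset.univ.image d := by
    ext k; simp [hroots]
  have hmult : ∀ k, q.rootMultiplicity k = (Finset.univ.filter fun i => d i = k).card := by
    intro k
    rw [← Polynomial.count_roots, hroots, Multiset.count_map]
    simp [Finset.card_def, eq_comm]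
  have hsum : ∑ i, (d i * s - 1) / (s - d i) =
      ∑ k ∈ q.roots.toFinset, (q.rootMultiplicity k : ℝ) * ((k * s - 1) / (s - k)) := by
    rw [hS, Finset.sum_comp (fun k => (k * s - 1) / (s - k)) d]
    simp [hmult]
  rw [hsum, rootPoly, Polynomial.eval_finsetSum, Finset.mul_sum]
  refine Finset.sum_congr rfl fun k hk => ?_
  have hk' : s - k ≠ 0 := by
    rw [hS] at hk
    obtain ⟨i, -, rfl⟩ := Finset.mem_image.mp hk
    exact sub_ne_zero.mpr (hs i)
  rw [← Finset.mul_prod_erase _ _ hk]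
  simp only [Polynomial.eval_mul, Polynomial.eval_natCast, Polynomial.eval_sub, Polynomial.eval_C,
    Polynomial.eval_X, Polynomial.eval_one, Polynomial.eval_prod]
  field_simp

end RootPolynomial

/-! ### Diagonalization of the shape operator and the trace formula. -/

section Diagonalization

variable {n : ℕ}

/-- A matrix that is symmetric for a scalar product is diagonalizable. -/
lemma exists_diagonalization {G L : Matrix (Fin n) (Fin n) ℝ} (hG : G.PosDef)
    (hL : L.transpose = L) :
    ∃ (P : (Matrix (Fin n) (Fin n) ℝ)ˣ) (d : Fin n → ℝ),
      G⁻¹ * L = P * Matrix.diagonal d * (P⁻¹ : (Matrix (Fin n) (Fin n) ℝ)ˣ) := by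
  have hGh : G.IsHermitian := hG.1
  have hpos : ∀ i, 0 < hGh.eigenvalues i := hG.eigenvalues_pos
  set U := (hGh.eigenvectorUnitary : Matrix (Fin n) (Fin n) ℝ) with hU
  have hUU : star U * U = 1 := Unitary.coe_star_mul_self _
  have hUU' : U * star U = 1 := Unitary.coe_mul_star_self _
  have hGs : G = U * Matrix.diagonal hGh.eigenvalues * star U := by
    conv_lhs => rw [hGh.spectral_theorem, Unitary.conjStarAlgAut_apply]
    rfl
  set r : Fin n → ℝ := fun i => (√(hGh.eigenvalues i))⁻¹ with hr
  -- The columns of R form a basis orthonormal for G: the eigenvectors of G rescaled by λ^{-1/2}.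
  set R := U * Matrix.diagonal r with hR
  have hRG : R.transpose * G * R = 1 := by
    have h1 : R.transpose = Matrix.diagonal r * star U := by
      rw [hR, Matrix.transpose_mul, Matrix.diagonal_transpose, Matrix.star_eq_conjTranspose,
        Matrix.conjTranspose_eq_transpose_of_trivial]
    rw [h1, hR]
    calc Matrix.diagonal r * star U * G * (U * Matrix.diagonal r)
        = Matrix.diagonal r * (star U * U) * Matrix.diagonal hGh.eigenvalues * (star U * U) *
            Matrix.diagonal r := by
          conv_lhs => rw [hGs]
          simp only [Matrix.mul_assoc]
      _ = 1 := by
          rw [hUU, Matrix.mul_one, Matrix.mul_one, Matrix.diagonal_mul_diagonal,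
            Matrix.diagonal_mul_diagonal, ← Matrix.diagonal_one]
          congr 1
          ext i
          have h2 : √(hGh.eigenvalues i) ≠ 0 := (Real.sqrt_pos.mpr (hpos i)).ne'
          have h3 := Real.mul_self_sqrt (hpos i).le
          simp only [hr]
          field_simp
          nlinarith
  clear_value R
  have hRu : IsUnit R := IsUnit.of_mul_eq_one_right _ hRG
  have hRdet := (Matrix.isUnit_iff_isUnit_det _).mp hRu
  have hGinv : G⁻¹ = R * R.transpose := by
    apply Matrix.inv_eq_left_inv
    have h2 : R.transpose * G = R⁻¹ := (Matrix.inv_eq_left_inv hRG).symm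
    rw [Matrix.mul_assoc, h2, Matrix.mul_nonsing_inv _ hRdet]
  -- In the orthonormal basis L is again symmetric. Since G⁻¹ = R Rᵀ, the matrix G⁻¹ L is conjugate
  -- by R to Rᵀ L R, and the spectral theorem applies a second time.
  have hS : (R.transpose * L * R).IsHermitian := by
    rw [Matrix.IsHermitian, Matrix.conjTranspose_eq_transpose_of_trivial, Matrix.transpose_mul,
      Matrix.transpose_mul, Matrix.transpose_transpose, hL, Matrix.mul_assoc]
  set V := (hS.eigenvectorUnitary : Matrix (Fin n) (Fin n) ℝ) with hV
  have hVV : star V * V = 1 := Unitary.coe_star_mul_self _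
  have hVV' : V * star V = 1 := Unitary.coe_mul_star_self _
  have hSs : R.transpose * L * R = V * Matrix.diagonal hS.eigenvalues * star V := by
    conv_lhs => rw [hS.spectral_theorem, Unitary.conjStarAlgAut_apply]
    rfl
  refine ⟨⟨R * V, star V * R⁻¹, ?_, ?_⟩, hS.eigenvalues, ?_⟩
  · calc R * V * (star V * R⁻¹) = R * (V * star V) * R⁻¹ := by simp only [Matrix.mul_assoc]
      _ = 1 := by rw [hVV', Matrix.mul_one, Matrix.mul_nonsing_inv _ hRdet]
  · calc star V * R⁻¹ * (R * V) = star V * (R⁻¹ * R) * V := by simp only [Matrix.mul_assoc]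
      _ = 1 := by rw [Matrix.nonsing_inv_mul _ hRdet, Matrix.mul_one, hVV]
  · calc G⁻¹ * L = R * (R.transpose * L * R) * R⁻¹ := by
          rw [hGinv]
          simp only [Matrix.mul_assoc, Matrix.mul_nonsing_inv _ hRdet, Matrix.mul_one]
      _ = R * (V * Matrix.diagonal hS.eigenvalues * star V) * R⁻¹ := by rw [← hSs]
      _ = _ := by simp only [Matrix.mul_assoc, Units.inv_mk]

variable {A : Matrix (Fin n) (Fin n) ℝ} {P : (Matrix (Fin n) (Fin n) ℝ)ˣ} {d : Fin n → ℝ}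

lemma charpoly_of_diagonalization
    (hA : A = P * Matrix.diagonal d * (P⁻¹ : (Matrix (Fin n) (Fin n) ℝ)ˣ)) :
    A.charpoly = ∏ i, (Polynomial.X - Polynomial.C (d i)) := by
  rw [hA, Matrix.coe_units_inv, Matrix.charpoly_units_conj, Matrix.charpoly_diagonal]

/-- A - k is conjugate to diag(d_i - k), whose rank counts the nonzero entries; rank-nullity then
makes geometric and algebraic multiplicities agree. -/
lemma finrank_eigenspace_of_diagonalization
    (hA : A = P * Matrix.diagonal d * (P⁻¹ : (Matrix (Fin n) (Fin n) ℝ)ˣ)) (k : ℝ) :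
    Module.finrank ℝ (Module.End.eigenspace
      (Matrix.toLin (EuclideanSpace.basisFun (Fin n) ℝ).toBasis
        (EuclideanSpace.basisFun (Fin n) ℝ).toBasis A) k) = A.charpoly.rootMultiplicity k := by
  set b := (EuclideanSpace.basisFun (Fin n) ℝ).toBasis
  have hroots : A.charpoly.roots = Finset.univ.val.map d := by
    rw [charpoly_of_diagonalization hA, Polynomial.roots_prod _ _
      (Finset.prod_ne_zero_iff.mpr fun i _ => Polynomial.X_sub_C_ne_zero (d i))]
    simp
  rw [← Polynomial.count_roots, hroots, Multiset.count_map, Module.End.eigenspace_def]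
  have h1 : Matrix.toLin b b A - k • (1 : Module.End ℝ (EuclideanSpace ℝ (Fin n))) =
      Matrix.toLin b b (P * Matrix.diagonal (fun i => d i - k) *
        (P⁻¹ : (Matrix (Fin n) (Fin n) ℝ)ˣ)) := by
    have h2 : Matrix.diagonal (fun i => d i - k) =
        Matrix.diagonal d - k • (1 : Matrix (Fin n) (Fin n) ℝ) := by
      rw [← Matrix.diagonal_one, ← Matrix.diagonal_smul, Matrix.diagonal_sub]
      simp
    rw [h2, Matrix.mul_sub, Matrix.sub_mul, ← hA, map_sub]
    congr 1
    simp [Matrix.toLin_one, Module.End.one_eq_id]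
  rw [h1]
  set M := (P * Matrix.diagonal (fun i => d i - k) *
        (P⁻¹ : (Matrix (Fin n) (Fin n) ℝ)ˣ) : Matrix (Fin n) (Fin n) ℝ) with hM
  have h3 := LinearMap.finrank_range_add_finrank_ker (Matrix.toLin b b M)
  rw [← Matrix.rank_eq_finrank_range_toLin, hM, Matrix.rank_mul_eq_left_of_isUnit_det,
    Matrix.rank_mul_eq_right_of_isUnit_det, Matrix.rank_diagonal, ← hM, Fintype.card_subtype] at h3
  · have h4 := Finset.card_filter_add_card_filter_not (s := (Finset.univ : Finset (Fin n)))
      (fun i => d i - k ≠ 0)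
    simp only [finrank_euclideanSpace, Fintype.card_fin, Finset.card_univ] at h3 h4
    have h5 : Multiset.card (Multiset.filter (fun a => k = d a) Finset.univ.val) =
        (Finset.univ.filter fun i => ¬ (d i - k ≠ 0)).card := by
      rw [Finset.card_def, Finset.filter_val]
      congr 1
      refine Multiset.filter_congr fun i _ => ?_
      simp [sub_eq_zero, eq_comm]
    rw [h5]
    omega
  · exact (Matrix.isUnit_iff_isUnit_det _).mp P.isUnit
  · exact (Matrix.isUnit_iff_isUnit_det _).mp (P⁻¹).isUnit

/-- The trace of `adj (s - A) (s A - 1)` in terms of the root polynomial of the characteristic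
polynomial. -/
lemma trace_adjugate_mul_eq
    (hA : A = P * Matrix.diagonal d * (P⁻¹ : (Matrix (Fin n) (Fin n) ℝ)ˣ)) {s : ℝ}
    (hs : ¬ A.charpoly.IsRoot s) :
    (∏ k ∈ A.charpoly.roots.toFinset, (s - k)) *
      ((s • 1 - A)⁻¹ * (s • A - 1)).trace = (rootPoly A.charpoly).eval s := by
  have hsd : ∀ i, s ≠ d i := by
    intro i hi
    apply hs
    rw [charpoly_of_diagonalization hA, Polynomial.IsRoot, Polynomial.eval_prod]
    exact Finset.prod_eq_zero (Finset.mem_univ i) (by simp [hi])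
  have hPP : (P : Matrix (Fin n) (Fin n) ℝ) * (P⁻¹ : (Matrix (Fin n) (Fin n) ℝ)ˣ) = 1 :=
    Units.mul_inv P
  have hPP' : ((P⁻¹ : (Matrix (Fin n) (Fin n) ℝ)ˣ) : Matrix (Fin n) (Fin n) ℝ) * P = 1 :=
    Units.inv_mul P
  have e1 : (s • 1 - A) = P * Matrix.diagonal (fun i => s - d i) *
      (P⁻¹ : (Matrix (Fin n) (Fin n) ℝ)ˣ) := by
    have h2 : Matrix.diagonal (fun i => s - d i) =
        s • (1 : Matrix (Fin n) (Fin n) ℝ) - Matrix.diagonal d := by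
      rw [← Matrix.diagonal_one, ← Matrix.diagonal_smul, Matrix.diagonal_sub]
      simp
    rw [h2, Matrix.mul_sub, Matrix.sub_mul, ← hA]
    simp
  have e2 : (s • 1 - A)⁻¹ = P * Matrix.diagonal (fun i => (s - d i)⁻¹) *
      (P⁻¹ : (Matrix (Fin n) (Fin n) ℝ)ˣ) := by
    apply Matrix.inv_eq_left_inv
    rw [e1]
    calc _ = (P : Matrix (Fin n) (Fin n) ℝ) * (Matrix.diagonal (fun i => (s - d i)⁻¹) *
          (((P⁻¹ : (Matrix (Fin n) (Fin n) ℝ)ˣ) : Matrix (Fin n) (Fin n) ℝ) * P) *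
          Matrix.diagonal (fun i => s - d i)) * (P⁻¹ : (Matrix (Fin n) (Fin n) ℝ)ˣ) := by
          simp only [Matrix.mul_assoc]
      _ = 1 := by
          rw [hPP', Matrix.mul_one, Matrix.diagonal_mul_diagonal]
          have : (fun i => (s - d i)⁻¹ * (s - d i)) = fun _ => 1 := by
            ext i; exact inv_mul_cancel₀ (sub_ne_zero.mpr (hsd i))
          rw [this, Matrix.diagonal_one, Matrix.mul_one, hPP]
  have e3 : (s • A - 1) = P * Matrix.diagonal (fun i => d i * s - 1) *
      (P⁻¹ : (Matrix (Fin n) (Fin n) ℝ)ˣ) := by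
    have h2 : Matrix.diagonal (fun i => d i * s - 1) =
        s • Matrix.diagonal d - (1 : Matrix (Fin n) (Fin n) ℝ) := by
      rw [← Matrix.diagonal_one, ← Matrix.diagonal_smul, Matrix.diagonal_sub]
      simp [mul_comm]
    rw [h2, Matrix.mul_sub, Matrix.sub_mul, Matrix.mul_smul, Matrix.smul_mul, ← hA]
    simp
  have e4 : ((s • 1 - A)⁻¹ * (s • A - 1)).trace = ∑ i, (d i * s - 1) / (s - d i) := by
    rw [e2, e3]
    calc _ = ((P : Matrix (Fin n) (Fin n) ℝ) * (Matrix.diagonal (fun i => (s - d i)⁻¹) *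
          (((P⁻¹ : (Matrix (Fin n) (Fin n) ℝ)ˣ) : Matrix (Fin n) (Fin n) ℝ) * P) *
          Matrix.diagonal (fun i => d i * s - 1)) *
            (P⁻¹ : (Matrix (Fin n) (Fin n) ℝ)ˣ)).trace := by
          simp only [Matrix.mul_assoc]
      _ = _ := by
          rw [hPP', Matrix.mul_one, Matrix.diagonal_mul_diagonal, Matrix.trace_mul_comm,
            ← Matrix.mul_assoc, hPP', Matrix.one_mul, Matrix.trace_diagonal]
          exact Finset.sum_congr rfl fun i _ => by rw [div_eq_inv_mul]
  rw [e4, charpoly_of_diagonalization hA, eval_rootPoly_prod d hsd]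

end Diagonalization

/-! ### Derivatives in flat space, of pairings, and of matrix inverses. -/

section Flat

variable {n : ℕ} {F : Type*} [NormedAddCommGroup F] [NormedSpace ℝ F]

lemma differential_eq_fderiv (f : EuclideanSpace ℝ (Fin n) → F) (p : EuclideanSpace ℝ (Fin n)) :
    differential f p = fderiv ℝ f p := by
  simp [differential, mfderiv_eq_fderiv]

lemma secondDeriv_eq_fderiv (f : EuclideanSpace ℝ (Fin n) → F) (p : EuclideanSpace ℝ (Fin n)) :
    secondDeriv f p = fderiv ℝ (fderiv ℝ f) p := by
  simp [secondDeriv, chartAt_self_eq]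

lemma gram_eq_gramOf {M : Type*} [TopologicalSpace M] [ChartedSpace (EuclideanSpace ℝ (Fin n)) M]
    (B : F → F → ℝ) (f : M → F) (x : M) : gram (n := n) B f x = gramOf B (differential f x) := rfl

end Flat

section LorCalculus

variable {n : ℕ} {E : Type*} [NormedAddCommGroup E] [NormedSpace ℝ E]

lemma hasFDerivAt_lor {f g : E → Mink n} {p : E} (hf : DifferentiableAt ℝ f p)
    (hg : DifferentiableAt ℝ g p) :
    DifferentiableAt ℝ (fun y => lor (f y) (g y)) p ∧
      ∀ v, fderiv ℝ (fun y => lor (f y) (g y)) p v =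
        lor (fderiv ℝ f p v) (g p) + lor (f p) (fderiv ℝ g p v) := by
  have h := (lorL n).hasFDerivAt_of_bilinear hf.hasFDerivAt hg.hasFDerivAt
  simp only [lorL_apply] at h
  refine ⟨h.differentiableAt, fun v => ?_⟩
  rw [h.fderiv]
  simp [ContinuousLinearMap.precompR, ContinuousLinearMap.precompL, lorL_apply, add_comm]

lemma lor_fderiv_add_eq_zero {f g : E → Mink n} {p : E} {c : ℝ} (hf : DifferentiableAt ℝ f p)
    (hg : DifferentiableAt ℝ g p) (h : ∀ᶠ y in 𝓝 p, lor (f y) (g y) = c) (v : E) :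
    lor (fderiv ℝ f p v) (g p) + lor (f p) (fderiv ℝ g p v) = 0 := by
  rw [← (hasFDerivAt_lor hf hg).2 v, Filter.EventuallyEq.fderiv_eq (f := fun _ => c) h]
  simp

lemma lor_fderiv_self_eq_zero {f : E → Mink n} {p : E} {c : ℝ} (hf : DifferentiableAt ℝ f p)
    (h : ∀ᶠ y in 𝓝 p, lor (f y) (f y) = c) (v : E) :
    lor (fderiv ℝ f p v) (f p) = 0 := by
  have := lor_fderiv_add_eq_zero hf hf h v
  rw [lor_comm (f p)] at this
  linarith

lemma ContDiffAt.lor {f g : E → Mink n} {p : E} {k : ℕ∞ω} (hf : ContDiffAt ℝ k f p)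
    (hg : ContDiffAt ℝ k g p) : ContDiffAt ℝ k (fun y => TrappedHyp.lor (f y) (g y)) p := by
  have := (lorL n).isBoundedBilinearMap.contDiff.contDiffAt.comp p (hf.prodMk hg)
  simpa only [Function.comp_def, lorL_apply] using this

lemma ContDiffAt.amb {f g : E → Amb n} {p : E} {k : ℕ∞ω} (hf : ContDiffAt ℝ k f p)
    (hg : ContDiffAt ℝ k g p) : ContDiffAt ℝ k (fun y => TrappedHyp.amb (f y) (g y)) p := by
  have := (ambL n).isBoundedBilinearMap.contDiff.contDiffAt.comp p (hf.prodMk hg)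
  simpa only [Function.comp_def, ambL_apply] using this

end LorCalculus

section MatrixCalculus

variable {m : ℕ} {E : Type*} [NormedAddCommGroup E] [NormedSpace ℝ E] {k : ℕ∞ω}
  {A : E → Matrix (Fin m) (Fin m) ℝ} {p : E}

lemma contDiffAt_det (hA : ∀ i j, ContDiffAt ℝ k (fun y => A y i j) p) :
    ContDiffAt ℝ k (fun y => (A y).det) p := by
  simp only [Matrix.det_apply]
  exact ContDiffAt.sum fun σ _ => (contDiffAt_prod fun i _ => hA _ _).const_smul _

lemma contDiffAt_adjugate (hA : ∀ i j, ContDiffAt ℝ k (fun y => A y i j) p) (i j : Fin m) :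
    ContDiffAt ℝ k (fun y => (A y).adjugate i j) p := by
  simp only [Matrix.adjugate_apply]
  refine contDiffAt_det fun a b => ?_
  simp only [Matrix.updateRow_apply]
  split_ifs
  · exact contDiffAt_const
  · exact hA a b

lemma contDiffAt_inv (hA : ∀ i j, ContDiffAt ℝ k (fun y => A y i j) p) (hdet : (A p).det ≠ 0)
    (i j : Fin m) : ContDiffAt ℝ k (fun y => (A y)⁻¹ i j) p := by
  simp only [Matrix.inv_def, Ring.inverse_eq_inv', Matrix.smul_apply, smul_eq_mul]
  exact ((contDiffAt_det hA).inv hdet).mul (contDiffAt_adjugate hA i j)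

end MatrixCalculus

/-! ### The normal projection and the second fundamental form. -/

section NormalProjection

variable {n : ℕ} {M : Type*} [TopologicalSpace M] [ChartedSpace (EuclideanSpace ℝ (Fin n)) M]

/-- The pointwise conditions under which the normal projection of `Φ` at `x` is well behaved. -/
structure IsNondegAt (Φ : M → Amb n) (x : M) : Prop where
  unit : lor (Φ x).1 (Φ x).1 = -1
  tangent : ∀ v : EuclideanSpace ℝ (Fin n), lor (differential Φ x v).1 (Φ x).1 = 0
  det : (gram amb Φ x : Matrix (Fin n) (Fin n) ℝ).det ≠ 0

variable {Φ : M → Amb n} {x : M}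

lemma IsNondegAt.eq_zero (h : IsNondegAt Φ x) {v : EuclideanSpace ℝ (Fin n)}
    (hv : ∀ w, amb (differential (n := n) Φ x w) (differential (n := n) Φ x v) = 0) : v = 0 := by
  have hdet := h.det
  rw [gram_eq_gramOf, ← gramOf_ambL] at hdet
  exact eq_zero_of_gramOf_det_ne_zero hdet (by simpa [ambL_apply] using hv)

/-- The tangential vector removed by the normal projection. -/
def tangentCoord (Φ : M → Amb n) (x : M) (w : Amb n) : EuclideanSpace ℝ (Fin n) :=
  ∑ i : Fin n, ∑ j : Fin n,
        ((gram (n := n) amb Φ x)⁻¹ i j * amb w (differential (n := n) Φ x (coordVec i))) •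
          coordVec j

lemma normalPart_eq (Φ : M → Amb n) (x : M) (w : Amb n) :
    normalPart Φ x w = w + lor w.1 (Φ x).1 • ((Φ x).1, (0 : ℝ)) -
      differential (n := n) Φ x (tangentCoord Φ x w) := by
  simp [normalPart, tangentCoord]

/-- The coordinates carry the factor G⁻¹, which cancels the Gram matrix G produced by pairing with
tangent vectors. -/
lemma IsNondegAt.amb_tangentCoord (h : IsNondegAt Φ x) (w : Amb n)
    (v : EuclideanSpace ℝ (Fin n)) :
    amb (differential (n := n) Φ x (tangentCoord Φ x w)) (differential (n := n) Φ x v) =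
      amb w (differential (n := n) Φ x v) := by
  have key : ∀ k, amb (differential (n := n) Φ x (tangentCoord Φ x w))
      (differential (n := n) Φ x (coordVec k)) =
        amb w (differential (n := n) Φ x (coordVec k)) := by
    intro k
    have h1 : ∀ i j, amb (differential (n := n) Φ x (coordVec i))
        (differential (n := n) Φ x (coordVec j)) =
        gram (n := n) amb Φ x i j := fun i j => rfl
    simp only [tangentCoord, map_sum, map_smul, amb_sum_left, amb_smul_left, h1]
    have h2 : ∀ i, ∑ j, (gram (n := n) amb Φ x)⁻¹ i j * gram (n := n) amb Φ x j k =
        (1 : Matrix (Fin n) (Fin n) ℝ) i k := by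
      intro i
      rw [← Matrix.mul_apply, Matrix.nonsing_inv_mul _ h.det.isUnit]
    calc _ = ∑ i, amb w (differential (n := n) Φ x (coordVec i)) *
          ∑ j, (gram (n := n) amb Φ x)⁻¹ i j * gram (n := n) amb Φ x j k := by
          refine Finset.sum_congr rfl fun i _ => ?_
          rw [Finset.mul_sum]
          exact Finset.sum_congr rfl fun j _ => by ring
      _ = _ := by simp [h2, Matrix.one_apply]
  have := eq_zero_of_forall_coordVec (D := differential (n := n) Φ x)
    (L := ambL n (differential (n := n) Φ x (tangentCoord Φ x w) - w))
    (by intro k; rw [ambL_apply, amb_sub_left, key k, sub_self]) v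
  rw [ambL_apply, amb_sub_left] at this
  linarith

lemma IsNondegAt.isNormalAt_normalPart (h : IsNondegAt Φ x) (w : Amb n) :
    IsNormalAt Φ x (normalPart Φ x w) := by
  rw [normalPart_eq]
  constructor
  · simp [lor_sub_left, lor_add_left, lor_smul_left, h.unit, h.tangent]
  · intro v
    have h1 : amb ((Φ x).1, (0 : ℝ)) (differential (n := n) Φ x v) = 0 := by
      rw [amb_comm, amb]; simp [h.tangent]
    rw [amb_sub_left, amb_add_left, amb_smul_left, h.amb_tangentCoord, h1]
    ring

/-- Two candidates for the normal part differ by a vector that is both tangent and normal, which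
vanishes by non-degeneracy. This allows second derivatives to be changed by tangent vectors when
charts are compared. -/
lemma IsNondegAt.normalPart_unique (h : IsNondegAt Φ x) {w u : Amb n} {a : ℝ}
    {v : EuclideanSpace ℝ (Fin n)} (hu : IsNormalAt Φ x u)
    (hw : w = u + a • ((Φ x).1, (0 : ℝ)) + differential (n := n) Φ x v) : normalPart Φ x w = u := by
  have ha : lor w.1 (Φ x).1 = - a := by
    rw [hw]
    simp [lor_add_left, lor_smul_left, h.unit, h.tangent, hu.1]
  have h2 := normalPart_eq Φ x w
  have hN := h.isNormalAt_normalPart w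
  have h3 : normalPart Φ x w - u = differential (n := n) Φ x (v - tangentCoord Φ x w) := by
    rw [h2, ha, hw, map_sub]
    module
  have h4 : v - tangentCoord Φ x w = 0 := by
    apply h.eq_zero
    intro z
    rw [← h3, amb_comm, amb_sub_left, hN.2, hu.2, sub_zero]
  rw [h4, map_zero, sub_eq_zero] at h3
  exact h3

/-- The removed components are orthogonal to N, so pairings with normals need no projection and no
non-degeneracy. -/
lemma amb_normalPart {N : Amb n} (hN : IsNormalAt Φ x N)
    (w : Amb n) : amb (normalPart Φ x w) N = amb w N := by
  have h1 : amb ((Φ x).1, (0 : ℝ)) N = 0 := by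
    rw [amb_comm, amb]; simp [hN.1]
  rw [normalPart_eq, amb_sub_left, amb_add_left, amb_smul_left, h1,
    amb_comm (differential (n := n) Φ x _), hN.2]
  ring

lemma normalPart_add (w w' : Amb n) :
    normalPart Φ x (w + w') = normalPart Φ x w + normalPart Φ x w' := by
  have : tangentCoord Φ x (w + w') = tangentCoord Φ x w + tangentCoord Φ x w' := by
    simp only [tangentCoord, amb_add_left, mul_add, add_smul, Finset.sum_add_distrib]
  rw [normalPart_eq, normalPart_eq, normalPart_eq, this, map_add, Prod.fst_add, lor_add_left]
  module

lemma normalPart_smul (c : ℝ) (w : Amb n) :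
    normalPart Φ x (c • w) = c • normalPart Φ x w := by
  have : tangentCoord Φ x (c • w) = c • tangentCoord Φ x w := by
    simp only [tangentCoord, amb_smul_left, Finset.smul_sum, smul_smul]
    exact Finset.sum_congr rfl fun i _ => Finset.sum_congr rfl fun j _ => by congr 1; ring
  rw [normalPart_eq, normalPart_eq, this, map_smul, Prod.smul_fst, lor_smul_left]
  module

/-- The second fundamental form as a bilinear map. -/
def secondFormL (Φ : M → Amb n) (x : M) :
    EuclideanSpace ℝ (Fin n) →ₗ[ℝ] EuclideanSpace ℝ (Fin n) →ₗ[ℝ] Amb n :=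
  LinearMap.mk₂ ℝ (secondForm Φ x)
    (by intros; simp [secondForm, normalPart_add]) (by intros; simp [secondForm, normalPart_smul])
    (by intros; simp [secondForm, normalPart_add]) (by intros; simp [secondForm, normalPart_smul])

lemma secondFormL_apply (v w : EuclideanSpace ℝ (Fin n)) :
    secondFormL Φ x v w = secondForm Φ x v w := rfl

lemma IsNormalAt.add {u w : Amb n} (hu : IsNormalAt Φ x u) (hw : IsNormalAt Φ x w) :
    IsNormalAt Φ x (u + w) := by
  refine ⟨?_, fun v => ?_⟩
  · rw [Prod.fst_add, lor_add_left, hu.1, hw.1, add_zero]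
  · rw [amb_add_left, hu.2, hw.2, add_zero]

lemma IsNormalAt.smul {u : Amb n} (c : ℝ) (hu : IsNormalAt Φ x u) : IsNormalAt Φ x (c • u) := by
  refine ⟨?_, fun v => ?_⟩
  · rw [Prod.smul_fst, lor_smul_left, hu.1, mul_zero]
  · rw [amb_smul_left, hu.2, mul_zero]

lemma IsNormalAt.sum {ι : Type*} (s : Finset ι) {f : ι → Amb n}
    (h : ∀ i ∈ s, IsNormalAt Φ x (f i)) : IsNormalAt Φ x (∑ i ∈ s, f i) := by
  classical
  induction s using Finset.induction_on with
  | empty => exact ⟨by simp [lor_zero_left], fun v => by simp [amb_zero_left]⟩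
  | insert a s ha ih =>
    rw [Finset.sum_insert ha]
    exact (h a (Finset.mem_insert_self _ _)).add
      (ih fun i hi => h i (Finset.mem_insert_of_mem hi))

lemma IsNondegAt.isNormalAt_meanCurv (h : IsNondegAt Φ x) : IsNormalAt Φ x (meanCurv Φ x) :=
  .sum _ fun _ _ => .sum _ fun _ _ => (h.isNormalAt_normalPart _).smul _

/-- A nonzero null normal vector can be normalised to have vertical component `1`. -/
lemma IsNondegAt.exists_null_normal (h : IsNondegAt Φ x) {w : Amb n} (hw : IsNormalAt Φ x w)
    (hnull : amb w w = 0) (hw0 : w ≠ 0) :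
    ∃ q : Mink n, lor q q = 1 ∧ IsNormalAt Φ x (q, 1) ∧ w = w.2 • (q, (1 : ℝ)) := by
  have h2 := snd_ne_zero_of_null h.unit hw.1 hnull hw0
  have h3 : w.2⁻¹ • w = (w.2⁻¹ • w.1, (1 : ℝ)) := by
    ext <;> simp [h2]
  refine ⟨w.2⁻¹ • w.1, ?_, ?_, ?_⟩
  · simp only [amb] at hnull
    rw [lor_smul_left, lor_smul_right]
    field_simp
    linarith
  · rw [← h3]; exact hw.smul _
  · rw [← h3, smul_smul, mul_inv_cancel₀ h2, one_smul]

end NormalProjection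

/-- The last term lies in the image of dg; for immersions it is tangent and disappears under the
normal projection. -/
lemma fderiv_fderiv_comp {E E' F : Type*} [NormedAddCommGroup E] [NormedSpace ℝ E]
    [NormedAddCommGroup E'] [NormedSpace ℝ E'] [NormedAddCommGroup F] [NormedSpace ℝ F]
    {g : E' → F} {c : E → E'} {p : E} (hg : ContDiffAt ℝ 2 g (c p)) (hc : ContDiffAt ℝ 2 c p)
    (v w : E) : fderiv ℝ (fderiv ℝ (g ∘ c)) p v w =
      fderiv ℝ (fderiv ℝ g) (c p) (fderiv ℝ c p v) (fderiv ℝ c p w) +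
        fderiv ℝ g (c p) (fderiv ℝ (fderiv ℝ c) p v w) := by
  have hg1 : ∀ᶠ q in 𝓝 (c p), DifferentiableAt ℝ g q :=
    (hg.eventually (by simp)).mono fun q hq => hq.differentiableAt (by simp)
  have hc1 : ∀ᶠ q in 𝓝 p, DifferentiableAt ℝ c q :=
    (hc.eventually (by simp)).mono fun q hq => hq.differentiableAt (by simp)
  have h1 : fderiv ℝ (g ∘ c) =ᶠ[𝓝 p] fun q => (fderiv ℝ g (c q)).comp (fderiv ℝ c q) := by
    filter_upwards [hc1, hc.continuousAt.eventually hg1] with q h1 h2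
    exact fderiv_comp q h2 h1
  have hdg : DifferentiableAt ℝ (fderiv ℝ g) (c p) :=
    (hg.fderiv_right (m := 1) (by norm_num)).differentiableAt (by simp)
  have hdc : DifferentiableAt ℝ (fderiv ℝ c) p :=
    (hc.fderiv_right (m := 1) (by norm_num)).differentiableAt (by simp)
  have h2 := (hdg.hasFDerivAt.comp p (hc.differentiableAt (by simp)).hasFDerivAt).clm_comp
    hdc.hasFDerivAt
  rw [h1.fderiv_eq]
  erw [h2.fderiv]
  simp [add_comm]

/-! ### Passing to a fixed chart. -/

section Transfer

variable {n : ℕ} {M : Type*} [TopologicalSpace M] [ChartedSpace (EuclideanSpace ℝ (Fin n)) M]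
  {F : Type*} [NormedAddCommGroup F] [NormedSpace ℝ F]

/-- The expression of a map in the chart at `x`. -/
def inChart (x : M) (f : M → F) : EuclideanSpace ℝ (Fin n) → F :=
  f ∘ (extChartAt (𝓡 n) x).symm

/-- The derivative at `y` of the chart at `x`. -/
def chartDeriv (x y : M) : EuclideanSpace ℝ (Fin n) →L[ℝ] EuclideanSpace ℝ (Fin n) :=
  mfderiv (𝓡 n) 𝓘(ℝ, EuclideanSpace ℝ (Fin n)) (extChartAt (𝓡 n) x) y

variable {f g : M → F} {x y : M}

lemma inChart_apply {F : Type*} {x y : M} (f : M → F) (hy : y ∈ (extChartAt (𝓡 n) x).source) :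
    inChart x f (extChartAt (𝓡 n) x y) = f y := by
  rw [inChart, Function.comp_apply, (extChartAt (𝓡 n) x).left_inv hy]

lemma inChart_comp_eventuallyEq {F : Type*} (f : M → F) (hy : y ∈ (extChartAt (𝓡 n) x).source) :
    inChart x f ∘ extChartAt (𝓡 n) x =ᶠ[𝓝 y] f := by
  filter_upwards [(isOpen_extChartAt_source x).mem_nhds hy] with z hz
  exact inChart_apply f hz

lemma differential_congr (h : f =ᶠ[𝓝 x] g) : differential (n := n) f x = differential g x :=
  h.mfderiv_eq

lemma differential_eq_fderiv_inChart (hf : MDifferentiableAt (𝓡 n) 𝓘(ℝ, F) f x) :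
    differential (n := n) f x = fderiv ℝ (inChart x f) (extChartAt (𝓡 n) x x) := by
  rw [differential, hf.mfderiv]
  simp [writtenInExtChartAt, inChart, fderivWithin_univ, chartAt_self_eq]

/-- The part of the domain of the chart at `x` corresponding to `U`. -/
def chartDomain (x : M) (U : Set M) : Set (EuclideanSpace ℝ (Fin n)) :=
  (extChartAt (𝓡 n) x).target ∩ (extChartAt (𝓡 n) x).symm ⁻¹' U

lemma isOpen_chartDomain (x : M) {U : Set M} (hU : IsOpen U) :
    IsOpen (chartDomain x U : Set (EuclideanSpace ℝ (Fin n))) :=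
  (continuousOn_extChartAt_symm x).isOpen_inter_preimage (isOpen_extChartAt_target x) hU

lemma mem_chartDomain {U : Set M} (hyU : y ∈ U) (hy : y ∈ (extChartAt (𝓡 n) x).source) :
    extChartAt (𝓡 n) x y ∈ chartDomain (n := n) x U := by
  refine ⟨(extChartAt (𝓡 n) x).map_source hy, ?_⟩
  rwa [Set.mem_preimage, (extChartAt (𝓡 n) x).left_inv hy]

lemma exists_of_mem_chartDomain {U : Set M} {p : EuclideanSpace ℝ (Fin n)}
    (hp : p ∈ chartDomain (n := n) x U) :
    ∃ y ∈ U, y ∈ (extChartAt (𝓡 n) x).source ∧ extChartAt (𝓡 n) x y = p :=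
  ⟨_, hp.2, (extChartAt (𝓡 n) x).map_target hp.1, (extChartAt (𝓡 n) x).right_inv hp.1⟩

variable [IsManifold (𝓡 n) ∞ M]

lemma chartDeriv_isInvertible (hy : y ∈ (extChartAt (𝓡 n) x).source) :
    (chartDeriv x y : EuclideanSpace ℝ (Fin n) →L[ℝ] EuclideanSpace ℝ (Fin n)).IsInvertible := by
  have : IsManifold (𝓡 n) 1 M := .of_le (n := ∞) (by exact_mod_cast le_top)
  exact isInvertible_mfderiv_extChartAt hy

lemma contMDiffAt_extChart {k : ℕ∞ω} (hk : k ≤ ∞) (hy : y ∈ (extChartAt (𝓡 n) x).source) :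
    ContMDiffAt (𝓡 n) 𝓘(ℝ, EuclideanSpace ℝ (Fin n)) k (extChartAt (𝓡 n) x) y := by
  have : IsManifold (𝓡 n) k M := .of_le hk
  exact contMDiffAt_extChartAt' (by simpa using hy)

lemma contDiffAt_inChart_iff {k : ℕ∞ω} (hk : k ≤ ∞) (hy : y ∈ (extChartAt (𝓡 n) x).source) :
    ContDiffAt ℝ k (inChart x f) (extChartAt (𝓡 n) x y) ↔
      ContMDiffAt (𝓡 n) 𝓘(ℝ, F) k f y := by
  have : IsManifold (𝓡 n) k M := .of_le hk
  rw [← contMDiffAt_iff_contDiffAt]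
  constructor
  · intro h
    exact (h.comp y (contMDiffAt_extChart hk hy)).congr_of_eventuallyEq
      (inChart_comp_eventuallyEq f hy).symm
  · intro h
    have h1 : ContMDiffAt 𝓘(ℝ, EuclideanSpace ℝ (Fin n)) (𝓡 n) k (extChartAt (𝓡 n) x).symm
        (extChartAt (𝓡 n) x y) :=
      (contMDiffOn_extChartAt_symm x).contMDiffAt
        ((isOpen_extChartAt_target x).mem_nhds ((extChartAt (𝓡 n) x).map_source hy))
    refine ContMDiffAt.comp _ ?_ h1
    rwa [(extChartAt (𝓡 n) x).left_inv hy]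

lemma differential_eq (hf : ContMDiffAt (𝓡 n) 𝓘(ℝ, F) 1 f y)
    (hy : y ∈ (extChartAt (𝓡 n) x).source) :
    differential (n := n) f y =
      (differential (n := n) (inChart x f) (extChartAt (𝓡 n) x y)).comp (chartDeriv x y) := by
  have h1 : (1 : ℕ∞ω) ≤ ∞ := by exact_mod_cast le_top
  have hd := (contDiffAt_inChart_iff h1 hy).mpr hf
  rw [differential, ← (inChart_comp_eventuallyEq f hy).mfderiv_eq,
    mfderiv_comp (I' := 𝓘(ℝ, EuclideanSpace ℝ (Fin n))) y
      (hd.differentiableAt (by simp)).mdifferentiableAt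
      ((contMDiffAt_extChart h1 hy).mdifferentiableAt (by simp))]
  rfl

/-- The left side is computed in the chart at y, the right side in the chart at x. The second
derivative of the transition map contributes only the vector tangent to f with coordinates u. -/
lemma secondDeriv_eq (hf : ContMDiffAt (𝓡 n) 𝓘(ℝ, F) 2 f y)
    (hy : y ∈ (extChartAt (𝓡 n) x).source) (v w : EuclideanSpace ℝ (Fin n)) :
    ∃ u : EuclideanSpace ℝ (Fin n), secondDeriv f y v w =
      secondDeriv (inChart x f) (extChartAt (𝓡 n) x y) (chartDeriv x y v) (chartDeriv x y w) +
        differential (inChart x f) (extChartAt (𝓡 n) x y) u := by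
  have h2 : (2 : ℕ∞ω) ≤ ∞ := ENat.LEInfty.out
  set c := inChart (n := n) y (extChartAt (𝓡 n) x : M → EuclideanSpace ℝ (Fin n)) with hc
  have hyy := mem_extChartAt_source (I := 𝓡 n) y
  have hcp : c (extChartAt (𝓡 n) y y) = extChartAt (𝓡 n) x y := inChart_apply _ hyy
  have hcd : ContDiffAt ℝ 2 c (extChartAt (𝓡 n) y y) :=
    (contDiffAt_inChart_iff h2 hyy).mpr (contMDiffAt_extChart h2 hy)
  have hc' : fderiv ℝ c (extChartAt (𝓡 n) y y) = chartDeriv x y :=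
    (differential_eq_fderiv_inChart
      ((contMDiffAt_extChart h2 hy).mdifferentiableAt (by simp))).symm
  have heq : f ∘ (extChartAt (𝓡 n) y).symm =ᶠ[𝓝 (extChartAt (𝓡 n) y y)] inChart x f ∘ c := by
    have h3 : ContinuousAt (extChartAt (𝓡 n) y).symm (extChartAt (𝓡 n) y y) :=
      continuousAt_extChartAt_symm y
    have h4 : (extChartAt (𝓡 n) x).source ∈
        𝓝 ((extChartAt (𝓡 n) y).symm (extChartAt (𝓡 n) y y)) := by
      rw [(extChartAt (𝓡 n) y).left_inv hyy]
      exact (isOpen_extChartAt_source x).mem_nhds hy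
    filter_upwards [h3.preimage_mem_nhds h4] with q hq
    simp only [hc, inChart, Function.comp_apply]
    rw [(extChartAt (𝓡 n) x).left_inv hq]
  have hfd := (contDiffAt_inChart_iff h2 hy).mpr hf
  refine ⟨fderiv ℝ (fderiv ℝ c) (extChartAt (𝓡 n) y y) v w, ?_⟩
  rw [secondDeriv, heq.fderiv.fderiv_eq, fderiv_fderiv_comp (by rwa [hcp]) hcd, hc', hcp,
    secondDeriv_eq_fderiv, differential_eq_fderiv]

lemma contDiffOn_inChart {k : ℕ∞ω} (hk : k ≤ ∞) {U : Set M} (hU : IsOpen U)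
    (hf : ContMDiffOn (𝓡 n) 𝓘(ℝ, F) k f U) (x : M) :
    ContMDiffOn (𝓡 n) 𝓘(ℝ, F) k (inChart (n := n) x f) (chartDomain (n := n) x U) := by
  rw [contMDiffOn_iff_contDiffOn]
  intro p hp
  obtain ⟨y, hyU, hy, rfl⟩ := exists_of_mem_chartDomain hp
  exact ((contDiffAt_inChart_iff hk hy).mpr
    (hf.contMDiffAt (hU.mem_nhds hyU))).contDiffWithinAt

end Transfer

lemma surjective_of_isInvertible {n : ℕ}
    {C : EuclideanSpace ℝ (Fin n) →L[ℝ] EuclideanSpace ℝ (Fin n)} (hC : C.IsInvertible) :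
    Function.Surjective C := by
  obtain ⟨e, rfl⟩ := hC
  exact e.surjective

lemma injective_of_isInvertible {n : ℕ}
    {C : EuclideanSpace ℝ (Fin n) →L[ℝ] EuclideanSpace ℝ (Fin n)} (hC : C.IsInvertible) :
    Function.Injective C := by
  obtain ⟨e, rfl⟩ := hC
  exact e.injective

/-! ### Chart independence of the second fundamental form and of the mean curvature. -/

section Invariance

variable {n : ℕ} {M : Type*} [TopologicalSpace M] [ChartedSpace (EuclideanSpace ℝ (Fin n)) M]
  [IsManifold (𝓡 n) ∞ M] {Φ : M → Amb n} {x y : M}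

lemma gram_amb_eq (hf : ContMDiffAt (𝓡 n) 𝓘(ℝ, Amb n) 1 Φ y)
    (hy : y ∈ (extChartAt (𝓡 n) x).source) :
    gram (n := n) amb Φ y = (coordMatrix (chartDeriv x y)).transpose *
      gram (n := n) amb (inChart x Φ) (extChartAt (𝓡 n) x y) * coordMatrix (chartDeriv x y) := by
  rw [gram_eq_gramOf, gram_eq_gramOf, differential_eq hf hy, ← gramOf_ambL, gramOf_comp,
    gramOf_ambL]

lemma isNormalAt_inChart_iff (hf : ContMDiffAt (𝓡 n) 𝓘(ℝ, Amb n) 1 Φ y)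
    (hy : y ∈ (extChartAt (𝓡 n) x).source) (w : Amb n) :
    IsNormalAt (inChart x Φ) (extChartAt (𝓡 n) x y) w ↔ IsNormalAt Φ y w := by
  have hs := surjective_of_isInvertible (chartDeriv_isInvertible hy)
  simp only [IsNormalAt, inChart_apply _ hy, differential_eq hf hy,
    ContinuousLinearMap.comp_apply]
  exact and_congr_right fun _ => (hs.forall (p := fun v => amb w
    (differential (n := n) (inChart x Φ) (extChartAt (𝓡 n) x y) v) = 0))

lemma isNondegAt_inChart_iff (hf : ContMDiffAt (𝓡 n) 𝓘(ℝ, Amb n) 1 Φ y)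
    (hy : y ∈ (extChartAt (𝓡 n) x).source) :
    IsNondegAt (inChart x Φ) (extChartAt (𝓡 n) x y) ↔ IsNondegAt Φ y := by
  have hC := chartDeriv_isInvertible hy
  have hs := surjective_of_isInvertible hC
  have hdet := (Matrix.isUnit_iff_isUnit_det _).mp (isUnit_coordMatrix hC)
  have h1 : (gram (n := n) amb Φ y).det ≠ 0 ↔
      (gram (n := n) amb (inChart x Φ) (extChartAt (𝓡 n) x y)).det ≠ 0 := by
    rw [gram_amb_eq hf hy, Matrix.det_mul, Matrix.det_mul, Matrix.det_transpose]
    simp [hdet.ne_zero]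
  have h2 : (∀ v : EuclideanSpace ℝ (Fin n), lor (differential Φ y v).1 (Φ y).1 = 0) ↔
      ∀ v : EuclideanSpace ℝ (Fin n),
        lor (differential (inChart x Φ) (extChartAt (𝓡 n) x y) v).1 (Φ y).1 = 0 := by
    simp only [differential_eq hf hy, ContinuousLinearMap.comp_apply]
    exact (hs.forall (p := fun v => lor
      (differential (n := n) (inChart x Φ) (extChartAt (𝓡 n) x y) v).1 (Φ y).1 = 0)).symm
  constructor
  · rintro ⟨a, b, c⟩
    rw [inChart_apply _ hy] at a b
    exact ⟨a, h2.mpr b, h1.mpr c⟩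
  · rintro ⟨a, b, c⟩
    refine ⟨?_, ?_, h1.mp c⟩ <;> rw [inChart_apply _ hy]
    exacts [a, h2.mp b]

/-- The second derivatives in the two charts differ by a tangent vector, and the normal part does
not see it. -/
lemma secondForm_eq (hΦ : IsNondegAt Φ y) (hf : ContMDiffAt (𝓡 n) 𝓘(ℝ, Amb n) 2 Φ y)
    (hy : y ∈ (extChartAt (𝓡 n) x).source) (v w : EuclideanSpace ℝ (Fin n)) :
    secondForm Φ y v w = secondForm (inChart x Φ) (extChartAt (𝓡 n) x y)
      (chartDeriv x y v) (chartDeriv x y w) := by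
  have hf1 := hf.of_le (m := 1) (by norm_num)
  have hΦ' := (isNondegAt_inChart_iff hf1 hy).mpr hΦ
  have hs := surjective_of_isInvertible (chartDeriv_isInvertible hy)
  obtain ⟨u, hu⟩ := secondDeriv_eq hf hy v w
  set z := secondDeriv (inChart x Φ) (extChartAt (𝓡 n) x y)
      (chartDeriv x y v) (chartDeriv x y w) with hz
  have h2 := normalPart_eq (inChart x Φ) (extChartAt (𝓡 n) x y) z
  -- u' collects the tangential component in the chart at x and the contribution of the transition
  -- map.
  obtain ⟨u', hu'⟩ := hs (tangentCoord (inChart x Φ) (extChartAt (𝓡 n) x y) z + u)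
  rw [secondForm, secondForm, ← hz]
  refine hΦ.normalPart_unique (a := - lor z.1 (Φ y).1) (v := u') ?_ ?_
  · exact (isNormalAt_inChart_iff hf1 hy _).mp (hΦ'.isNormalAt_normalPart z)
  · rw [hu, h2, differential_eq hf1 hy, ContinuousLinearMap.comp_apply, hu', map_add,
      inChart_apply _ hy]
    module

lemma meanCurv_eq (hΦ : IsNondegAt Φ y) (hf : ContMDiffAt (𝓡 n) 𝓘(ℝ, Amb n) 2 Φ y)
    (hy : y ∈ (extChartAt (𝓡 n) x).source) :
    meanCurv Φ y = meanCurv (inChart x Φ) (extChartAt (𝓡 n) x y) := by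
  simp only [meanCurv, secondForm_eq hΦ hf hy,
    gram_amb_eq (hf.of_le (m := 1) (by norm_num)) hy]
  exact trace_gram_congr (secondFormL (inChart x Φ) (extChartAt (𝓡 n) x y)) _
    (chartDeriv_isInvertible hy) _

end Invariance

section FlatNondeg

variable {n : ℕ} {U : Set (EuclideanSpace ℝ (Fin n))}

lemma fderiv_fst_apply {E F G : Type*} [NormedAddCommGroup E] [NormedSpace ℝ E]
    [NormedAddCommGroup F] [NormedSpace ℝ F] [NormedAddCommGroup G] [NormedSpace ℝ G]
    {Φ : E → F × G} {p : E} (h : DifferentiableAt ℝ Φ p) (v : E) :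
    fderiv ℝ (fun y => (Φ y).1) p v = (fderiv ℝ Φ p v).1 := by
  rw [h.hasFDerivAt.fst.fderiv]; rfl

lemma fderiv_snd_apply {E F G : Type*} [NormedAddCommGroup E] [NormedSpace ℝ E]
    [NormedAddCommGroup F] [NormedSpace ℝ F] [NormedAddCommGroup G] [NormedSpace ℝ G]
    {Φ : E → F × G} {p : E} (h : DifferentiableAt ℝ Φ p) (v : E) :
    fderiv ℝ (fun y => (Φ y).2) p v = (fderiv ℝ Φ p v).2 := by
  rw [h.hasFDerivAt.snd.fderiv]; rfl

lemma isNondegAt_of_contDiffAt {Φ : EuclideanSpace ℝ (Fin n) → Amb n}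
    {p : EuclideanSpace ℝ (Fin n)} (hU : IsOpen U) (hp : p ∈ U)
    (hΦ : DifferentiableAt ℝ Φ p) (hmaps : ∀ q ∈ U, Φ q ∈ hypProd n)
    (hdet : (gram amb Φ p : Matrix (Fin n) (Fin n) ℝ).det ≠ 0) : IsNondegAt Φ p := by
  refine ⟨(hmaps p hp).1, fun v => ?_, hdet⟩
  rw [differential_eq_fderiv, ← fderiv_fst_apply hΦ]
  refine lor_fderiv_self_eq_zero hΦ.fst (c := -1) ?_ v
  filter_upwards [hU.mem_nhds hp] with q hq using (hmaps q hq).1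

end FlatNondeg

section InChart

variable {n : ℕ} {M : Type*} [TopologicalSpace M] [ChartedSpace (EuclideanSpace ℝ (Fin n)) M]
  [IsManifold (𝓡 n) ∞ M] {Φ : M → Amb n} {x y : M} {U : Set M}

lemma IsNondegImmersionOn.inChart (hU : IsOpen U) (h : IsNondegImmersionOn Φ U) (x : M) :
    IsNondegImmersionOn (inChart (n := n) x Φ) (chartDomain (n := n) x U) := by
  refine ⟨?_, contDiffOn_inChart ENat.LEInfty.out hU h.contMDiffOn x, ?_⟩
  · intro p hp
    obtain ⟨y, hyU, hy, rfl⟩ := exists_of_mem_chartDomain hp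
    rw [inChart_apply _ hy]
    exact h.mapsTo y hyU
  · intro p hp
    obtain ⟨y, hyU, hy, rfl⟩ := exists_of_mem_chartDomain hp
    have h1 := h.nondeg y hyU
    rw [gram_amb_eq ((h.contMDiffOn.contMDiffAt (hU.mem_nhds hyU)).of_le (by norm_num)) hy,
      Matrix.det_mul, Matrix.det_mul] at h1
    intro h0
    exact h1 (by rw [h0]; simp)

lemma contDiffAt_of_contMDiffOn {F : Type*} [NormedAddCommGroup F] [NormedSpace ℝ F]
    {f : EuclideanSpace ℝ (Fin n) → F} {V : Set (EuclideanSpace ℝ (Fin n))} {k : ℕ∞ω}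
    (hV : IsOpen V) (h : ContMDiffOn (𝓡 n) 𝓘(ℝ, F) k f V) {p : EuclideanSpace ℝ (Fin n)}
    (hp : p ∈ V) : ContDiffAt ℝ k f p :=
  (contMDiffOn_iff_contDiffOn.mp h).contDiffAt (hV.mem_nhds hp)

lemma IsNondegImmersionOn.isNondegAt (hU : IsOpen U) (h : IsNondegImmersionOn Φ U)
    (hy : y ∈ U) : IsNondegAt Φ y := by
  have hs := mem_extChartAt_source (I := 𝓡 n) y
  rw [← isNondegAt_inChart_iff (x := y)
    ((h.contMDiffOn.contMDiffAt (hU.mem_nhds hy)).of_le (by norm_num)) hs]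
  have h1 := h.inChart hU y
  have hV := isOpen_chartDomain (n := n) y hU
  have hp := mem_chartDomain hy hs
  exact isNondegAt_of_contDiffAt hV hp
    ((contDiffAt_of_contMDiffOn hV h1.contMDiffOn hp).differentiableAt (by simp)) h1.mapsTo
    (h1.nondeg _ hp)

end InChart

/-! ### The shape operator at a point and hyperbolic rotations of a frame. -/

section MatCLM

variable {n : ℕ}

/-- The endomorphism with a given matrix in the coordinate basis. -/
def matCLM (B : Matrix (Fin n) (Fin n) ℝ) :
    EuclideanSpace ℝ (Fin n) →L[ℝ] EuclideanSpace ℝ (Fin n) :=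
  LinearMap.toContinuousLinearMap (Matrix.toLin (EuclideanSpace.basisFun (Fin n) ℝ).toBasis
    (EuclideanSpace.basisFun (Fin n) ℝ).toBasis B)

lemma coordMatrix_matCLM (B : Matrix (Fin n) (Fin n) ℝ) : coordMatrix (matCLM B) = B := by
  ext i j
  have h : coordVec j = (EuclideanSpace.basisFun (Fin n) ℝ).toBasis j := by
    simp [coordVec]
  simp only [coordMatrix, matCLM, Matrix.of_apply, h, LinearMap.coe_toContinuousLinearMap',
    Matrix.toLin_self]
  simp [Pi.single_apply]

lemma matCLM_add_smul (a b : ℝ) (B : Matrix (Fin n) (Fin n) ℝ) (v : EuclideanSpace ℝ (Fin n)) :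
    matCLM (a • 1 + b • B) v = a • v + b • matCLM B v := by
  simp [matCLM, Matrix.toLin_one]

end MatCLM

section Frame

variable {n : ℕ}

/-- The values and first derivatives at a point of a hypersurface of hyperbolic space and of its
Gauss map. -/
structure HypersurfaceFrame (p q : Mink n) (D D' : EuclideanSpace ℝ (Fin n) →L[ℝ] Mink n) :
    Prop where
  base : lor p p = -1
  unit : lor q q = 1
  normal : lor q p = 0
  inj : ∀ v, D v = 0 → v = 0
  base_tangent : ∀ v, lor (D v) p = 0
  unit_tangent : ∀ v, lor (D v) q = 0
  base_deriv : ∀ v, lor (D' v) p = 0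
  unit_deriv : ∀ v, lor (D' v) q = 0
  symm : ∀ v w, lor (D v) (D' w) = lor (D w) (D' v)

/-- The matrix of the shape operator. -/
def shapeMat (D D' : EuclideanSpace ℝ (Fin n) →L[ℝ] Mink n) : Matrix (Fin n) (Fin n) ℝ :=
  (gramOf lor D)⁻¹ * Matrix.of fun i j => - lor (D (coordVec i)) (D' (coordVec j))

variable {p q : Mink n} {D D' : EuclideanSpace ℝ (Fin n) →L[ℝ] Mink n}

namespace HypersurfaceFrame

lemma lor_pos (h : HypersurfaceFrame p q D D') {v : EuclideanSpace ℝ (Fin n)} (hv : v ≠ 0) :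
    0 < lor (D v) (D v) :=
  lor_self_pos h.base (h.base_tangent v) fun h0 => hv (h.inj v h0)

lemma gram_posDef (h : HypersurfaceFrame p q D D') : (gramOf lor D).PosDef := by
  refine Matrix.PosDef.of_dotProduct_mulVec_pos ?_ fun v hv => ?_
  · rw [Matrix.IsHermitian, Matrix.conjTranspose_eq_transpose_of_trivial, gramOf_lor_transpose]
  · set v' : EuclideanSpace ℝ (Fin n) := WithLp.toLp 2 v
    have hv' : v' ≠ 0 := fun h => hv (by
      ext i; simpa [v'] using congrArg (fun z : EuclideanSpace ℝ (Fin n) => z i) h)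
    have h1 := h.lor_pos hv'
    have h2 : lor (D v') (D v') = star v ⬝ᵥ (gramOf lor D).mulVec v := by
      conv_lhs => rw [← sum_coordVec v', ← lorL_apply]
      simp only [map_sum, map_smul, sum_apply, smul_apply, smul_eq_mul,
        lorL_apply, dotProduct, Matrix.mulVec, gramOf, Matrix.of_apply, Finset.mul_sum, v']
      rw [Finset.sum_comm]
      refine Finset.sum_congr rfl fun i _ => Finset.sum_congr rfl fun j _ => ?_
      simp
      ring
    rwa [← h2]

lemma second_transpose (h : HypersurfaceFrame p q D D') :
    (Matrix.of fun i j => - lor (D (coordVec i)) (D' (coordVec j))).transpose =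
      Matrix.of fun i j => - lor (D (coordVec i)) (D' (coordVec j)) := by
  ext i j
  simp [h.symm (coordVec j)]

lemma gram_det_isUnit (h : HypersurfaceFrame p q D D') : IsUnit (gramOf lor D).det :=
  (Matrix.isUnit_iff_isUnit_det _).mp h.gram_posDef.isUnit

lemma gram_mul_shapeMat (h : HypersurfaceFrame p q D D') :
    gramOf lor D * shapeMat D D' =
      Matrix.of fun i j => - lor (D (coordVec i)) (D' (coordVec j)) := by
  rw [shapeMat, ← Matrix.mul_assoc, Matrix.mul_nonsing_inv _ h.gram_det_isUnit, Matrix.one_mul]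

lemma exists_diagonalization (h : HypersurfaceFrame p q D D') :
    ∃ (P : (Matrix (Fin n) (Fin n) ℝ)ˣ) (d : Fin n → ℝ),
      shapeMat D D' = P * Matrix.diagonal d * (P⁻¹ : (Matrix (Fin n) (Fin n) ℝ)ˣ) :=
  TrappedHyp.exists_diagonalization h.gram_posDef h.second_transpose

lemma lor_comp_matCLM (D : EuclideanSpace ℝ (Fin n) →L[ℝ] Mink n)
    (B B' : Matrix (Fin n) (Fin n) ℝ) :
    (Matrix.of fun i j => lor (D (matCLM B (coordVec i))) (D (matCLM B' (coordVec j)))) =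
      B.transpose * gramOf lor D * B' := by
  have := bilin_comp_matrix ((lorL n).bilinearComp D D) (matCLM B) (matCLM B')
  simpa [coordMatrix_matCLM, lorL_apply, gramOf] using this

/-- The Weingarten equation. -/
lemma weingarten (h : HypersurfaceFrame p q D D') (v : EuclideanSpace ℝ (Fin n)) :
    D' v = - D (matCLM (shapeMat D D') v) := by
  rw [eq_neg_iff_add_eq_zero]
  refine eq_zero_of_orthogonal_frame h.base h.unit h.normal h.inj h.base_tangent h.unit_tangent
    ?_ ?_ fun w => ?_
  · rw [lor_add_left, h.base_deriv, h.base_tangent, add_zero]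
  · rw [lor_add_left, h.unit_deriv, h.unit_tangent, add_zero]
  · have key : ∀ i j, lor (D' (coordVec i) + D (matCLM (shapeMat D D') (coordVec i)))
        (D (coordVec j)) = 0 := by
      intro i j
      have h1 := congrFun (congrFun (lor_comp_matCLM D (shapeMat D D') 1) i) j
      have h2 : matCLM (1 : Matrix (Fin n) (Fin n) ℝ) (coordVec j) = coordVec j := by
        simpa using matCLM_add_smul 1 0 (0 : Matrix (Fin n) (Fin n) ℝ) (coordVec j)
      have h3 : (shapeMat D D').transpose * gramOf lor D =
          Matrix.of fun i j => - lor (D (coordVec i)) (D' (coordVec j)) := by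
        rw [← h.second_transpose, ← h.gram_mul_shapeMat, Matrix.transpose_mul,
          gramOf_lor_transpose]
      rw [Matrix.mul_one, h3] at h1
      simp only [Matrix.of_apply, h2] at h1
      rw [lor_add_left, h1, h.symm, lor_comm]
      ring
    have k2 : ∀ i, lor (D' (coordVec i) + D (matCLM (shapeMat D D') (coordVec i))) (D w) = 0 := by
      intro i
      have := eq_zero_of_forall_coordVec (D := D)
        (L := lorL n (D' (coordVec i) + D (matCLM (shapeMat D D') (coordVec i))))
        (by simpa only [lorL_apply] using key i) w
      rwa [lorL_apply] at this
    have := eq_zero_of_forall_coordVec (D := D' + D.comp (matCLM (shapeMat D D')))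
        (L := (lorL n).flip (D w))
        (fun i => by rw [ContinuousLinearMap.flip_apply, lorL_apply]; exact k2 i) v
    rwa [ContinuousLinearMap.flip_apply, lorL_apply] at this

/-- By the Weingarten equation a dφ + b dν = dφ ∘ (a - b A), which turns statements on parallel
hypersurfaces into matrix algebra in A. -/
lemma rotate_apply (h : HypersurfaceFrame p q D D') (a b : ℝ) (v : EuclideanSpace ℝ (Fin n)) :
    a • D v + b • D' v = D (matCLM (a • 1 + (-b) • shapeMat D D') v) := by
  rw [h.weingarten, matCLM_add_smul, map_add, map_smul, map_smul]
  module

lemma isRoot_charpoly_iff (A : Matrix (Fin n) (Fin n) ℝ) (s : ℝ) :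
    A.charpoly.IsRoot s ↔ (s • 1 - A).det = 0 := by
  rw [Polynomial.IsRoot, Matrix.eval_charpoly, Matrix.scalar_apply, Matrix.smul_one_eq_diagonal]

/-- a - b A = b (a/b - A) is invertible because a/b is not an eigenvalue; geometrically, the moved
point is not focal. -/
lemma rotate_injective (h : HypersurfaceFrame p q D D') {a b : ℝ} (hb : b ≠ 0)
    (hs : ¬ (shapeMat D D').charpoly.IsRoot (a / b)) {v : EuclideanSpace ℝ (Fin n)}
    (hv : a • D v + b • D' v = 0) : v = 0 := by
  rw [h.rotate_apply] at hv
  have h1 := h.inj _ hv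
  have h2 : (a • 1 + (-b) • shapeMat D D' : Matrix (Fin n) (Fin n) ℝ).det ≠ 0 := by
    rw [isRoot_charpoly_iff] at hs
    have : (a • 1 + (-b) • shapeMat D D' : Matrix (Fin n) (Fin n) ℝ) =
        b • ((a / b) • 1 - shapeMat D D') := by
      rw [smul_sub, smul_smul, mul_div_cancel₀ _ hb]
      module
    rw [this, Matrix.det_smul]
    exact mul_ne_zero (pow_ne_zero _ hb) hs
  set B := (a • 1 + (-b) • shapeMat D D' : Matrix (Fin n) (Fin n) ℝ)
  by_contra hne
  apply h2
  apply Matrix.exists_mulVec_eq_zero_iff.mp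
  refine ⟨v, fun h => hne (by ext i; simpa using congrFun h i), ?_⟩
  have h3 := congrArg (fun z : EuclideanSpace ℝ (Fin n) => (z : Fin n → ℝ)) h1
  ext i
  have := congrFun h3 i
  rw [← sum_coordVec v] at this
  simp only [map_sum, map_smul, sum_coordMatrix, coordMatrix_matCLM] at this
  simpa [Matrix.mulVec, dotProduct, coordVec, Pi.single_apply, mul_comm] using this

/-- The trace that computes the mean curvature in the direction of the null normal of the rotated
hypersurface vanishes exactly at the roots of the root polynomial. -/
lemma trace_rotate_eq_zero_iff (h : HypersurfaceFrame p q D D') {a b : ℝ} (hb : b ≠ 0)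
    (hs : ¬ (shapeMat D D').charpoly.IsRoot (a / b)) {g : Matrix (Fin n) (Fin n) ℝ}
    (hg : g = gramOf lor (a • D + b • D')) :
    (∑ i, ∑ j, g⁻¹ i j * lor (a • D (coordVec j) + b • D' (coordVec j))
        (b • D (coordVec i) + a • D' (coordVec i))) = 0 ↔
      (rootPoly (shapeMat D D').charpoly).IsRoot (a / b) := by
  set A := shapeMat D D' with hA
  set s := a / b with hsd
  have hdet : (s • 1 - A).det ≠ 0 := by rwa [isRoot_charpoly_iff] at hs
  have has : a = b * s := by rw [hsd]; field_simp
  have e1 : (a • 1 + (-b) • A) = b • (s • 1 - A) := by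
    rw [has]; module
  have e2 : (b • 1 + (-a) • A) = (-b) • (s • A - 1) := by
    rw [has]; module
  have hBdet : IsUnit (a • 1 + (-b) • A).det := by
    rw [e1, Matrix.det_smul]
    exact (mul_ne_zero (pow_ne_zero _ hb) hdet).isUnit
  have hg' : g = (a • 1 + (-b) • A).transpose * gramOf lor D * (a • 1 + (-b) • A) := by
    rw [hg, ← lor_comp_matCLM]
    ext i j
    simp only [gramOf, Matrix.of_apply, add_apply, smul_apply, h.rotate_apply]
    rfl
  have hM : (Matrix.of fun j i => lor (a • D (coordVec j) + b • D' (coordVec j))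
        (b • D (coordVec i) + a • D' (coordVec i))) =
      (a • 1 + (-b) • A).transpose * gramOf lor D * (b • 1 + (-a) • A) := by
    rw [← lor_comp_matCLM]
    ext i j
    simp only [Matrix.of_apply, h.rotate_apply]
    rfl
  have htr : (∑ i, ∑ j, g⁻¹ i j * lor (a • D (coordVec j) + b • D' (coordVec j))
        (b • D (coordVec i) + a • D' (coordVec i))) =
      (g⁻¹ * ((a • 1 + (-b) • A).transpose * gramOf lor D * (b • 1 + (-a) • A))).trace := by
    rw [← hM]
    simp [Matrix.trace, Matrix.mul_apply]
  -- With B = a - b A the rotated Gram matrix is Bᵀ G B, so the factor Bᵀ G cancels and only B⁻¹ (b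
  -- - a A) remains.
  have hprod : g⁻¹ * ((a • 1 + (-b) • A).transpose * gramOf lor D * (b • 1 + (-a) • A)) =
      (a • 1 + (-b) • A)⁻¹ * (b • 1 + (-a) • A) := by
    set B := (a • 1 + (-b) • A)
    have hT : IsUnit (B.transpose * gramOf lor D).det := by
      rw [Matrix.det_mul, Matrix.det_transpose]
      exact hBdet.mul h.gram_det_isUnit
    rw [hg', Matrix.mul_inv_rev, Matrix.mul_assoc, ← Matrix.mul_assoc _ (B.transpose * _),
      Matrix.nonsing_inv_mul _ hT, Matrix.one_mul]
  have hinv : (b • (s • 1 - A))⁻¹ = b⁻¹ • (s • 1 - A)⁻¹ := by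
    apply Matrix.inv_eq_left_inv
    rw [Matrix.smul_mul, Matrix.mul_smul, smul_smul, Matrix.nonsing_inv_mul _ hdet.isUnit,
      inv_mul_cancel₀ hb, one_smul]
  obtain ⟨P, d, hPd⟩ := h.exists_diagonalization
  -- For a = b s the trace is -tr((s - A)⁻¹ (s A - 1)), and multiplication by the nonzero product of
  -- the s - κ gives -P(s).
  rw [htr, hprod, e1, e2, hinv, Polynomial.IsRoot, ← trace_adjugate_mul_eq hPd hs]
  have hprod2 : (∏ k ∈ A.charpoly.roots.toFinset, (s - k)) ≠ 0 := by
    refine Finset.prod_ne_zero_iff.mpr fun k hk hk0 => hs ?_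
    rw [sub_eq_zero.mp hk0]
    exact Polynomial.isRoot_of_mem_roots (Multiset.mem_toFinset.mp hk)
  rw [Matrix.smul_mul, Matrix.mul_smul, Matrix.trace_smul, Matrix.trace_smul]
  rw [← hA]
  simp [hb, hprod2]

lemma not_isRoot_charpoly {A : Matrix (Fin n) (Fin n) ℝ} {s : ℝ}
    (hs : (rootPoly A.charpoly).IsRoot s) (hs1 : 1 < |s|) : ¬ A.charpoly.IsRoot s :=
  fun h => eval_rootPoly_of_isRoot A.charpoly_monic.ne_zero h hs1 hs

variable {C : EuclideanSpace ℝ (Fin n) →L[ℝ] EuclideanSpace ℝ (Fin n)}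

lemma comp (h : HypersurfaceFrame p q D D') (hC : C.IsInvertible) :
    HypersurfaceFrame p q (D.comp C) (D'.comp C) where
  base := h.base
  unit := h.unit
  normal := h.normal
  inj v hv := injective_of_isInvertible hC (by rw [map_zero]; exact h.inj _ hv)
  base_tangent v := h.base_tangent _
  unit_tangent v := h.unit_tangent _
  base_deriv v := h.base_deriv _
  unit_deriv v := h.unit_deriv _
  symm v w := h.symm _ _

/-- A change of coordinates conjugates the shape matrix: the transposed factor of the second
fundamental form cancels against that of the inverse Gram matrix. -/
lemma charpoly_comp (hC : C.IsInvertible) :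
    (shapeMat (D.comp C) (D'.comp C)).charpoly = (shapeMat D D').charpoly := by
  have hu := isUnit_coordMatrix hC
  have hdet : IsUnit (coordMatrix C).det := (Matrix.isUnit_iff_isUnit_det _).mp hu
  have hdetT : IsUnit (coordMatrix C).transpose.det := by rwa [Matrix.det_transpose]
  have h1 : gramOf lor (D.comp C) =
      (coordMatrix C).transpose * gramOf lor D * coordMatrix C := by
    rw [← gramOf_lorL, gramOf_comp, gramOf_lorL]
  have h2 : (Matrix.of fun i j => - lor ((D.comp C) (coordVec i)) ((D'.comp C) (coordVec j))) =
      (coordMatrix C).transpose * (Matrix.of fun i j => - lor (D (coordVec i)) (D' (coordVec j))) *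
        coordMatrix C := by
    have := bilin_comp_matrix (-((lorL n).bilinearComp D D')) C C
    simpa [lorL_apply] using this
  have h3 : shapeMat (D.comp C) (D'.comp C) =
      (coordMatrix C)⁻¹ * shapeMat D D' * coordMatrix C := by
    rw [shapeMat, h1, h2, shapeMat, Matrix.mul_assoc (coordMatrix C).transpose,
      Matrix.mul_inv_rev, Matrix.mul_inv_rev]
    simp only [Matrix.mul_assoc]
    rw [← Matrix.mul_assoc (coordMatrix C).transpose⁻¹, Matrix.nonsing_inv_mul _ hdetT,
      Matrix.one_mul]
  rw [h3, ← hu.unit_spec, Matrix.charpoly_units_conj']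

end HypersurfaceFrame

end Frame

/-! ### P at a point, and the frame conditions of a hypersurface. -/

section TrapPoly

variable {n : ℕ} {M : Type*} [TopologicalSpace M] [ChartedSpace (EuclideanSpace ℝ (Fin n)) M]
  {φ ν : M → Mink n} {x : M}

/-- The hypersurface `φ` with Gauss map `ν` has good values and derivatives at `x`. -/
def IsHypersurfaceAt (φ ν : M → Mink n) (x : M) : Prop :=
  HypersurfaceFrame (φ x) (ν x) (differential (n := n) φ x) (differential (n := n) ν x)

lemma shapeOperator_charpoly (φ ν : M → Mink n) (x : M) :
    (shapeOperator φ ν x).charpoly =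
      (shapeMat (differential (n := n) φ x) (differential (n := n) ν x)).charpoly :=
  Matrix.charpoly_toLin _ _

/-- Diagonalizability identifies eigenspace dimensions with root multiplicities, so P depends only
on the characteristic polynomial of A. -/
lemma IsHypersurfaceAt.trapPoly_eq (h : IsHypersurfaceAt φ ν x) :
    trapPoly φ ν x =
      rootPoly (shapeMat (differential (n := n) φ x) (differential (n := n) ν x)).charpoly := by
  obtain ⟨P, d, hPd⟩ := h.exists_diagonalization
  have h1 : ∀ k, multiplicity φ ν x k =
      (shapeMat (differential (n := n) φ x)
        (differential (n := n) ν x)).charpoly.rootMultiplicity k :=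
    fun k => finrank_eigenspace_of_diagonalization hPd k
  simp only [trapPoly, rootPoly, principalCurvatures, shapeOperator_charpoly, h1]

lemma IsHypersurfaceAt.card_principalCurvatures (φ ν : M → Mink n) (x : M) :
    (principalCurvatures φ ν x).card = (shapeMat (differential (n := n) φ x)
      (differential (n := n) ν x)).charpoly.roots.toFinset.card := by
  rw [principalCurvatures, shapeOperator_charpoly]

end TrapPoly

section FlatHypersurface

variable {n : ℕ} {φ ν : EuclideanSpace ℝ (Fin n) → Mink n} {V : Set (EuclideanSpace ℝ (Fin n))}
  {p : EuclideanSpace ℝ (Fin n)}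

lemma ContDiffAt.hasFDerivAt_fderiv_apply {E F : Type*} [NormedAddCommGroup E] [NormedSpace ℝ E]
    [NormedAddCommGroup F] [NormedSpace ℝ F] {f : E → F} {p : E} (hf : ContDiffAt ℝ 2 f p) (v : E) :
    DifferentiableAt ℝ (fun y => fderiv ℝ f y v) p ∧
      ∀ w, fderiv ℝ (fun y => fderiv ℝ f y v) p w = fderiv ℝ (fderiv ℝ f) p w v := by
  have h : DifferentiableAt ℝ (fderiv ℝ f) p :=
    (hf.fderiv_right (m := 1) (by norm_num)).differentiableAt (by simp)
  have h2 := h.hasFDerivAt.clm_apply (hasFDerivAt_const v p)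
  exact ⟨h2.differentiableAt, fun w => by rw [h2.fderiv]; simp⟩

lemma ContDiffAt.fderiv_fderiv_symm {E F : Type*} [NormedAddCommGroup E] [NormedSpace ℝ E]
    [NormedAddCommGroup F] [NormedSpace ℝ F] {f : E → F} {p : E} (hf : ContDiffAt ℝ 2 f p)
    (v w : E) : fderiv ℝ (fderiv ℝ f) p v w = fderiv ℝ (fderiv ℝ f) p w v :=
  hf.isSymmSndFDerivAt (by simp) v w

lemma IsHypersurfaceOn.isHypersurfaceAt_flat (h : IsHypersurfaceOn φ ν V) (hV : IsOpen V)
    (hp : p ∈ V) : IsHypersurfaceAt φ ν p := by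
  have hφ := contDiffAt_of_contMDiffOn hV h.contMDiffOn hp
  have hν := contDiffAt_of_contMDiffOn hV h.gauss_contMDiffOn hp
  have hφd := hφ.differentiableAt (by simp)
  have hνd := hν.differentiableAt (by simp)
  have hVp := hV.mem_nhds hp
  have hun : ∀ v, lor (fderiv ℝ φ p v) (ν p) = 0 := by
    intro v
    rw [lor_comm, ← differential_eq_fderiv]
    exact h.gauss_normal p hp v
  -- Differentiating ⟨ν, dφ v⟩ = 0 gives ⟨dν w, dφ v⟩ = -⟨ν, D²φ(w, v)⟩; symmetry of D²φ makes the
  -- shape operator self-adjoint.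
  have hsecond : ∀ v w, lor (fderiv ℝ ν p w) (fderiv ℝ φ p v) +
      lor (ν p) (fderiv ℝ (fderiv ℝ φ) p w v) = 0 := by
    intro v w
    obtain ⟨h1, h2⟩ := ContDiffAt.hasFDerivAt_fderiv_apply (hφ.of_le (by norm_num)) v
    rw [← h2]
    refine lor_fderiv_add_eq_zero (c := 0) hνd h1 ?_ w
    filter_upwards [hVp] with q hq
    rw [← differential_eq_fderiv]
    exact h.gauss_normal q hq v
  unfold IsHypersurfaceAt
  rw [differential_eq_fderiv, differential_eq_fderiv]
  refine ⟨(h.mapsTo p hp).1, h.gauss_unit p hp, h.gauss_tangent p hp, ?_, ?_, hun, ?_, ?_, ?_⟩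
  · intro v hv
    have := h.immersion p hp
    rw [differential_eq_fderiv] at this
    exact this (by rw [hv, map_zero])
  · refine lor_fderiv_self_eq_zero (c := -1) hφd ?_
    filter_upwards [hVp] with q hq using (h.mapsTo q hq).1
  · intro v
    have := lor_fderiv_add_eq_zero (c := 0) hνd hφd
      (by filter_upwards [hVp] with q hq using h.gauss_tangent q hq) v
    rw [lor_comm (ν p), hun, add_zero] at this
    exact this
  · refine lor_fderiv_self_eq_zero (c := 1) hνd ?_
    filter_upwards [hVp] with q hq using h.gauss_unit q hq
  · intro v w
    have h1 := hsecond v w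
    have h2 := hsecond w v
    rw [ContDiffAt.fderiv_fderiv_symm (hφ.of_le (by norm_num))] at h1
    rw [lor_comm, lor_comm (fderiv ℝ φ p w)]
    linarith

end FlatHypersurface

lemma isHypersurfaceAt_of_comp {n : ℕ} {M N : Type*} [TopologicalSpace M]
    [ChartedSpace (EuclideanSpace ℝ (Fin n)) M] [TopologicalSpace N]
    [ChartedSpace (EuclideanSpace ℝ (Fin n)) N] {φ ν : M → Mink n} {y : M}
    {φ' ν' : N → Mink n} {z : N}
    {C : EuclideanSpace ℝ (Fin n) →L[ℝ] EuclideanSpace ℝ (Fin n)} (hC : C.IsInvertible)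
    (h : IsHypersurfaceAt φ' ν' z) (hφ : φ y = φ' z) (hν : ν y = ν' z)
    (hφd : differential (n := n) φ y = (differential (n := n) φ' z).comp C)
    (hνd : differential (n := n) ν y = (differential (n := n) ν' z).comp C) :
    IsHypersurfaceAt φ ν y ∧ trapPoly φ ν y = trapPoly φ' ν' z ∧
      (shapeOperator φ ν y).charpoly = (shapeOperator φ' ν' z).charpoly := by
  have h1 : IsHypersurfaceAt φ ν y := by
    unfold IsHypersurfaceAt
    rw [hφ, hν, hφd, hνd]
    exact HypersurfaceFrame.comp h hC
  refine ⟨h1, ?_, ?_⟩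
  · rw [h1.trapPoly_eq, h.trapPoly_eq, hφd, hνd, HypersurfaceFrame.charpoly_comp hC]
  · rw [shapeOperator_charpoly, shapeOperator_charpoly, hφd, hνd,
      HypersurfaceFrame.charpoly_comp hC]

/-! ### Hypersurfaces read in a chart and pulled back from it. -/

section Transfer

variable {n : ℕ} {M : Type*} [TopologicalSpace M] [ChartedSpace (EuclideanSpace ℝ (Fin n)) M]
  [IsManifold (𝓡 n) ∞ M] {φ ν : M → Mink n} {x y : M} {U : Set M}

lemma IsHypersurfaceOn.inChart (h : IsHypersurfaceOn φ ν U) (hU : IsOpen U) (x : M) :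
    IsHypersurfaceOn (inChart (n := n) x φ) (inChart (n := n) x ν) (chartDomain (n := n) x U) := by
  have hd : ∀ y ∈ U, y ∈ (extChartAt (𝓡 n) x).source → differential (n := n) φ y =
      (differential (n := n) (TrappedHyp.inChart x φ) (extChartAt (𝓡 n) x y)).comp
        (chartDeriv x y) := fun y hyU hy =>
    differential_eq ((h.contMDiffOn.contMDiffAt (hU.mem_nhds hyU)).of_le (by norm_num)) hy
  refine ⟨?_, contDiffOn_inChart ENat.LEInfty.out hU h.contMDiffOn x, ?_,
    contDiffOn_inChart ENat.LEInfty.out hU h.gauss_contMDiffOn x, ?_, ?_, ?_⟩ <;>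
    intro p hp <;> obtain ⟨y, hyU, hy, rfl⟩ := exists_of_mem_chartDomain hp <;>
    (try simp only [inChart_apply _ hy])
  · exact h.mapsTo y hyU
  · have h1 := h.immersion y hyU
    rw [hd y hyU hy] at h1
    have hs := surjective_of_isInvertible (chartDeriv_isInvertible hy)
    intro v w hvw
    obtain ⟨v, rfl⟩ := hs v
    obtain ⟨w, rfl⟩ := hs w
    rw [h1 hvw]
  · exact h.gauss_unit y hyU
  · exact h.gauss_tangent y hyU
  · intro v
    obtain ⟨v, rfl⟩ := surjective_of_isInvertible (chartDeriv_isInvertible hy) v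
    have := h.gauss_normal y hyU v
    rwa [hd y hyU hy] at this

lemma isHypersurfaceAt_inChart (h : IsHypersurfaceOn φ ν U) (hU : IsOpen U) (hyU : y ∈ U)
    (hy : y ∈ (extChartAt (𝓡 n) x).source) :
    IsHypersurfaceAt (inChart (n := n) x φ) (inChart (n := n) x ν) (extChartAt (𝓡 n) x y) :=
  (h.inChart hU x).isHypersurfaceAt_flat (isOpen_chartDomain x hU) (mem_chartDomain hyU hy)

lemma IsHypersurfaceOn.transfer (h : IsHypersurfaceOn φ ν U) (hU : IsOpen U) (hyU : y ∈ U)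
    (hy : y ∈ (extChartAt (𝓡 n) x).source) :
    IsHypersurfaceAt φ ν y ∧ trapPoly φ ν y =
      trapPoly (TrappedHyp.inChart (n := n) x φ) (TrappedHyp.inChart (n := n) x ν)
        (extChartAt (𝓡 n) x y) ∧
      (shapeOperator φ ν y).charpoly = (shapeOperator (TrappedHyp.inChart (n := n) x φ)
        (TrappedHyp.inChart (n := n) x ν) (extChartAt (𝓡 n) x y)).charpoly :=
  isHypersurfaceAt_of_comp (chartDeriv_isInvertible hy) (isHypersurfaceAt_inChart h hU hyU hy)
    (inChart_apply _ hy).symm (inChart_apply _ hy).symm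
    (differential_eq ((h.contMDiffOn.contMDiffAt (hU.mem_nhds hyU)).of_le (by norm_num)) hy)
    (differential_eq ((h.gauss_contMDiffOn.contMDiffAt (hU.mem_nhds hyU)).of_le (by norm_num)) hy)

lemma IsHypersurfaceOn.isHypersurfaceAt (h : IsHypersurfaceOn φ ν U) (hU : IsOpen U)
    (hyU : y ∈ U) : IsHypersurfaceAt φ ν y :=
  (h.transfer hU hyU (mem_extChartAt_source (I := 𝓡 n) y)).1

end Transfer

section Pullback

variable {n : ℕ} {M : Type*} [TopologicalSpace M] [ChartedSpace (EuclideanSpace ℝ (Fin n)) M]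
  [IsManifold (𝓡 n) ∞ M] {φ ν : EuclideanSpace ℝ (Fin n) → Mink n} {x y : M}
  {V : Set (EuclideanSpace ℝ (Fin n))} {F : Type*} [NormedAddCommGroup F] [NormedSpace ℝ F]

/-- The part of the domain of the chart at `x` that is mapped to `V`. -/
def chartPreimage (x : M) (V : Set (EuclideanSpace ℝ (Fin n))) : Set M :=
  (extChartAt (𝓡 n) x).source ∩ extChartAt (𝓡 n) x ⁻¹' V

lemma isOpen_chartPreimage {M : Type*} [TopologicalSpace M]
    [ChartedSpace (EuclideanSpace ℝ (Fin n)) M] (x : M) (hV : IsOpen V) :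
    IsOpen (chartPreimage x V) :=
  (continuousOn_extChartAt x).isOpen_inter_preimage (isOpen_extChartAt_source x) hV

lemma contMDiffOn_comp_extChart {f : EuclideanSpace ℝ (Fin n) → F} {k : ℕ∞ω} (hk : k ≤ ∞)
    (hV : IsOpen V) (hf : ContMDiffOn (𝓡 n) 𝓘(ℝ, F) k f V) (x : M) :
    ContMDiffOn (𝓡 n) 𝓘(ℝ, F) k (f ∘ extChartAt (𝓡 n) x) (chartPreimage x V) := by
  intro y hy
  exact ((hf.contMDiffAt (hV.mem_nhds hy.2)).comp y
    (contMDiffAt_extChart hk hy.1)).contMDiffWithinAt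

lemma differential_comp_extChart {f : EuclideanSpace ℝ (Fin n) → F}
    (hy : y ∈ (extChartAt (𝓡 n) x).source)
    (hf : DifferentiableAt ℝ f (extChartAt (𝓡 n) x y)) :
    differential (n := n) (f ∘ extChartAt (𝓡 n) x) y =
      (differential (n := n) f (extChartAt (𝓡 n) x y)).comp (chartDeriv x y) := by
  rw [differential, mfderiv_comp (I' := 𝓘(ℝ, EuclideanSpace ℝ (Fin n))) y hf.mdifferentiableAt
    ((contMDiffAt_extChart (k := 1) ENat.LEInfty.out hy).mdifferentiableAt (by simp))]
  rfl

lemma IsHypersurfaceOn.pullback (h : IsHypersurfaceOn φ ν V) (hV : IsOpen V) (x : M) :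
    IsHypersurfaceOn (φ ∘ extChartAt (𝓡 n) x) (ν ∘ extChartAt (𝓡 n) x) (chartPreimage x V) ∧
      ∀ y ∈ chartPreimage x V,
        trapPoly (φ ∘ extChartAt (𝓡 n) x) (ν ∘ extChartAt (𝓡 n) x) y =
          trapPoly φ ν (extChartAt (𝓡 n) x y) := by
  have hφ : ∀ y ∈ chartPreimage x V, differential (n := n) (φ ∘ extChartAt (𝓡 n) x) y =
      (differential (n := n) φ (extChartAt (𝓡 n) x y)).comp (chartDeriv x y) := fun y hy =>
    differential_comp_extChart hy.1
      ((contDiffAt_of_contMDiffOn hV h.contMDiffOn hy.2).differentiableAt (by simp))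
  have hν : ∀ y ∈ chartPreimage x V, differential (n := n) (ν ∘ extChartAt (𝓡 n) x) y =
      (differential (n := n) ν (extChartAt (𝓡 n) x y)).comp (chartDeriv x y) := fun y hy =>
    differential_comp_extChart hy.1
      ((contDiffAt_of_contMDiffOn hV h.gauss_contMDiffOn hy.2).differentiableAt (by simp))
  have hat : ∀ y ∈ chartPreimage x V,
      IsHypersurfaceAt (φ ∘ extChartAt (𝓡 n) x) (ν ∘ extChartAt (𝓡 n) x) y ∧
        trapPoly (φ ∘ extChartAt (𝓡 n) x) (ν ∘ extChartAt (𝓡 n) x) y =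
          trapPoly φ ν (extChartAt (𝓡 n) x y) := fun y hy => by
    have := isHypersurfaceAt_of_comp (φ := φ ∘ extChartAt (𝓡 n) x)
      (ν := ν ∘ extChartAt (𝓡 n) x) (y := y) (chartDeriv_isInvertible hy.1)
      (h.isHypersurfaceAt_flat hV hy.2) rfl rfl (hφ y hy) (hν y hy)
    exact ⟨this.1, this.2.1⟩
  refine ⟨⟨fun y hy => h.mapsTo _ hy.2,
    contMDiffOn_comp_extChart ENat.LEInfty.out hV h.contMDiffOn x, ?_,
    contMDiffOn_comp_extChart ENat.LEInfty.out hV h.gauss_contMDiffOn x,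
    fun y hy => h.gauss_unit _ hy.2, fun y hy => h.gauss_tangent _ hy.2, ?_⟩,
    fun y hy => (hat y hy).2⟩
  · intro y hy
    rw [injective_iff_map_eq_zero]
    exact (hat y hy).1.inj
  · intro y hy v
    rw [lor_comm]
    exact (hat y hy).1.unit_tangent v

end Pullback

/-! ### The second fundamental form against a null normal. -/

section NullNormal

lemma lor_add_smul {n : ℕ} {X Z η ζ : Mink n} {a b : ℝ} (hX : lor X ζ = 0) (hZ : lor η Z = 0) :
    lor (X + a • η) (Z + b • ζ) = lor X Z + a * b * lor η ζ := by
  simp only [lor_add_left, lor_add_right, lor_smul_left, lor_smul_right, hX, hZ]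
  ring

variable {n : ℕ} {Φ : EuclideanSpace ℝ (Fin n) → Amb n} {η : EuclideanSpace ℝ (Fin n) → Mink n}
  {p : EuclideanSpace ℝ (Fin n)}

/-- Differentiating ⟨η, dψ w⟩ = dτ w gives ⟨dη v, dψ w⟩ + ⟨η, D²ψ(v, w)⟩ = D²τ(v, w). The second
derivatives of Φ thus drop out in favour of first derivatives of η. -/
lemma amb_secondForm_null_normal (hΦ : ContDiffAt ℝ 2 Φ p) (hη : DifferentiableAt ℝ η p)
    (hN : ∀ᶠ y in 𝓝 p, IsNormalAt Φ y (η y, 1)) (v w : EuclideanSpace ℝ (Fin n)) :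
    amb (secondForm Φ p v w) (η p, 1) = - lor (fderiv ℝ Φ p w).1 (fderiv ℝ η p v) := by
  rw [secondForm, amb_normalPart hN.self_of_nhds, secondDeriv_eq_fderiv]
  obtain ⟨h1, h2⟩ := ContDiffAt.hasFDerivAt_fderiv_apply hΦ w
  have h3 := fderiv_fst_apply h1 v
  have h4 := fderiv_snd_apply h1 v
  rw [h2] at h3 h4
  obtain ⟨h5, h6⟩ := hasFDerivAt_lor hη h1.fst
  have h7 : (fun y => lor (η y) (fderiv ℝ Φ y w).1) =ᶠ[𝓝 p] fun y => (fderiv ℝ Φ y w).2 := by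
    filter_upwards [hN] with y hy
    have := hy.2 w
    rw [differential_eq_fderiv, amb] at this
    linarith
  have h8 := DFunLike.congr_fun (h7.fderiv_eq (𝕜 := ℝ)) v
  rw [h6, h3, h4] at h8
  rw [amb, lor_comm (fderiv ℝ Φ p w).1, lor_comm _ (η p)]
  linarith

lemma amb_meanCurv_null_normal (hΦ : ContDiffAt ℝ 2 Φ p) (hη : DifferentiableAt ℝ η p)
    (hN : ∀ᶠ y in 𝓝 p, IsNormalAt Φ y (η y, 1)) :
    amb (meanCurv Φ p) (η p, 1) = - ∑ i, ∑ j, (gram (n := n) amb Φ p)⁻¹ i j *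
      lor (fderiv ℝ Φ p (coordVec j)).1 (fderiv ℝ η p (coordVec i)) := by
  simp only [meanCurv, amb_sum_left, amb_smul_left, amb_secondForm_null_normal hΦ hη hN, mul_neg,
    Finset.sum_neg_distrib]

end NullNormal

/-! ### Geometry of a hypersurface moved along its null normals. -/

section Rotation

variable {n : ℕ} {φ ν : EuclideanSpace ℝ (Fin n) → Mink n} {V : Set (EuclideanSpace ℝ (Fin n))}
  {τ : EuclideanSpace ℝ (Fin n) → ℝ} {c : ℝ} {Φ : EuclideanSpace ℝ (Fin n) → Amb n}
  {p : EuclideanSpace ℝ (Fin n)}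

/-- `Φ` is obtained by moving the points of the hypersurface `φ` by the distance `τ` along the
normal geodesics; the height is `τ + c`. -/
structure IsRotationOn (φ ν : EuclideanSpace ℝ (Fin n) → Mink n)
    (τ : EuclideanSpace ℝ (Fin n) → ℝ) (c : ℝ) (Φ : EuclideanSpace ℝ (Fin n) → Amb n)
    (V : Set (EuclideanSpace ℝ (Fin n))) : Prop where
  isOpen : IsOpen V
  hypersurface : IsHypersurfaceOn φ ν V
  contDiffAt : ∀ y ∈ V, ContDiffAt ℝ 2 Φ y
  eq : ∀ y ∈ V, Φ y = (Real.cosh (τ y) • φ y + Real.sinh (τ y) • ν y, τ y + c)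

/-- The unit normal direction of the rotated hypersurface along the normal geodesics. -/
def rotatedNormal (φ ν : EuclideanSpace ℝ (Fin n) → Mink n) (τ : EuclideanSpace ℝ (Fin n) → ℝ)
    (y : EuclideanSpace ℝ (Fin n)) : Mink n :=
  Real.sinh (τ y) • φ y + Real.cosh (τ y) • ν y

namespace IsRotationOn

lemma differentiableAt_τ (h : IsRotationOn φ ν τ c Φ V) (hp : p ∈ V) : DifferentiableAt ℝ τ p := by
  have h1 : (fun y => (Φ y).2 - c) =ᶠ[𝓝 p] τ := by
    filter_upwards [h.isOpen.mem_nhds hp] with y hy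
    rw [h.eq y hy]; simp
  exact ((((h.contDiffAt p hp).differentiableAt (by simp)).snd).sub_const c).congr_of_eventuallyEq
    h1.symm

lemma frame (h : IsRotationOn φ ν τ c Φ V) (hp : p ∈ V) : HypersurfaceFrame (φ p) (ν p)
    (fderiv ℝ φ p) (fderiv ℝ ν p) := by
  have := h.hypersurface.isHypersurfaceAt_flat h.isOpen hp
  unfold IsHypersurfaceAt at this
  rwa [differential_eq_fderiv, differential_eq_fderiv] at this

lemma differentiableAt (h : IsRotationOn φ ν τ c Φ V) (hp : p ∈ V) :
    DifferentiableAt ℝ φ p ∧ DifferentiableAt ℝ ν p :=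
  ⟨(contDiffAt_of_contMDiffOn h.isOpen h.hypersurface.contMDiffOn hp).differentiableAt (by simp),
    (contDiffAt_of_contMDiffOn h.isOpen h.hypersurface.gauss_contMDiffOn hp).differentiableAt
      (by simp)⟩

lemma fderiv_eq (h : IsRotationOn φ ν τ c Φ V) (hp : p ∈ V) (v : EuclideanSpace ℝ (Fin n)) :
    fderiv ℝ Φ p v = (Real.cosh (τ p) • fderiv ℝ φ p v + Real.sinh (τ p) • fderiv ℝ ν p v +
      fderiv ℝ τ p v • rotatedNormal φ ν τ p, fderiv ℝ τ p v) := by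
  obtain ⟨h1, h2⟩ := h.differentiableAt hp
  have h3 := h.differentiableAt_τ hp
  have h4 : Φ =ᶠ[𝓝 p]
      fun y => (Real.cosh (τ y) • φ y + Real.sinh (τ y) • ν y, τ y + c) := by
    filter_upwards [h.isOpen.mem_nhds hp] with y hy using h.eq y hy
  have h5 := ((h3.hasFDerivAt.cosh.smul h1.hasFDerivAt).add
    (h3.hasFDerivAt.sinh.smul h2.hasFDerivAt)).prodMk (h3.hasFDerivAt.add_const c)
  rw [h4.fderiv_eq]
  erw [h5.fderiv]
  ext1
  · simp [rotatedNormal]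
    module
  · simp

lemma fderiv_rotatedNormal (h : IsRotationOn φ ν τ c Φ V) (hp : p ∈ V) : DifferentiableAt ℝ
    (rotatedNormal φ ν τ) p ∧
    ∀ v, fderiv ℝ (rotatedNormal φ ν τ) p v =
      Real.sinh (τ p) • fderiv ℝ φ p v + Real.cosh (τ p) • fderiv ℝ ν p v +
        fderiv ℝ τ p v • (Φ p).1 := by
  obtain ⟨h1, h2⟩ := h.differentiableAt hp
  have h3 := h.differentiableAt_τ hp
  have h5 := (h3.hasFDerivAt.sinh.smul h1.hasFDerivAt).add
    (h3.hasFDerivAt.cosh.smul h2.hasFDerivAt)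
  refine ⟨h5.differentiableAt, fun v => ?_⟩
  erw [h5.fderiv]
  rw [h.eq p hp]
  simp
  module

lemma lor_rotate (h : IsRotationOn φ ν τ c Φ V) (hp : p ∈ V) : lor (Φ p).1 (Φ p).1 = -1 ∧
    lor (rotatedNormal φ ν τ p) (rotatedNormal φ ν τ p) = 1 ∧
    lor (rotatedNormal φ ν τ p) (Φ p).1 = 0 := by
  have hf := h.frame hp
  have hcs := Real.cosh_sq (τ p)
  rw [h.eq p hp, rotatedNormal]
  simp only [lor_add_left, lor_add_right, lor_smul_left, lor_smul_right, hf.base, hf.unit,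
    hf.normal, lor_comm (φ p) (ν p)]
  refine ⟨?_, ?_, ?_⟩ <;> nlinarith

/-- dφ and dν are orthogonal to φ and ν, whose span contains the rotated pair ψ, η. -/
lemma lor_rotate_deriv (h : IsRotationOn φ ν τ c Φ V) (hp : p ∈ V) (a b : ℝ)
    (v : EuclideanSpace ℝ (Fin n)) :
    lor (a • fderiv ℝ φ p v + b • fderiv ℝ ν p v) (Φ p).1 = 0 ∧
      lor (a • fderiv ℝ φ p v + b • fderiv ℝ ν p v) (rotatedNormal φ ν τ p) = 0 := by
  have hf := h.frame hp
  rw [h.eq p hp, rotatedNormal]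
  simp [lor_add_left, lor_add_right, lor_smul_left, lor_smul_right, hf.base_tangent,
    hf.base_deriv, hf.unit_tangent, hf.unit_deriv]

lemma isNormalAt (h : IsRotationOn φ ν τ c Φ V) (hp : p ∈ V) : IsNormalAt Φ p
    (rotatedNormal φ ν τ p, 1) := by
  refine ⟨(h.lor_rotate hp).2.2, fun v => ?_⟩
  rw [differential_eq_fderiv, h.fderiv_eq hp, amb_comm]
  simp only [amb]
  rw [lor_add_left, (h.lor_rotate_deriv hp _ _ v).2, lor_smul_left, (h.lor_rotate hp).2.1]
  ring

/-- The component dτ η of dψ has square dτ², which the vertical part of the metric cancels. The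
induced metric therefore ignores the variation of τ. -/
lemma amb_fderiv (h : IsRotationOn φ ν τ c Φ V) (hp : p ∈ V) (v w : EuclideanSpace ℝ (Fin n)) :
    amb (fderiv ℝ Φ p v) (fderiv ℝ Φ p w) =
      lor (Real.cosh (τ p) • fderiv ℝ φ p v + Real.sinh (τ p) • fderiv ℝ ν p v)
        (Real.cosh (τ p) • fderiv ℝ φ p w + Real.sinh (τ p) • fderiv ℝ ν p w) := by
  rw [h.fderiv_eq hp, h.fderiv_eq hp]
  simp only [amb]
  rw [lor_add_smul (h.lor_rotate_deriv hp _ _ v).2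
    (by rw [lor_comm]; exact (h.lor_rotate_deriv hp _ _ w).2), (h.lor_rotate hp).2.1]
  ring

lemma gram_eq (h : IsRotationOn φ ν τ c Φ V) (hp : p ∈ V) : gram (n := n) amb Φ p =
    gramOf lor (Real.cosh (τ p) • fderiv ℝ φ p + Real.sinh (τ p) • fderiv ℝ ν p) := by
  ext i j
  simp only [gram, gramOf, Matrix.of_apply, differential_eq_fderiv, h.amb_fderiv hp]
  rfl

lemma isNondegAt (h : IsRotationOn φ ν τ c Φ V) (hp : p ∈ V)
    (hdet : (gram amb Φ p : Matrix (Fin n) (Fin n) ℝ).det ≠ 0) :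
    IsNondegAt Φ p := by
  refine ⟨(h.lor_rotate hp).1, fun v => ?_, hdet⟩
  rw [differential_eq_fderiv, h.fderiv_eq hp]
  rw [lor_add_left, (h.lor_rotate_deriv hp _ _ v).1, lor_smul_left, (h.lor_rotate hp).2.2]
  ring

/-- The Gram matrix is Bᵀ G B with B = sinh τ (coth τ - A), so an eigenvalue coth τ would make it
singular. The converse uses this, where non-degeneracy is given. -/
lemma not_isRoot_of_det_ne_zero (h : IsRotationOn φ ν τ c Φ V) (hp : p ∈ V)
    (hτ : Real.sinh (τ p) ≠ 0)
    (hdet : (gram amb Φ p : Matrix (Fin n) (Fin n) ℝ).det ≠ 0) :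
    ¬ (shapeMat (fderiv ℝ φ p) (fderiv ℝ ν p)).charpoly.IsRoot
      (Real.cosh (τ p) / Real.sinh (τ p)) := by
  intro hroot
  apply hdet
  rw [HypersurfaceFrame.isRoot_charpoly_iff] at hroot
  have e1 : (Real.cosh (τ p) • 1 + (-Real.sinh (τ p)) • shapeMat (fderiv ℝ φ p) (fderiv ℝ ν p)) =
      Real.sinh (τ p) • ((Real.cosh (τ p) / Real.sinh (τ p)) • 1 -
        shapeMat (fderiv ℝ φ p) (fderiv ℝ ν p)) := by
    rw [smul_sub, smul_smul, mul_div_cancel₀ _ hτ]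
    module
  have e2 : gram (n := n) amb Φ p =
      (Real.cosh (τ p) • 1 + (-Real.sinh (τ p)) • shapeMat (fderiv ℝ φ p)
        (fderiv ℝ ν p)).transpose * gramOf lor (fderiv ℝ φ p) *
      (Real.cosh (τ p) • 1 + (-Real.sinh (τ p)) • shapeMat (fderiv ℝ φ p) (fderiv ℝ ν p)) := by
    rw [h.gram_eq hp, ← HypersurfaceFrame.lor_comp_matCLM]
    ext i j
    simp only [gramOf, Matrix.of_apply, add_apply, smul_apply, (h.frame hp).rotate_apply]
  rw [e2, e1, Matrix.det_mul, Matrix.det_smul _ (Real.sinh (τ p)), hroot]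
  simp

/-- In ⟨dψ, dη⟩ the terms with dτ vanish, since dψ contributes dτ η, dη contributes dτ ψ, and η is
orthogonal to ψ. What remains is the trace computed in the rotated frame. -/
lemma amb_meanCurv_eq_zero_iff (h : IsRotationOn φ ν τ c Φ V) (hp : p ∈ V)
    (hτ : Real.sinh (τ p) ≠ 0)
    (hs : ¬ (shapeMat (fderiv ℝ φ p) (fderiv ℝ ν p)).charpoly.IsRoot
      (Real.cosh (τ p) / Real.sinh (τ p))) :
    amb (meanCurv Φ p) (rotatedNormal φ ν τ p, 1) = 0 ↔
      (trapPoly φ ν p).IsRoot (Real.cosh (τ p) / Real.sinh (τ p)) := by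
  have hN : ∀ᶠ y in 𝓝 p, IsNormalAt Φ y (rotatedNormal φ ν τ y, 1) := by
    filter_upwards [h.isOpen.mem_nhds hp] with y hy using h.isNormalAt hy
  obtain ⟨h1, h2⟩ := h.fderiv_rotatedNormal hp
  rw [(h.hypersurface.isHypersurfaceAt_flat h.isOpen hp).trapPoly_eq, differential_eq_fderiv,
    differential_eq_fderiv, amb_meanCurv_null_normal (h.contDiffAt p hp) h1 hN,
    ← (h.frame hp).trace_rotate_eq_zero_iff hτ hs (h.gram_eq hp), neg_eq_zero]
  have key : ∀ v w, lor (fderiv ℝ Φ p w).1 (fderiv ℝ (rotatedNormal φ ν τ) p v) =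
      lor (Real.cosh (τ p) • fderiv ℝ φ p w + Real.sinh (τ p) • fderiv ℝ ν p w)
        (Real.sinh (τ p) • fderiv ℝ φ p v + Real.cosh (τ p) • fderiv ℝ ν p v) := by
    intro v w
    rw [h.fderiv_eq hp, h2]
    simp only
    rw [lor_add_smul (h.lor_rotate_deriv hp _ _ w).1
      (by rw [lor_comm]; exact (h.lor_rotate_deriv hp _ _ v).2), (h.lor_rotate hp).2.2]
    ring
  simp only [key]

lemma rotate_deriv_injective (h : IsRotationOn φ ν τ c Φ V) (hp : p ∈ V) (hτ : Real.sinh (τ p) ≠ 0)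
    (hs : ¬ (shapeMat (fderiv ℝ φ p) (fderiv ℝ ν p)).charpoly.IsRoot
      (Real.cosh (τ p) / Real.sinh (τ p))) (v : EuclideanSpace ℝ (Fin n))
    (hv : Real.cosh (τ p) • fderiv ℝ φ p v + Real.sinh (τ p) • fderiv ℝ ν p v = 0) : v = 0 :=
  (h.frame hp).rotate_injective hτ hs hv

lemma amb_fderiv_pos (h : IsRotationOn φ ν τ c Φ V) (hp : p ∈ V) (hτ : Real.sinh (τ p) ≠ 0)
    (hs : ¬ (shapeMat (fderiv ℝ φ p) (fderiv ℝ ν p)).charpoly.IsRoot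
      (Real.cosh (τ p) / Real.sinh (τ p))) {v : EuclideanSpace ℝ (Fin n)} (hv : v ≠ 0) :
    0 < amb (fderiv ℝ Φ p v) (fderiv ℝ Φ p v) := by
  rw [h.amb_fderiv hp]
  exact lor_self_pos (h.lor_rotate hp).1 (h.lor_rotate_deriv hp _ _ v).1
    fun h0 => hv (h.rotate_deriv_injective hp hτ hs v h0)

/-- A normal vector orthogonal to the null normal of the rotated hypersurface is null. -/
lemma amb_self_eq_zero (h : IsRotationOn φ ν τ c Φ V) (hp : p ∈ V) (hτ : Real.sinh (τ p) ≠ 0)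
    (hs : ¬ (shapeMat (fderiv ℝ φ p) (fderiv ℝ ν p)).charpoly.IsRoot
      (Real.cosh (τ p) / Real.sinh (τ p))) {w : Amb n} (hw : IsNormalAt Φ p w)
    (hwN : amb w (rotatedNormal φ ν τ p, 1) = 0) : amb w w = 0 := by
  obtain ⟨l1, l2, l3⟩ := h.lor_rotate hp
  have hwN' : lor w.1 (rotatedNormal φ ν τ p) = w.2 := by
    simp only [amb] at hwN; linarith
  -- The difference is orthogonal to ψ, to η and to the n-plane complementary to them, hence zero; w
  -- is a multiple of the null normal.
  have h1 : w.1 - w.2 • rotatedNormal φ ν τ p = 0 := by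
    refine eq_zero_of_orthogonal_frame (X := Real.cosh (τ p) • fderiv ℝ φ p +
      Real.sinh (τ p) • fderiv ℝ ν p) l1 l2 l3 (h.rotate_deriv_injective hp hτ hs)
      (fun v => (h.lor_rotate_deriv hp _ _ v).1) (fun v => (h.lor_rotate_deriv hp _ _ v).2)
      ?_ ?_ fun v => ?_
    · rw [lor_sub_left, hw.1, lor_smul_left, l3]; ring
    · rw [lor_sub_left, hwN', lor_smul_left, l2]; ring
    · have h2 := hw.2 v
      rw [differential_eq_fderiv, h.fderiv_eq hp] at h2
      simp only [amb] at h2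
      rw [lor_add_right, lor_smul_right, hwN'] at h2
      have h3 := (h.lor_rotate_deriv hp (Real.cosh (τ p)) (Real.sinh (τ p)) v).2
      rw [add_apply, smul_apply, smul_apply, lor_sub_left, lor_smul_left,
        lor_comm (rotatedNormal φ ν τ p), h3]
      linarith
  rw [amb, sub_eq_zero.mp h1, lor_smul_left, lor_smul_right, l2]
  ring

end IsRotationOn

end Rotation

/-! ### Hyperbolic functions of the inverse hyperbolic cotangent. -/

section Arcoth

lemma sinh_arcoth {s : ℝ} (hs : 1 < |s|) :
    Real.sinh (arcoth s) = Real.sign s / √(s ^ 2 - 1) ∧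
      Real.cosh (arcoth s) = Real.sign s / √(s ^ 2 - 1) * s := by
  have hs0 : s ≠ 0 := by rintro rfl; norm_num at hs
  have hx : s⁻¹ ∈ Set.Ioo (-1 : ℝ) 1 := by
    rw [Set.mem_Ioo, ← abs_lt, abs_inv]
    exact inv_lt_one_of_one_lt₀ hs
  have h1 : (1 : ℝ) - s⁻¹ ^ 2 = (s ^ 2 - 1) / s ^ 2 := by field_simp
  have h2 : 0 < s ^ 2 - 1 := by rw [← sq_abs]; nlinarith
  have h3 : √(s ^ 2 - 1) ≠ 0 := (Real.sqrt_pos.mpr h2).ne'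
  rw [arcoth, Real.sinh_artanh hx, Real.cosh_artanh hx, h1, Real.sqrt_div h2.le,
    Real.sqrt_sq_eq_abs]
  rcases lt_or_gt_of_ne hs0 with h | h
  · rw [Real.sign_of_neg h, abs_of_neg h]
    constructor <;> field_simp
  · rw [Real.sign_of_pos h, abs_of_pos h]
    constructor <;> field_simp

lemma sinh_arcoth_ne_zero {s : ℝ} (hs : 1 < |s|) : Real.sinh (arcoth s) ≠ 0 := by
  have hs0 : s ≠ 0 := by rintro rfl; norm_num at hs
  have h2 : 0 < s ^ 2 - 1 := by rw [← sq_abs]; nlinarith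
  rw [(sinh_arcoth hs).1]
  exact div_ne_zero (by simpa [Real.sign_eq_zero_iff] using hs0) (Real.sqrt_pos.mpr h2).ne'

lemma cosh_div_sinh_arcoth {s : ℝ} (hs : 1 < |s|) :
    Real.cosh (arcoth s) / Real.sinh (arcoth s) = s := by
  have h := sinh_arcoth_ne_zero hs
  rw [div_eq_iff h, (sinh_arcoth hs).1, (sinh_arcoth hs).2]
  ring

/-- No condition t ≠ 0 is needed: at t = 0 division by zero gives 0 on both sides. -/
lemma arcoth_cosh_div_sinh (t : ℝ) : arcoth (Real.cosh t / Real.sinh t) = t := by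
  rw [arcoth, inv_div, ← Real.tanh_eq_sinh_div_cosh, Real.artanh_tanh]

lemma one_lt_abs_cosh_div_sinh {t : ℝ} (ht : t ≠ 0) : 1 < |Real.cosh t / Real.sinh t| := by
  have h1 : Real.sinh t ≠ 0 := by simpa using ht
  rw [abs_div, one_lt_div (abs_pos.mpr h1), ← sq_lt_sq, Real.cosh_sq]
  linarith

/-- The normalizing factor, with its sign, is sinh t for t = coth⁻¹ s, so the map is a hyperbolic
rotation by t at height t. -/
lemma trapMap_eq {n : ℕ} {M : Type*} (φ ν : M → Mink n) {s : M → ℝ} {x : M}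
    (hs : 1 < |s x|) :
    trapMap φ ν s x = (Real.cosh (arcoth (s x)) • φ x + Real.sinh (arcoth (s x)) • ν x,
      arcoth (s x)) := by
  rw [trapMap, (sinh_arcoth hs).1, (sinh_arcoth hs).2, smul_add, smul_smul]

lemma contDiffAt_arcoth {s : ℝ} (hs : 1 < |s|) {k : ℕ∞ω} : ContDiffAt ℝ k arcoth s := by
  have hs0 : s ≠ 0 := by rintro rfl; norm_num at hs
  have hx : s⁻¹ ∈ Set.Ioo (-1 : ℝ) 1 := by
    rw [Set.mem_Ioo, ← abs_lt, abs_inv]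
    exact inv_lt_one_of_one_lt₀ hs
  have h1 : 0 < 1 - s⁻¹ := by linarith [hx.2]
  have h2 : 0 < 1 + s⁻¹ := by linarith [hx.1]
  have h3 : 0 < (1 + s⁻¹) / (1 - s⁻¹) := div_pos h2 h1
  unfold arcoth Real.artanh
  have hi : ContDiffAt ℝ k (fun s : ℝ => s⁻¹) s := _root_.contDiffAt_inv ℝ hs0
  refine ContDiffAt.log (ContDiffAt.sqrt ?_ h3.ne') (Real.sqrt_pos.mpr h3).ne'
  exact (contDiffAt_const.add hi).div (contDiffAt_const.sub hi) h1.ne'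

end Arcoth

/-! ### Implicit functions and the regularity of the roots of P. -/

section Implicit

/-- The implicit function theorem in finite dimensions. -/
lemma exists_implicit_function {X Y Z : Type*} [NormedAddCommGroup X] [NormedSpace ℝ X]
    [CompleteSpace X] [NormedAddCommGroup Y] [NormedSpace ℝ Y] [FiniteDimensional ℝ Y]
    [NormedAddCommGroup Z] [NormedSpace ℝ Z] [FiniteDimensional ℝ Z]
    (hdim : Module.finrank ℝ Y = Module.finrank ℝ Z) {F : X × Y → Z} {u : X × Y} {k : ℕ∞ω}
    (hF : ContDiffAt ℝ k F u) (hk : k ≠ 0) (hu : F u = 0)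
    (hinj : ∀ w, fderiv ℝ F u (0, w) = 0 → w = 0) :
    ∃ g : X → Y, g u.1 = u.2 ∧ ContDiffAt ℝ k g u.1 ∧ (∀ᶠ x in 𝓝 u.1, F (x, g x) = 0) ∧
      ∀ᶠ v in 𝓝 u, F v = 0 → g v.1 = v.2 := by
  have : CompleteSpace Y := FiniteDimensional.complete ℝ Y
  have : CompleteSpace Z := FiniteDimensional.complete ℝ Z
  set L := fderiv ℝ F u ∘L .inr ℝ X Y with hL
  have hLinj : Function.Injective (L : Y →ₗ[ℝ] Z) := by
    rw [← LinearMap.ker_eq_bot, LinearMap.ker_eq_bot']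
    intro w hw
    exact hinj w (by simpa [hL] using hw)
  have hinv : L.IsInvertible := by
    refine ⟨((L : Y →ₗ[ℝ] Z).linearEquivOfInjective hLinj hdim).toContinuousLinearEquiv, ?_⟩
    ext w; simp
  refine ⟨hF.implicitFunction hk hinv, hF.implicitFunction_apply_self hk hinv,
    hF.contDiffAt_implicitFunction hk hinv, ?_, ?_⟩
  · filter_upwards [hF.eventually_apply_implicitFunction hk hinv] with x hx
    rw [hx, hu]
  · filter_upwards [hF.eventually_apply_eq_iff_implicitFunction hk hinv] with v hv h0
    exact hv.mp (by rw [h0, hu])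

end Implicit

section Roots

variable {n : ℕ} {M : Type*} [TopologicalSpace M] [ChartedSpace (EuclideanSpace ℝ (Fin n)) M]
  {φ ν : M → Mink n} {x : M}

lemma ncard_roots_le (h : IsHypersurfaceAt φ ν x) (h0 : trapPoly φ ν x ≠ 0) :
    {s : ℝ | (trapPoly φ ν x).IsRoot s ∧ 1 < |s|}.ncard ≤ (principalCurvatures φ ν x).card := by
  have h1 : {s : ℝ | (trapPoly φ ν x).IsRoot s ∧ 1 < |s|} ⊆
      ((trapPoly φ ν x).roots.toFinset : Set ℝ) := by
    intro s hs
    simpa [h0] using hs.1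
  calc _ ≤ ((trapPoly φ ν x).roots.toFinset : Set ℝ).ncard :=
        Set.ncard_le_ncard h1 (Finset.finite_toSet _)
    _ = (trapPoly φ ν x).roots.toFinset.card := Set.ncard_coe_finset _
    _ ≤ Multiset.card (trapPoly φ ν x).roots := Multiset.toFinset_card_le _
    _ ≤ (trapPoly φ ν x).natDegree := Polynomial.card_roots' _
    _ ≤ _ := by
        rw [h.trapPoly_eq, IsHypersurfaceAt.card_principalCurvatures]
        exact natDegree_rootPoly_le _

lemma IsHypersurfaceAt.not_isRoot_charpoly (h : IsHypersurfaceAt φ ν x) {s : ℝ}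
    (hs : (trapPoly φ ν x).IsRoot s) (hs1 : 1 < |s|) :
    ¬ (shapeMat (differential (n := n) φ x) (differential (n := n) ν x)).charpoly.IsRoot s := by
  rw [h.trapPoly_eq] at hs
  exact HypersurfaceFrame.not_isRoot_charpoly hs hs1

/-- The trace `tr (adj (s - A) (s A - 1))`. -/
def trapTrace (A : Matrix (Fin n) (Fin n) ℝ) (s : ℝ) : ℝ :=
  ((s • 1 - A).adjugate * (s • A - 1)).trace

/-- adj(s - A) = det(s - A) (s - A)⁻¹, and det(s - A) is the characteristic polynomial. Off the
spectrum the trace is thus P times a nonvanishing factor, but unlike P it depends polynomially on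
the entries of A. -/
lemma IsHypersurfaceAt.trapTrace_eq (h : IsHypersurfaceAt φ ν x) {s : ℝ}
    (hs : ¬ (shapeMat (differential (n := n) φ x) (differential (n := n) ν x)).charpoly.IsRoot s) :
    trapTrace (shapeMat (differential (n := n) φ x) (differential (n := n) ν x)) s =
      (shapeMat (differential (n := n) φ x) (differential (n := n) ν x)).charpoly.eval s /
        (∏ k ∈ (shapeMat (differential (n := n) φ x)
          (differential (n := n) ν x)).charpoly.roots.toFinset, (s - k)) *
        (trapPoly φ ν x).eval s ∧
    (∏ k ∈ (shapeMat (differential (n := n) φ x)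
          (differential (n := n) ν x)).charpoly.roots.toFinset, (s - k)) ≠ 0 := by
  set A := shapeMat (differential (n := n) φ x) (differential (n := n) ν x) with hA
  have hprod2 : (∏ k ∈ A.charpoly.roots.toFinset, (s - k)) ≠ 0 := by
    refine Finset.prod_ne_zero_iff.mpr fun k hk hk0 => hs ?_
    rw [sub_eq_zero.mp hk0]
    exact Polynomial.isRoot_of_mem_roots (Multiset.mem_toFinset.mp hk)
  refine ⟨?_, hprod2⟩
  obtain ⟨P, d, hPd⟩ := h.exists_diagonalization
  have hdet : (s • 1 - A).det ≠ 0 := by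
    rwa [HypersurfaceFrame.isRoot_charpoly_iff] at hs
  have hev : A.charpoly.eval s = (s • 1 - A).det := by
    rw [Matrix.eval_charpoly, Matrix.scalar_apply, Matrix.smul_one_eq_diagonal]
  rw [h.trapPoly_eq, ← hA, ← trace_adjugate_mul_eq hPd hs, ← hA, hev, Matrix.inv_def,
    Ring.inverse_eq_inv', Matrix.smul_mul, Matrix.trace_smul, trapTrace, smul_eq_mul]
  field_simp

lemma IsHypersurfaceAt.trapTrace_eq_zero_iff (h : IsHypersurfaceAt φ ν x) {s : ℝ}
    (hs : ¬ (shapeMat (differential (n := n) φ x) (differential (n := n) ν x)).charpoly.IsRoot s) :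
    trapTrace (shapeMat (differential (n := n) φ x) (differential (n := n) ν x)) s = 0 ↔
      (trapPoly φ ν x).IsRoot s := by
  obtain ⟨h1, h2⟩ := h.trapTrace_eq hs
  rw [h1, mul_eq_zero_iff_left (div_ne_zero hs h2), Polynomial.IsRoot]

/-- At a root of P the product rule leaves only the nonvanishing factor times P'(s). -/
lemma IsHypersurfaceAt.deriv_trapTrace (h : IsHypersurfaceAt φ ν x) {s : ℝ}
    (hroot : (trapPoly φ ν x).IsRoot s) (hs1 : 1 < |s|)
    (hsimple : ¬ (trapPoly φ ν x).derivative.IsRoot s) {d : ℝ}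
    (hd : HasDerivAt (trapTrace (shapeMat (differential (n := n) φ x) (differential (n := n) ν x)))
      d s) : d ≠ 0 := by
  have hs := h.not_isRoot_charpoly hroot hs1
  set A := shapeMat (differential (n := n) φ x) (differential (n := n) ν x) with hA
  obtain ⟨-, h2⟩ := h.trapTrace_eq hs
  set c : ℝ → ℝ := fun σ => A.charpoly.eval σ / (∏ k ∈ A.charpoly.roots.toFinset, (σ - k)) with hc
  have hev : ∀ᶠ σ in 𝓝 s, ¬ A.charpoly.IsRoot σ :=
    A.charpoly.continuous.continuousAt.eventually_ne hs
  have heq : trapTrace A =ᶠ[𝓝 s] fun σ => c σ * (trapPoly φ ν x).eval σ := by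
    filter_upwards [hev] with σ hσ using (h.trapTrace_eq hσ).1
  have hcd : DifferentiableAt ℝ c s := by
    refine A.charpoly.differentiableAt.div ?_ h2
    exact DifferentiableAt.fun_finsetProd fun k _ => differentiableAt_id.sub_const k
  have h3 := (hcd.hasDerivAt.mul ((trapPoly φ ν x).hasDerivAt s)).congr_of_eventuallyEq heq
  rw [hd.unique h3, hroot, mul_zero, zero_add]
  exact mul_ne_zero (div_ne_zero hs h2) hsimple

end Roots

section FlatRoots

variable {n : ℕ} {φ ν : EuclideanSpace ℝ (Fin n) → Mink n} {V : Set (EuclideanSpace ℝ (Fin n))}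
  {p : EuclideanSpace ℝ (Fin n)}

/-- The class is set by dν, which is C² because ν is C³; this determines the class of the root
functions. -/
lemma IsHypersurfaceOn.contDiffAt_shapeMat (h : IsHypersurfaceOn φ ν V) (hV : IsOpen V)
    (hp : p ∈ V) (i j : Fin n) :
    ContDiffAt ℝ 2 (fun y => shapeMat (differential (n := n) φ y) (differential (n := n) ν y) i j)
      p := by
  simp only [differential_eq_fderiv]
  have hφ : ContDiffAt ℝ 2 (fderiv ℝ φ) p :=
    (contDiffAt_of_contMDiffOn hV h.contMDiffOn hp).fderiv_right (by norm_num)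
  have hν : ContDiffAt ℝ 2 (fderiv ℝ ν) p :=
    (contDiffAt_of_contMDiffOn hV h.gauss_contMDiffOn hp).fderiv_right (by norm_num)
  have h1 : ∀ v, ContDiffAt ℝ 2 (fun y => fderiv ℝ φ y v) p := fun v =>
    hφ.clm_apply contDiffAt_const
  have h2 : ∀ v, ContDiffAt ℝ 2 (fun y => fderiv ℝ ν y v) p := fun v =>
    hν.clm_apply contDiffAt_const
  have h3 : (gramOf lor (fderiv ℝ φ p)).det ≠ 0 := by
    have := (h.isHypersurfaceAt_flat hV hp).gram_det_isUnit.ne_zero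
    rwa [differential_eq_fderiv] at this
  simp only [shapeMat, Matrix.mul_apply]
  refine ContDiffAt.sum fun k _ => ContDiffAt.mul ?_ ?_
  · refine TrappedHyp.contDiffAt_inv (A := fun y => gramOf lor (fderiv ℝ φ y)) (fun a b => ?_)
      h3 i k
    exact ContDiffAt.lor (h1 _) (h1 _)
  · exact (ContDiffAt.lor (h1 _) (h2 _)).neg

lemma contDiffAt_trapTrace {A : EuclideanSpace ℝ (Fin n) → Matrix (Fin n) (Fin n) ℝ} {k : ℕ∞ω}
    (hA : ∀ i j, ContDiffAt ℝ k (fun y => A y i j) p) (s : ℝ) :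
    ContDiffAt ℝ k (fun v : EuclideanSpace ℝ (Fin n) × ℝ => trapTrace (A v.1) v.2) (p, s) := by
  have h1 : ∀ i j, ContDiffAt ℝ k (fun v : EuclideanSpace ℝ (Fin n) × ℝ => A v.1 i j) (p, s) :=
    fun i j => (hA i j).comp (p, s) contDiffAt_fst
  have h2 : ContDiffAt ℝ k (fun v : EuclideanSpace ℝ (Fin n) × ℝ => v.2) (p, s) := contDiffAt_snd
  simp only [trapTrace, Matrix.trace, Matrix.diag_apply, Matrix.mul_apply]
  refine ContDiffAt.sum fun i _ => ContDiffAt.sum fun j _ => ContDiffAt.mul ?_ ?_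
  · refine contDiffAt_adjugate (A := fun v : EuclideanSpace ℝ (Fin n) × ℝ => v.2 • 1 - A v.1)
      (fun a b => ?_) i j
    simp only [Matrix.sub_apply, Matrix.smul_apply, smul_eq_mul]
    exact (h2.mul contDiffAt_const).sub (h1 a b)
  · simp only [Matrix.sub_apply, Matrix.smul_apply, smul_eq_mul]
    exact (h2.mul (h1 _ _)).sub contDiffAt_const

/-- The implicit function theorem for `trapTrace`, transferred to P near the given point, where s
stays off the spectrum. The final clause is local uniqueness, which identifies any continuous root
with g. -/
lemma IsHypersurfaceOn.exists_root_function (h : IsHypersurfaceOn φ ν V) (hV : IsOpen V)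
    (hp : p ∈ V) {s : ℝ} (hroot : (trapPoly φ ν p).IsRoot s) (hs1 : 1 < |s|)
    (hsimple : ¬ (trapPoly φ ν p).derivative.IsRoot s) :
    ∃ g : EuclideanSpace ℝ (Fin n) → ℝ, g p = s ∧ ContDiffAt ℝ 2 g p ∧
      (∀ᶠ q in 𝓝 p, (trapPoly φ ν q).IsRoot (g q)) ∧
      ∀ᶠ v in 𝓝 (p, s), (trapPoly φ ν v.1).IsRoot v.2 → g v.1 = v.2 := by
  have hat : ∀ q ∈ V, IsHypersurfaceAt φ ν q := fun q hq => h.isHypersurfaceAt_flat hV hq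
  set A : EuclideanSpace ℝ (Fin n) → Matrix (Fin n) (Fin n) ℝ := fun y =>
    shapeMat (differential (n := n) φ y) (differential (n := n) ν y) with hA
  have hAc : ∀ i j, ContDiffAt ℝ 2 (fun y => A y i j) p := fun i j =>
    h.contDiffAt_shapeMat hV hp i j
  have hAc' : ∀ i j, ContDiffAt ℝ 2 (fun v : EuclideanSpace ℝ (Fin n) × ℝ => A v.1 i j) (p, s) :=
    fun i j => ContDiffAt.comp (g := fun y => A y i j) (f := Prod.fst) (p, s) (hAc i j)
      contDiffAt_fst
  have hF := contDiffAt_trapTrace (A := A) hAc s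
  have hs := (hat p hp).not_isRoot_charpoly hroot hs1
  have hcharc : ContinuousAt (fun v : EuclideanSpace ℝ (Fin n) × ℝ => (v.2 • 1 - A v.1).det)
      (p, s) := by
    refine (contDiffAt_det (A := fun v : EuclideanSpace ℝ (Fin n) × ℝ => v.2 • 1 - A v.1)
      (k := 2) fun a b => ?_).continuousAt
    simp only [Matrix.sub_apply, Matrix.smul_apply, smul_eq_mul]
    exact (contDiffAt_snd.mul contDiffAt_const).sub (hAc' a b)
  have hev : ∀ᶠ v : EuclideanSpace ℝ (Fin n) × ℝ in 𝓝 (p, s), ¬ (A v.1).charpoly.IsRoot v.2 := by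
    simp only [HypersurfaceFrame.isRoot_charpoly_iff]
    refine hcharc.eventually_ne ?_
    rwa [HypersurfaceFrame.isRoot_charpoly_iff] at hs
  have hVev : ∀ᶠ v : EuclideanSpace ℝ (Fin n) × ℝ in 𝓝 (p, s), v.1 ∈ V :=
    continuousAt_fst.eventually (hV.mem_nhds hp)
  obtain ⟨g, hg1, hg2, hg3, hg4⟩ := exists_implicit_function (u := (p, s)) (by simp) hF (by simp)
    (((hat p hp).trapTrace_eq_zero_iff hs).mpr hroot) (by
      intro w hw
      have h1 := (hF.differentiableAt (by simp)).hasFDerivAt.comp_hasDerivAt s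
        ((hasDerivAt_const s p).prodMk (hasDerivAt_id s))
      have h2 := (hat p hp).deriv_trapTrace hroot hs1 hsimple h1
      have h3 : ((0, w) : EuclideanSpace ℝ (Fin n) × ℝ) = w • (0, 1) := by simp
      rw [h3, map_smul, smul_eq_mul] at hw
      exact (mul_eq_zero.mp hw).resolve_right h2)
  refine ⟨g, hg1, hg2, ?_, ?_⟩
  · have ht : Filter.Tendsto (fun q => (q, g q)) (𝓝 p) (𝓝 (p, s)) := by
      have := continuousAt_id.prodMk (hg2.continuousAt)
      simpa [ContinuousAt, hg1] using this
    filter_upwards [hg3, ht.eventually hev, ht.eventually hVev] with q h1 h2 h3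
    exact ((hat q h3).trapTrace_eq_zero_iff h2).mp h1
  · filter_upwards [hg4, hev, hVev] with v h1 h2 h3 h4
    exact h1 (((hat v.1 h3).trapTrace_eq_zero_iff h2).mpr h4)

end FlatRoots

section RootFunctions

variable {n : ℕ} {M : Type*} [TopologicalSpace M] [ChartedSpace (EuclideanSpace ℝ (Fin n)) M]
  [IsManifold (𝓡 n) ∞ M] {φ ν : M → Mink n} {U : Set M} {s : M → ℝ}

lemma IsHypersurfaceOn.contMDiffOn_of_simple_root (h : IsHypersurfaceOn φ ν U) (hU : IsOpen U)
    (hs : ContinuousOn s U) (hroot : IsRootOn φ ν s U)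
    (hsimple : ∀ x ∈ U, ¬ (trapPoly φ ν x).derivative.IsRoot (s x)) :
    ContMDiffOn (𝓡 n) 𝓘(ℝ, ℝ) 2 s U := by
  intro y hyU
  refine ContMDiffAt.contMDiffWithinAt ?_
  have hy := mem_extChartAt_source (I := 𝓡 n) y
  rw [← contDiffAt_inChart_iff (x := y) ENat.LEInfty.out hy]
  have hV := isOpen_chartDomain (n := n) y hU
  have hp := mem_chartDomain (n := n) hyU hy
  have ht := (h.transfer hU hyU hy).2.1
  obtain ⟨g, hg1, hg2, hg3, hg4⟩ := (h.inChart hU y).exists_root_function hV hp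
    (s := s y) (by rw [← ht]; exact (hroot y hyU).1) (hroot y hyU).2
    (by rw [← ht]; exact hsimple y hyU)
  have hcont : ContinuousAt (TrappedHyp.inChart (n := n) y s) (extChartAt (𝓡 n) y y) := by
    refine ContinuousAt.comp ?_ (continuousAt_extChartAt_symm y)
    rw [(extChartAt (𝓡 n) y).left_inv hy]
    exact hs.continuousAt (hU.mem_nhds hyU)
  -- Continuity of s keeps its graph in the neighbourhood where the implicit function is the only
  -- root.
  have htend : Filter.Tendsto (fun q => (q, TrappedHyp.inChart (n := n) y s q))
      (𝓝 (extChartAt (𝓡 n) y y)) (𝓝 (extChartAt (𝓡 n) y y, s y)) := by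
    have := (continuousAt_id (x := extChartAt (𝓡 n) y y)).prodMk hcont
    rw [ContinuousAt, inChart_apply _ hy] at this
    exact this
  refine hg2.congr_of_eventuallyEq ?_
  filter_upwards [htend.eventually hg4, hV.mem_nhds hp] with q h1 h2
  obtain ⟨z, hzU, hz, rfl⟩ := exists_of_mem_chartDomain h2
  refine (h1 ?_).symm
  rw [← (h.transfer hU hzU hz).2.1, inChart_apply _ hz]
  exact (hroot z hzU).1

lemma IsHypersurfaceOn.exists_root_extension (h : IsHypersurfaceOn φ ν U) (hU : IsOpen U) {x : M}
    (hx : x ∈ U) {s₀ : ℝ} (hroot : (trapPoly φ ν x).IsRoot s₀) (hs : 1 < |s₀|)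
    (hsimple : ¬ (trapPoly φ ν x).derivative.IsRoot s₀) :
    ∃ (V : Set M) (s : M → ℝ), IsOpen V ∧ x ∈ V ∧ V ⊆ U ∧ s x = s₀ ∧
      ContMDiffOn (𝓡 n) 𝓘(ℝ, ℝ) 2 s V ∧ IsRootOn φ ν s V := by
  have hxs := mem_extChartAt_source (I := 𝓡 n) x
  have hV := isOpen_chartDomain (n := n) x hU
  have hp := mem_chartDomain (n := n) hx hxs
  have ht := (h.transfer hU hx hxs).2.1
  obtain ⟨g, hg1, hg2, hg3, -⟩ := (h.inChart hU x).exists_root_function hV hp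
    (s := s₀) (by rwa [← ht]) hs (by rwa [← ht])
  have habs : ∀ᶠ q in 𝓝 (extChartAt (𝓡 n) x x), 1 < |g q| :=
    (hg2.continuousAt.abs).eventually_const_lt (by simpa only [hg1] using hs)
  have hdom : ∀ᶠ q in 𝓝 (extChartAt (𝓡 n) x x), q ∈ chartDomain (n := n) x U := hV.mem_nhds hp
  have hall := hdom.and
    (((hg2.eventually (by simp)).and hg3).and habs)
  obtain ⟨W, hW, hWo, hpW⟩ := eventually_nhds_iff.mp hall
  refine ⟨chartPreimage x W, g ∘ extChartAt (𝓡 n) x, isOpen_chartPreimage x hWo, ⟨hxs, hpW⟩,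
    ?_, hg1, ?_, ?_⟩
  · intro y hy
    obtain ⟨z, hzU, hz, hzy⟩ := exists_of_mem_chartDomain (hW _ hy.2).1
    rwa [(extChartAt (𝓡 n) x).injOn hy.1 hz hzy.symm]
  · refine contMDiffOn_comp_extChart ENat.LEInfty.out hWo ?_ x
    rw [contMDiffOn_iff_contDiffOn]
    exact fun q hq => (hW q hq).2.1.1.contDiffWithinAt
  · intro y hy
    obtain ⟨z, hzU, hz, hzy⟩ := exists_of_mem_chartDomain (hW _ hy.2).1
    obtain rfl := (extChartAt (𝓡 n) x).injOn hy.1 hz hzy.symm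
    rw [(h.transfer hU hzU hz).2.1]
    exact ⟨(hW _ hy.2).2.1.2, (hW _ hy.2).2.2⟩

end RootFunctions

/-! ### Locality of the geometric conditions. -/

section Congr

variable {n : ℕ} {M : Type*} [TopologicalSpace M] [ChartedSpace (EuclideanSpace ℝ (Fin n)) M]
  {Φ Ψ : M → Amb n} {x : M} {U : Set M}

lemma secondDeriv_congr (h : Φ =ᶠ[𝓝 x] Ψ) :
    secondDeriv (n := n) Φ x = secondDeriv (n := n) Ψ x := by
  have hc := continuousAt_extChartAt_symm (I := 𝓡 n) x
  rw [ContinuousAt, (extChartAt (𝓡 n) x).left_inv (mem_extChartAt_source x)] at hc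
  have h1 : Φ ∘ (extChartAt (𝓡 n) x).symm =ᶠ[𝓝 (extChartAt (𝓡 n) x x)]
      Ψ ∘ (extChartAt (𝓡 n) x).symm := hc.eventually h
  exact h1.fderiv.fderiv_eq

lemma gram_congr (h : differential (n := n) Φ x = differential (n := n) Ψ x) :
    gram (n := n) amb Φ x = gram (n := n) amb Ψ x := by
  rw [gram_eq_gramOf, gram_eq_gramOf, h]

lemma meanCurv_congr (h0 : (Φ x).1 = (Ψ x).1)
    (h1 : differential (n := n) Φ x = differential (n := n) Ψ x)
    (h2 : secondDeriv (n := n) Φ x = secondDeriv (n := n) Ψ x) : meanCurv Φ x = meanCurv Ψ x := by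
  simp only [meanCurv, secondForm, normalPart, gram_congr h1, h0, h1, h2]

lemma IsMarginallyTrappedOn.congr (hU : IsOpen U) (h : IsMarginallyTrappedOn Φ U)
    (heq : ∀ x ∈ U, Ψ x = Φ x) : IsMarginallyTrappedOn Ψ U := by
  have hev : ∀ x ∈ U, Ψ =ᶠ[𝓝 x] Φ := fun x hx => by
    filter_upwards [hU.mem_nhds hx] with y hy using heq y hy
  refine ⟨⟨fun x hx => ?_, h.contMDiffOn.congr heq, fun x hx => ?_⟩, fun x hx => ?_⟩
  · rw [heq x hx]; exact h.mapsTo x hx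
  · rw [gram_congr (differential_congr (hev x hx))]; exact h.nondeg x hx
  · rw [meanCurv_congr (by rw [heq x hx]) (differential_congr (hev x hx))
      (secondDeriv_congr (hev x hx))]
    exact h.null x hx

lemma IsSpacelikeOn.congr (hU : IsOpen U) (h : IsSpacelikeOn Φ U)
    (heq : ∀ x ∈ U, Ψ x = Φ x) : IsSpacelikeOn Ψ U := by
  intro x hx v hv
  have hev : Ψ =ᶠ[𝓝 x] Φ := by
    filter_upwards [hU.mem_nhds hx] with y hy using heq y hy
  rw [differential_congr hev]
  exact h x hx v hv

end Congr

/-! ### Root functions give marginally trapped immersions. -/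

section FlatTrap

variable {n : ℕ} {φ ν : EuclideanSpace ℝ (Fin n) → Mink n} {V : Set (EuclideanSpace ℝ (Fin n))}
  {s : EuclideanSpace ℝ (Fin n) → ℝ} {p : EuclideanSpace ℝ (Fin n)}

lemma IsHypersurfaceOn.isRotationOn_trapMap (h : IsHypersurfaceOn φ ν V) (hV : IsOpen V)
    (hs : ∀ y ∈ V, ContDiffAt ℝ 2 s y) (hs1 : ∀ y ∈ V, 1 < |s y|) :
    IsRotationOn φ ν (fun y => arcoth (s y)) 0 (trapMap φ ν s) V := by
  have heq : ∀ y ∈ V, trapMap φ ν s y = (Real.cosh (arcoth (s y)) • φ y +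
      Real.sinh (arcoth (s y)) • ν y, arcoth (s y)) := fun y hy => trapMap_eq φ ν (hs1 y hy)
  refine ⟨hV, h, fun y hy => ?_, fun y hy => by rw [heq y hy, add_zero]⟩
  have h1 : ContDiffAt ℝ 2 (fun y => arcoth (s y)) y :=
    (contDiffAt_arcoth (hs1 y hy)).comp y (hs y hy)
  have h2 := (contDiffAt_of_contMDiffOn hV h.contMDiffOn hy).of_le (m := 2) (by norm_num)
  have h3 := (contDiffAt_of_contMDiffOn hV h.gauss_contMDiffOn hy).of_le (m := 2) (by norm_num)
  have h4 : ContDiffAt ℝ 2 (fun y => (Real.cosh (arcoth (s y)) • φ y +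
      Real.sinh (arcoth (s y)) • ν y, arcoth (s y))) y :=
    ((h1.cosh.smul h2).add (h1.sinh.smul h3)).prodMk h1
  refine h4.congr_of_eventuallyEq ?_
  filter_upwards [hV.mem_nhds hy] with z hz using heq z hz

/-- The root is not a principal curvature, so the rotated metric is positive definite. The root
equation makes H orthogonal to the null normal (η, 1), and such a normal vector is null. -/
lemma IsHypersurfaceOn.trapMap_flat (h : IsHypersurfaceOn φ ν V) (hV : IsOpen V)
    (hs : ∀ y ∈ V, ContDiffAt ℝ 2 s y) (hroot : IsRootOn φ ν s V) (hp : p ∈ V) :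
    IsNondegAt (trapMap φ ν s) p ∧ ContDiffAt ℝ 2 (trapMap φ ν s) p ∧
      amb (meanCurv (trapMap φ ν s) p) (meanCurv (trapMap φ ν s) p) = 0 ∧
      ∀ v : EuclideanSpace ℝ (Fin n), v ≠ 0 → 0 < amb (differential (n := n) (trapMap φ ν s) p v)
        (differential (n := n) (trapMap φ ν s) p v) := by
  have hrot := h.isRotationOn_trapMap hV hs fun y hy => (hroot y hy).2
  obtain ⟨hr, h1⟩ := hroot p hp
  have hsinh := sinh_arcoth_ne_zero h1
  have hq := cosh_div_sinh_arcoth h1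
  have hnr := (h.isHypersurfaceAt_flat hV hp).not_isRoot_charpoly hr h1
  rw [differential_eq_fderiv, differential_eq_fderiv, ← hq] at hnr
  have hpos : ∀ v : EuclideanSpace ℝ (Fin n), v ≠ 0 →
      0 < amb (differential (n := n) (trapMap φ ν s) p v)
        (differential (n := n) (trapMap φ ν s) p v) := by
    intro v hv
    rw [differential_eq_fderiv]
    exact hrot.amb_fderiv_pos hp hsinh hnr hv
  have hdet : (gram amb (trapMap φ ν s) p : Matrix (Fin n) (Fin n) ℝ).det ≠ 0 := by
    rw [gram_eq_gramOf, ← gramOf_ambL]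
    exact gramOf_det_ne_zero fun v hv => by rw [ambL_apply]; exact (hpos v hv).ne'
  have hnd := hrot.isNondegAt hp hdet
  refine ⟨hnd, hrot.contDiffAt p hp, ?_, hpos⟩
  refine hrot.amb_self_eq_zero hp hsinh hnr hnd.isNormalAt_meanCurv ?_
  rw [hrot.amb_meanCurv_eq_zero_iff hp hsinh hnr, hq]
  exact hr

end FlatTrap

section Trap

variable {n : ℕ} {M : Type*} [TopologicalSpace M] [ChartedSpace (EuclideanSpace ℝ (Fin n)) M]
  [IsManifold (𝓡 n) ∞ M] {φ ν : M → Mink n} {U : Set M} {s : M → ℝ}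

theorem IsHypersurfaceOn.isMarginallyTrappedOn_trapMap (h : IsHypersurfaceOn φ ν U)
    (hU : IsOpen U) (hs : ContMDiffOn (𝓡 n) 𝓘(ℝ, ℝ) 2 s U) (hroot : IsRootOn φ ν s U) :
    IsMarginallyTrappedOn (trapMap φ ν s) U ∧ IsSpacelikeOn (trapMap φ ν s) U := by
  have key : ∀ x ∈ U, IsNondegAt (trapMap φ ν s) x ∧
      ContMDiffAt (𝓡 n) 𝓘(ℝ, Amb n) 2 (trapMap φ ν s) x ∧
      amb (meanCurv (trapMap φ ν s) x) (meanCurv (trapMap φ ν s) x) = 0 ∧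
      ∀ v : EuclideanSpace ℝ (Fin n), v ≠ 0 → 0 < amb (differential (n := n) (trapMap φ ν s) x v)
        (differential (n := n) (trapMap φ ν s) x v) := by
    intro x hx
    have hxs := mem_extChartAt_source (I := 𝓡 n) x
    have hV := isOpen_chartDomain (n := n) x hU
    have hp := mem_chartDomain (n := n) hx hxs
    have hs' : ContMDiffOn (𝓡 n) 𝓘(ℝ, ℝ) 2 (TrappedHyp.inChart (n := n) x s)
      (chartDomain (n := n) x U) := contDiffOn_inChart ENat.LEInfty.out hU hs x
    have hroot' : IsRootOn (TrappedHyp.inChart (n := n) x φ) (TrappedHyp.inChart (n := n) x ν)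
        (TrappedHyp.inChart (n := n) x s) (chartDomain (n := n) x U) := by
      intro q hq
      obtain ⟨y, hyU, hy, rfl⟩ := exists_of_mem_chartDomain hq
      rw [← (h.transfer hU hyU hy).2.1, inChart_apply _ hy]
      exact hroot y hyU
    have hflat := (h.inChart hU x).trapMap_flat hV
      (fun y hy => contDiffAt_of_contMDiffOn hV hs' hy) hroot' hp
    -- `trapMap` is built pointwise, so it commutes definitionally with passing to the chart.
    change IsNondegAt (TrappedHyp.inChart (n := n) x (trapMap φ ν s)) _ ∧
      ContDiffAt ℝ 2 (TrappedHyp.inChart (n := n) x (trapMap φ ν s)) _ ∧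
      amb (meanCurv (TrappedHyp.inChart (n := n) x (trapMap φ ν s)) _)
        (meanCurv (TrappedHyp.inChart (n := n) x (trapMap φ ν s)) _) = 0 ∧
      ∀ v : EuclideanSpace ℝ (Fin n), v ≠ 0 → 0 <
        amb (differential (n := n) (TrappedHyp.inChart (n := n) x (trapMap φ ν s)) _ v)
        (differential (n := n) (TrappedHyp.inChart (n := n) x (trapMap φ ν s)) _ v) at hflat
    obtain ⟨f1, f2, f3, f4⟩ := hflat
    have g2 := (contDiffAt_inChart_iff ENat.LEInfty.out hxs).mp f2
    have g21 := g2.of_le (m := 1) (by norm_num)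
    have g1 := (isNondegAt_inChart_iff g21 hxs).mp f1
    refine ⟨g1, g2, ?_, fun v hv => ?_⟩
    · rwa [meanCurv_eq g1 g2 hxs]
    · rw [differential_eq g21 hxs]
      refine f4 _ fun h0 => hv ?_
      exact injective_of_isInvertible (chartDeriv_isInvertible hxs) (h0.trans (map_zero _).symm)
  refine ⟨⟨⟨fun x hx => ?_, fun x hx => (key x hx).2.1.contMDiffWithinAt,
    fun x hx => (key x hx).1.det⟩, fun x hx => (key x hx).2.2.1⟩, fun x hx => (key x hx).2.2.2⟩
  have hf := h.isHypersurfaceAt hU hx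
  -- The first component lies on the upper sheet because its product with φ is -cosh t < 0.
  refine mem_hyperbolicSpace_of_lor_neg (h.mapsTo x hx) (key x hx).1.unit ?_
  rw [trapMap_eq φ ν (hroot x hx).2]
  simp only [lor_add_left, lor_smul_left, hf.base, hf.normal]
  have := Real.cosh_pos (arcoth (s x))
  linarith

end Trap

/-! ### The explicit formula for surfaces. -/

section Surfaces

/-- For s = a + √(a² - 1) one has s² - 1 = 2 (a² - 1 + a √(a² - 1)) and a = (s² + 1) / (2 s), which
is coth 2t when s = coth t. -/
lemma surfaceTrapMap_eq {M : Type*} (φ ν : M → Mink 2) {a : M → ℝ} {x : M} (ha : 1 < a x) :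
    surfaceTrapMap φ ν a x = trapMap φ ν (fun y => a y + √(a y ^ 2 - 1)) x := by
  set r := √(a x ^ 2 - 1) with hr
  have hr2 : r ^ 2 = a x ^ 2 - 1 := Real.sq_sqrt (by nlinarith)
  have hr0 : 0 ≤ r := Real.sqrt_nonneg _
  have hs : 1 < a x + r := by linarith
  have habs : 1 < |a x + r| := by rwa [abs_of_pos (by linarith)]
  have hsgn : Real.sign (a x + r) = 1 := Real.sign_of_pos (by linarith)
  have h1 : (a x + r) ^ 2 - 1 = 2 * (a x ^ 2 - 1 + a x * r) := by
    nlinarith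
  have h2 : arcoth (a x) = 2 * arcoth (a x + r) := by
    set t := arcoth (a x + r) with ht
    have hsh : Real.sinh t ≠ 0 := sinh_arcoth_ne_zero habs
    have hq : Real.cosh t / Real.sinh t = a x + r := cosh_div_sinh_arcoth habs
    have hc : Real.cosh t = (a x + r) * Real.sinh t := by rw [← hq]; field_simp
    have h3 : a x = Real.cosh (2 * t) / Real.sinh (2 * t) := by
      rw [Real.cosh_two_mul, Real.sinh_two_mul, hc]
      field_simp
      nlinarith
    conv_lhs => rw [h3]
    exact arcoth_cosh_div_sinh _
  simp only [surfaceTrapMap, trapMap]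
  rw [← hr, hsgn, h1, Real.sqrt_mul (by norm_num), h2, one_div]
  rw [← mul_assoc]
  norm_num

variable {M : Type*} [TopologicalSpace M] [ChartedSpace (EuclideanSpace ℝ (Fin 2)) M]
  {φ ν : M → Mink 2} {U : Set M} {κ₁ κ₂ a : M → ℝ}

variable [IsManifold (𝓡 2) ∞ M]

/-- The larger root of s² - 2 a s + 1 exceeds 1 and is a root of P. At an umbilic point with κ > 1
this larger root would be κ itself, a focal value; the condition κ₁ < 1 selects 1/κ instead. -/
theorem IsHypersurfaceOn.isMarginallyTrappedOn_surfaceTrapMap (h : IsHypersurfaceOn φ ν U)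
    (hU : IsOpen U)
    (hκ : ∀ x ∈ U, (shapeOperator φ ν x).charpoly =
        (Polynomial.X - Polynomial.C (κ₁ x)) * (Polynomial.X - Polynomial.C (κ₂ x)))
    (hsum : ∀ x ∈ U, κ₁ x + κ₂ x ≠ 0)
    (ha : ∀ x ∈ U, a x = (κ₁ x * κ₂ x + 1) / (κ₁ x + κ₂ x)) (ha1 : ∀ x ∈ U, 1 < a x)
    (humb : ∀ x ∈ U, κ₁ x = κ₂ x → κ₁ x < 1) :
    IsMarginallyTrappedOn (surfaceTrapMap φ ν a) U ∧ IsSpacelikeOn (surfaceTrapMap φ ν a) U := by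
  set s : M → ℝ := fun y => a y + √(a y ^ 2 - 1) with hs
  have hasmooth : ContMDiffOn (𝓡 2) 𝓘(ℝ, ℝ) 2 a U := by
    intro x hx
    have hxs := mem_extChartAt_source (I := 𝓡 2) x
    have hV := isOpen_chartDomain (n := 2) x hU
    have hp := mem_chartDomain (n := 2) hx hxs
    refine ContMDiffAt.contMDiffWithinAt ?_
    rw [← contDiffAt_inChart_iff (x := x) ENat.LEInfty.out hxs]
    set A : EuclideanSpace ℝ (Fin 2) → Matrix (Fin 2) (Fin 2) ℝ := fun y =>
      shapeMat (differential (n := 2) (TrappedHyp.inChart (n := 2) x φ) y)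
        (differential (n := 2) (TrappedHyp.inChart (n := 2) x ν) y)
    have hA : ∀ i j, ContDiffAt ℝ 2 (fun y => A y i j) (extChartAt (𝓡 2) x x) := fun i j =>
      (h.inChart hU x).contDiffAt_shapeMat hV hp i j
    have hchar : ∀ y ∈ U, y ∈ (extChartAt (𝓡 2) x).source →
        (A (extChartAt (𝓡 2) x y)).det = κ₁ y * κ₂ y ∧
        (A (extChartAt (𝓡 2) x y)).trace = κ₁ y + κ₂ y := by
      intro y hyU hy
      have h1 := hκ y hyU
      rw [(h.transfer hU hyU hy).2.2, shapeOperator_charpoly, Matrix.charpoly_fin_two] at h1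
      -- Evaluation at 0 and 1 recovers the determinant and the trace.
      have h2 := congrArg (Polynomial.eval 0) h1
      have h3 := congrArg (Polynomial.eval 1) h1
      simp only [Polynomial.eval_add, Polynomial.eval_sub, Polynomial.eval_mul, Polynomial.eval_C,
        Polynomial.eval_X, Polynomial.eval_pow] at h2 h3
      constructor
      · linarith
      · linarith
    -- κ₁ and κ₂ need not be continuous, but a is the rational function (det A + 1) / tr A of the C²
    -- matrix A.
    have hd : ContDiffAt ℝ 2 (fun y => ((A y).det + 1) / (A y).trace) (extChartAt (𝓡 2) x x) := by
      refine ((contDiffAt_det hA).add contDiffAt_const).div ?_ ?_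
      · exact ContDiffAt.sum fun i _ => hA i i
      · rw [(hchar x hx hxs).2]; exact hsum x hx
    refine hd.congr_of_eventuallyEq ?_
    filter_upwards [hV.mem_nhds hp] with q hq
    obtain ⟨y, hyU, hy, rfl⟩ := exists_of_mem_chartDomain hq
    rw [inChart_apply _ hy, (hchar y hyU hy).1, (hchar y hyU hy).2, ha y hyU]
  have hssmooth : ContMDiffOn (𝓡 2) 𝓘(ℝ, ℝ) 2 s U := by
    intro x hx
    have h1 : ContDiffAt ℝ 2 (fun t : ℝ => t + √(t ^ 2 - 1)) (a x) := by
      refine contDiffAt_id.add (ContDiffAt.sqrt ((contDiffAt_id.pow 2).sub contDiffAt_const) ?_)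
      have h2 : 0 < a x ^ 2 - 1 := by nlinarith [ha1 x hx]
      exact h2.ne'
    exact (h1.contMDiffAt.comp x (hasmooth.contMDiffAt (hU.mem_nhds hx))).contMDiffWithinAt
  have hroot : IsRootOn φ ν s U := by
    intro x hx
    have h1 := ha1 x hx
    have hr2 : √(a x ^ 2 - 1) ^ 2 = a x ^ 2 - 1 := Real.sq_sqrt (by nlinarith)
    have hr0 : 0 ≤ √(a x ^ 2 - 1) := Real.sqrt_nonneg _
    have hs1 : 1 < s x := by simp only [hs]; linarith
    have hquad : s x ^ 2 - 2 * a x * s x + 1 = 0 := by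
      simp only [hs]; nlinarith
    refine ⟨?_, by rwa [abs_of_pos (by linarith)]⟩
    have ha' : a x * (κ₁ x + κ₂ x) = κ₁ x * κ₂ x + 1 := by
      rw [ha x hx, div_mul_cancel₀ _ (hsum x hx)]
    have hq2 : (κ₁ x * s x - 1) * (s x - κ₂ x) + (κ₂ x * s x - 1) * (s x - κ₁ x) = 0 := by
      linear_combination (κ₁ x + κ₂ x) * hquad + 2 * s x * ha'
    have hsq : s x * s x - 1 ≠ 0 := by nlinarith
    -- If s = κ₁, the quadratic reduces to (s² - 1)(s - κ₂) = 0, so the point is umbilic with κ₁ = s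
    -- > 1, which is excluded.
    have hne1 : s x ≠ κ₁ x := by
      intro h0
      rw [← h0] at hq2
      have h3 : (s x * s x - 1) * (s x - κ₂ x) = 0 := by linarith
      have h4 := (mul_eq_zero.mp h3).resolve_left hsq
      have := humb x hx (by linarith)
      linarith
    have hne2 : s x ≠ κ₂ x := by
      intro h0
      rw [← h0] at hq2
      have h3 : (s x * s x - 1) * (s x - κ₁ x) = 0 := by linarith
      have h4 := (mul_eq_zero.mp h3).resolve_left hsq
      have := humb x hx (by linarith)
      linarith
    have hprod : (Polynomial.X - Polynomial.C (κ₁ x)) * (Polynomial.X - Polynomial.C (κ₂ x)) =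
        ∏ i, (Polynomial.X - Polynomial.C (![κ₁ x, κ₂ x] i)) := by
      simp [Fin.prod_univ_two]
    rw [(h.isHypersurfaceAt hU hx).trapPoly_eq, ← shapeOperator_charpoly, hκ x hx, hprod,
      Polynomial.IsRoot, eval_rootPoly_prod]
    · rw [Fin.sum_univ_two]
      change _ * ((κ₁ x * s x - 1) / (s x - κ₁ x) + (κ₂ x * s x - 1) / (s x - κ₂ x)) = 0
      rw [div_add_div _ _ (sub_ne_zero.mpr hne1) (sub_ne_zero.mpr hne2),
        mul_comm (s x - κ₁ x) (κ₂ x * s x - 1), hq2, zero_div, mul_zero]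
    · intro i
      fin_cases i
      exacts [hne1, hne2]
  obtain ⟨t1, t2⟩ := h.isMarginallyTrappedOn_trapMap hU hssmooth hroot
  exact ⟨t1.congr hU fun x hx => surfaceTrapMap_eq φ ν (ha1 x hx),
    t2.congr hU fun x hx => surfaceTrapMap_eq φ ν (ha1 x hx)⟩

end Surfaces

/-! ### The frame adapted to a null normal. -/

section NullFrame

variable {n : ℕ} {M : Type*} [TopologicalSpace M] [ChartedSpace (EuclideanSpace ℝ (Fin n)) M]
  {Φ : M → Amb n} {x : M} {q : Mink n}

/-- The component of the horizontal part of the differential orthogonal to `q`. -/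
def screenPart (Φ : M → Amb n) (x : M) (q : Mink n) : EuclideanSpace ℝ (Fin n) →L[ℝ] Mink n :=
  (ContinuousLinearMap.fst ℝ (Mink n) ℝ).comp (differential Φ x) -
    ((ContinuousLinearMap.snd ℝ (Mink n) ℝ).comp (differential Φ x)).smulRight q

lemma screenPart_apply (v : EuclideanSpace ℝ (Fin n)) : screenPart Φ x q v =
    (differential (n := n) Φ x v).1 - (differential (n := n) Φ x v).2 • q := by
  simp [screenPart]

lemma lor_fst_eq_snd (hN : IsNormalAt Φ x (q, 1)) (v : EuclideanSpace ℝ (Fin n)) :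
    lor (differential (n := n) Φ x v).1 q = (differential (n := n) Φ x v).2 := by
  have := hN.2 v
  simp only [amb] at this
  rw [lor_comm]
  linarith

/-- On a kernel vector v, dΦ v is a multiple of the normal (q, 1), hence orthogonal to all tangent
vectors; non-degeneracy gives v = 0. -/
lemma IsNondegAt.screenPart_injective (h : IsNondegAt Φ x) (hN : IsNormalAt Φ x (q, 1))
    {v : EuclideanSpace ℝ (Fin n)} (hv : screenPart Φ x q v = 0) : v = 0 := by
  apply h.eq_zero
  intro w
  have h1 : differential (n := n) Φ x v =
      (differential (n := n) Φ x v).2 • ((q, 1) : Amb n) := by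
    rw [screenPart_apply, sub_eq_zero] at hv
    exact Prod.ext hv (by simp)
  rw [h1, amb_comm, amb_smul_left, hN.2, mul_zero]

lemma IsNondegAt.screenPart_orthogonal (h : IsNondegAt Φ x) (hq : lor q q = 1)
    (hN : IsNormalAt Φ x (q, 1)) (v : EuclideanSpace ℝ (Fin n)) :
    lor (screenPart Φ x q v) (Φ x).1 = 0 ∧ lor (screenPart Φ x q v) q = 0 := by
  rw [screenPart_apply]
  constructor
  · have := hN.1
    simp only at this
    rw [lor_sub_left, lor_smul_left, h.tangent, this]; ring
  · rw [lor_sub_left, lor_smul_left, lor_fst_eq_snd hN, hq]; ring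

lemma IsNondegAt.eq_zero_of_orthogonal (h : IsNondegAt Φ x) (hq : lor q q = 1)
    (hN : IsNormalAt Φ x (q, 1)) {u : Mink n} (hu : lor u (Φ x).1 = 0) (huq : lor u q = 0)
    (huX : ∀ v : EuclideanSpace ℝ (Fin n), lor u (differential (n := n) Φ x v).1 = 0) : u = 0 := by
  refine eq_zero_of_orthogonal_frame (X := screenPart Φ x q) h.unit hq hN.1
    (fun v => h.screenPart_injective hN) (fun v => (h.screenPart_orthogonal hq hN v).1)
    (fun v => (h.screenPart_orthogonal hq hN v).2) hu huq fun v => ?_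
  rw [screenPart_apply, lor_sub_right, lor_smul_right, huX, huq]
  ring

/-- The normal plane of a spacelike immersion contains a null line. -/
lemma IsNondegAt.exists_null_normal_of_spacelike (h : IsNondegAt Φ x)
    (hs : ∀ v : EuclideanSpace ℝ (Fin n), v ≠ 0 →
      0 < amb (differential (n := n) Φ x v) (differential (n := n) Φ x v)) :
    ∃ q : Mink n, lor q q = 1 ∧ IsNormalAt Φ x (q, 1) := by
  let L : Mink n →ₗ[ℝ] ℝ × (Fin n → ℝ) :=
    ((lorL n).flip (Φ x).1 : Mink n →ₗ[ℝ] ℝ).prod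
      (LinearMap.pi fun i => ((lorL n).flip (differential (n := n) Φ x (coordVec i)).1 :
        Mink n →ₗ[ℝ] ℝ))
  -- There are n + 1 linear conditions in dimension n + 2, so a nonzero horizontal normal exists.
  have hker : L.ker ≠ ⊥ := LinearMap.ker_ne_bot_of_finrank_lt (by simp; omega)
  obtain ⟨z, hz, hz0⟩ := Submodule.exists_mem_ne_zero_of_ne_bot hker
  have hz1 : lor z (Φ x).1 = 0 := by
    have := congrArg Prod.fst hz
    simpa [L, lorL_apply] using this
  have hz2 : ∀ v : EuclideanSpace ℝ (Fin n), lor z (differential (n := n) Φ x v).1 = 0 := by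
    intro v
    have h1 : ∀ i, lor z (differential (n := n) Φ x (coordVec i)).1 = 0 := fun i => by
      have := congrFun (congrArg Prod.snd hz) i
      simpa [L, lorL_apply] using this
    have := eq_zero_of_forall_coordVec (D := differential (n := n) Φ x)
      (L := (lorL n z).comp (ContinuousLinearMap.fst ℝ (Mink n) ℝ))
      (by simpa [lorL_apply] using h1) v
    simpa [lorL_apply] using this
  have hzpos := lor_self_pos h.unit hz1 hz0
  set u : Amb n := ((√(lor z z))⁻¹ • z, 0) with hu
  have hun : IsNormalAt Φ x u := by
    refine ⟨?_, fun v => ?_⟩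
    · simp [hu, lor_smul_left, hz1]
    · simp [hu, amb, lor_smul_left, hz2]
  have huu : amb u u = 1 := by
    have h1 := Real.mul_self_sqrt hzpos.le
    have h2 := (Real.sqrt_pos.mpr hzpos).ne'
    simp only [hu, amb, lor_smul_left, lor_smul_right]
    field_simp
    nlinarith
  -- The normal part of the vertical vector: since -1 = ⟨t, t⟩ plus a nonnegative tangential square,
  -- t is timelike.
  set t := normalPart Φ x ((0 : Mink n), (1 : ℝ)) with ht
  have htn : IsNormalAt Φ x t := h.isNormalAt_normalPart _
  have htu : amb t u = 0 := by
    rw [ht, amb_normalPart hun]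
    simp [amb, hu, lor_zero_left]
  have htt : amb t t < 0 := by
    have h1 := normalPart_eq Φ x ((0 : Mink n), (1 : ℝ))
    rw [← ht] at h1
    simp only [lor_zero_left, zero_smul, add_zero] at h1
    set v := tangentCoord Φ x ((0 : Mink n), (1 : ℝ))
    have h2 : ((0 : Mink n), (1 : ℝ)) = t + differential (n := n) Φ x v := by rw [h1]; abel
    have h3 : amb ((0 : Mink n), (1 : ℝ)) ((0 : Mink n), (1 : ℝ)) = -1 := by
      simp [amb, lor_zero_left]
    rw [h2, amb_add_left, amb_add_right, amb_add_right, htn.2,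
      amb_comm (differential (n := n) Φ x v) t, htn.2] at h3
    have h4 : 0 ≤ amb (differential (n := n) Φ x v) (differential (n := n) Φ x v) := by
      by_cases hv : v = 0
      · rw [hv, map_zero, amb_zero_left]
      · exact (hs v hv).le
    linarith
  -- The sum of orthogonal unit vectors, one spacelike and one timelike, is null.
  set w := u + (√(-amb t t))⁻¹ • t with hw
  have hwn : IsNormalAt Φ x w := hun.add (htn.smul _)
  have hww : amb w w = 0 := by
    have h1 := Real.mul_self_sqrt (by linarith : 0 ≤ -amb t t)
    have h2 := (Real.sqrt_pos.mpr (by linarith : 0 < -amb t t)).ne'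
    simp only [hw, amb_add_left, amb_add_right, amb_smul_left, amb_smul_right, huu, htu,
      amb_comm u t]
    field_simp
    nlinarith
  have hw0 : w ≠ 0 := by
    intro h0
    have h1 : amb w u = 1 := by
      rw [hw, amb_add_left, amb_smul_left, huu, htu]; ring
    rw [h0, amb_zero_left] at h1
    norm_num at h1
  obtain ⟨q, hq1, hq2, -⟩ := h.exists_null_normal hwn hww hw0
  exact ⟨q, hq1, hq2⟩

/-- If one value of a null second fundamental form is a nonzero multiple of a null normal, then
all values are orthogonal to this null normal. -/
lemma IsNondegAt.amb_secondForm_eq_zero (h : IsNondegAt Φ x) (hq : lor q q = 1)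
    (hN : IsNormalAt Φ x (q, 1))
    (hnull : ∀ v w, amb (secondForm Φ x v w) (secondForm Φ x v w) = 0)
    {v₀ w₀ : EuclideanSpace ℝ (Fin n)} {c : ℝ} (hc : c ≠ 0)
    (h0 : secondForm Φ x v₀ w₀ = c • ((q, 1) : Amb n)) (v w : EuclideanSpace ℝ (Fin n)) :
    amb (secondForm Φ x v w) (q, 1) = 0 := by
  have hadd_left : ∀ v v' w, secondForm Φ x (v + v') w =
      secondForm Φ x v w + secondForm Φ x v' w := fun v v' w => by
    simp only [← secondFormL_apply, map_add, LinearMap.add_apply]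
  have hadd_right : ∀ v w w', secondForm Φ x v (w + w') =
      secondForm Φ x v w + secondForm Φ x v w' := fun v w w' => by
    simp only [← secondFormL_apply, map_add]
  -- Polarization in one argument: values of h that share an argument are mutually orthogonal.
  have hpol : ∀ a b : Amb n, amb a a = 0 → amb b b = 0 → amb (a + b) (a + b) = 0 →
      amb a b = 0 := by
    intro a b ha hb hab
    rw [amb_add_left, amb_add_right, amb_add_right, ha, hb, amb_comm b a] at hab
    linarith
  have hleft : ∀ v v' w, amb (secondForm Φ x v w) (secondForm Φ x v' w) = 0 := fun v v' w =>
    hpol _ _ (hnull _ _) (hnull _ _) (by rw [← hadd_left]; exact hnull _ _)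
  have hright : ∀ v w w', amb (secondForm Φ x v w) (secondForm Φ x v w') = 0 := fun v w w' =>
    hpol _ _ (hnull _ _) (hnull _ _) (by rw [← hadd_right]; exact hnull _ _)
  have hperp : ∀ a, amb (secondForm Φ x v₀ w₀) a = 0 → amb a (q, 1) = 0 := by
    intro a ha
    rw [h0, amb_smul_left, amb_comm] at ha
    exact (mul_eq_zero.mp ha).resolve_left hc
  have h1 := hperp _ (hright v₀ w₀ w)
  have h2 := hperp _ (hleft v₀ v w₀)
  have h3 : secondForm Φ x v₀ w = (secondForm Φ x v₀ w).2 • ((q, 1) : Amb n) :=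
    eq_smul_of_null_of_amb_eq_zero h.unit hq hN.1 (h.isNormalAt_normalPart _).1 (hnull v₀ w) h1
  apply hperp
  -- h(v₀, w) is a multiple of (q, 1), and h(v, w₀) is orthogonal to it. Expanding the square of
  -- h(v₀ + v, w₀ + w) then leaves only 2 ⟨h(v₀, w₀), h(v, w)⟩.
  have h4 : amb (secondForm Φ x v₀ w) (secondForm Φ x v w₀) = 0 := by
    rw [h3, amb_smul_left, amb_comm, h2, mul_zero]
  have h5 := hnull (v₀ + v) (w₀ + w)
  rw [hadd_left, hadd_right, hadd_right] at h5
  simp only [amb_add_left, amb_add_right, hnull, hleft, hright, h4,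
    amb_comm (secondForm Φ x v w₀) (secondForm Φ x v₀ w),
    amb_comm (secondForm Φ x v w) (secondForm Φ x v₀ w₀)] at h5
  linarith

end NullFrame

/-! ### Continuity of the second fundamental form and of the mean curvature. -/

section Continuity

variable {n : ℕ} {Φ : EuclideanSpace ℝ (Fin n) → Amb n} {p : EuclideanSpace ℝ (Fin n)}

lemma continuousAt_secondForm (hΦ : ContDiffAt ℝ 2 Φ p)
    (hdet : (gram amb Φ p : Matrix (Fin n) (Fin n) ℝ).det ≠ 0) (v w : EuclideanSpace ℝ (Fin n)) :
    ContDiffAt ℝ 0 (fun y => secondForm Φ y v w) p ∧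
      ∀ i j, ContDiffAt ℝ 0 (fun y => (gram (n := n) amb Φ y)⁻¹ i j) p := by
  have h0 : ContDiffAt ℝ 0 Φ p := hΦ.of_le (by norm_num)
  have h1 : ∀ u, ContDiffAt ℝ 0 (fun y => differential (n := n) Φ y u) p := fun u => by
    simp only [differential_eq_fderiv]
    exact (hΦ.fderiv_right (m := 0) (by norm_num)).clm_apply contDiffAt_const
  have h2 : ContDiffAt ℝ 0 (fun y => secondDeriv Φ y v w) p := by
    simp only [secondDeriv_eq_fderiv]
    have := (hΦ.fderiv_right (m := 1) (by norm_num)).fderiv_right (m := 0) (by norm_num)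
    exact (this.clm_apply contDiffAt_const).clm_apply contDiffAt_const
  have h3 : ∀ i j, ContDiffAt ℝ 0 (fun y => (gram (n := n) amb Φ y)⁻¹ i j) p := fun i j =>
    TrappedHyp.contDiffAt_inv (A := fun y => gram (n := n) amb Φ y)
      (fun a b => ContDiffAt.amb (h1 _) (h1 _)) hdet i j
  refine ⟨?_, h3⟩
  simp only [secondForm, normalPart]
  refine (h2.add ((ContDiffAt.lor h2.fst h0.fst).smul (h0.fst.prodMk contDiffAt_const))).sub ?_
  exact ContDiffAt.sum fun i _ => ContDiffAt.sum fun j _ =>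
    ((h3 i j).mul (ContDiffAt.amb h2 (h1 _))).smul (h1 _)

lemma continuousAt_meanCurv (hΦ : ContDiffAt ℝ 2 Φ p)
    (hdet : (gram amb Φ p : Matrix (Fin n) (Fin n) ℝ).det ≠ 0) :
    ContinuousAt (fun y => meanCurv Φ y) p := by
  have : ContDiffAt ℝ 0 (fun y => meanCurv Φ y) p := by
    simp only [meanCurv]
    exact ContDiffAt.sum fun i _ => ContDiffAt.sum fun j _ =>
      -- The arguments 0 0 are arbitrary; the second component concerns only the inverse Gram
      -- matrix.
      ((continuousAt_secondForm hΦ hdet 0 0).2 i j).smul (continuousAt_secondForm hΦ hdet _ _).1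
  exact this.continuousAt

end Continuity

/-! ### Regular null normal fields. -/

section NullField

variable {n : ℕ} {Φ : EuclideanSpace ℝ (Fin n) → Amb n} {p : EuclideanSpace ℝ (Fin n)} {q : Mink n}

/-- The equations that characterise the horizontal part of a normalised null normal. -/
def nullNormalEq (Φ : EuclideanSpace ℝ (Fin n) → Amb n)
    (u : EuclideanSpace ℝ (Fin n) × Mink n) : (ℝ × ℝ) × (Fin n → ℝ) :=
  ((lor u.2 (Φ u.1).1, lor u.2 u.2 - 1), fun i => amb (u.2, 1) (fderiv ℝ Φ u.1 (coordVec i)))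

lemma nullNormalEq_eq_zero_iff {u : EuclideanSpace ℝ (Fin n) × Mink n} :
    nullNormalEq Φ u = 0 ↔ lor u.2 u.2 = 1 ∧ IsNormalAt Φ u.1 (u.2, 1) := by
  constructor
  · intro h
    have h1 := congrArg (fun z => z.1.1) h
    have h2 := congrArg (fun z => z.1.2) h
    have h3 := congrArg (fun z => z.2) h
    simp only [nullNormalEq, Prod.fst_zero, Prod.snd_zero] at h1 h2 h3
    refine ⟨by linarith, h1, fun v => ?_⟩
    rw [differential_eq_fderiv, ← ambL_apply]
    exact eq_zero_of_forall_coordVec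
      (fun i => by rw [ambL_apply]; exact congrFun h3 i) v
  · rintro ⟨h1, h2, h3⟩
    refine Prod.ext (Prod.ext h2 (by simp [nullNormalEq, h1])) ?_
    funext i
    have := h3 (coordVec i)
    rwa [differential_eq_fderiv] at this

/-- Local existence, uniqueness and regularity of null normal fields. -/
lemma IsNondegAt.exists_null_normal_field (h : IsNondegAt Φ p) {k : ℕ∞ω} (hk : k ≠ 0)
    (hΦ : ContDiffAt ℝ k Φ p) (hdΦ : ContDiffAt ℝ k (fderiv ℝ Φ) p) (hq : lor q q = 1)
    (hN : IsNormalAt Φ p (q, 1)) :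
    ∃ η : EuclideanSpace ℝ (Fin n) → Mink n, η p = q ∧ ContDiffAt ℝ k η p ∧
      (∀ᶠ y in 𝓝 p, lor (η y) (η y) = 1 ∧ IsNormalAt Φ y (η y, 1)) ∧
      ∀ᶠ u in 𝓝 (p, q), lor u.2 u.2 = 1 → IsNormalAt Φ u.1 (u.2, 1) → η u.1 = u.2 := by
  have hF : ContDiffAt ℝ k (nullNormalEq Φ) (p, q) := by
    have h1 : ContDiffAt ℝ k (fun u : EuclideanSpace ℝ (Fin n) × Mink n => Φ u.1) (p, q) :=
      hΦ.comp (p, q) contDiffAt_fst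
    have h2 : ContDiffAt ℝ k (fun u : EuclideanSpace ℝ (Fin n) × Mink n => fderiv ℝ Φ u.1) (p, q) :=
      ContDiffAt.comp (g := fderiv ℝ Φ) (f := Prod.fst) (p, q) hdΦ contDiffAt_fst
    have h3 : ContDiffAt ℝ k (fun u : EuclideanSpace ℝ (Fin n) × Mink n => u.2) (p, q) :=
      contDiffAt_snd
    refine ((ContDiffAt.lor h3 h1.fst).prodMk ((ContDiffAt.lor h3 h3).sub contDiffAt_const)).prodMk
      (contDiffAt_pi.mpr fun i => ?_)
    exact ContDiffAt.amb (h3.prodMk contDiffAt_const) (h2.clm_apply contDiffAt_const)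
  have hinj : ∀ w, fderiv ℝ (nullNormalEq Φ) (p, q) (0, w) = 0 → w = 0 := by
    intro w hw
    -- The partial derivative in the direction w is computed along the line q + t w. Its vanishing
    -- makes w orthogonal to ψ, q and dψ, hence zero.
    have hline : HasDerivAt (fun t : ℝ => (p, q + t • w)) (0, w) 0 := by
      refine (hasDerivAt_const _ _).prodMk ?_
      simpa using ((hasDerivAt_id (0 : ℝ)).smul_const w).const_add q
    have hF' : HasFDerivAt (nullNormalEq Φ) (fderiv ℝ (nullNormalEq Φ) (p, q))
        (p, q + (0 : ℝ) • w) := by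
      rw [zero_smul, add_zero]
      exact (hF.differentiableAt hk).hasFDerivAt
    have h1 := hF'.comp_hasDerivAt (0 : ℝ) hline
    rw [hw] at h1
    have hlin : ∀ b a : ℝ, HasDerivAt (fun t : ℝ => b + t * a) a 0 := fun b a => by
      simpa using ((hasDerivAt_id (0 : ℝ)).mul_const a).const_add b
    have hc1 := h1.fst.fst
    have hc2 := h1.fst.snd
    have hc3 := hasDerivAt_pi.mp h1.snd
    have e1 : lor w (Φ p).1 = 0 := by
      refine HasDerivAt.unique ?_ hc1
      refine (hlin (lor q (Φ p).1) (lor w (Φ p).1)).congr_of_eventuallyEq (.of_forall fun t => ?_)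
      simp [nullNormalEq, lor_add_left, lor_smul_left]
    have e2 : lor w q = 0 := by
      have hsq : HasDerivAt (fun t : ℝ => lor q q - 1 + t * (2 * lor w q + t * lor w w))
          (2 * lor w q) 0 := by
        have := ((hasDerivAt_id (0 : ℝ)).mul (hlin (2 * lor w q) (lor w w))).const_add (lor q q - 1)
        simpa using this
      have := HasDerivAt.unique (hsq.congr_of_eventuallyEq (.of_forall fun t => ?_)) hc2
      · simpa using this
      · simp only [nullNormalEq, Function.comp_apply, lor_add_left, lor_add_right, lor_smul_left,
          lor_smul_right, lor_comm q w]
        ring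
    have e3 : ∀ i, lor w (fderiv ℝ Φ p (coordVec i)).1 = 0 := by
      intro i
      refine HasDerivAt.unique ?_ (hc3 i)
      refine (hlin (amb (q, 1) (fderiv ℝ Φ p (coordVec i)))
        (lor w (fderiv ℝ Φ p (coordVec i)).1)).congr_of_eventuallyEq (.of_forall fun t => ?_)
      simp only [nullNormalEq, Function.comp_apply, amb, lor_add_left, lor_smul_left]
      ring
    refine h.eq_zero_of_orthogonal hq hN e1 e2 fun v => ?_
    have := eq_zero_of_forall_coordVec (D := fderiv ℝ Φ p)
      (L := (lorL n w).comp (ContinuousLinearMap.fst ℝ (Mink n) ℝ))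
      (by simpa [lorL_apply] using e3) v
    rw [differential_eq_fderiv]
    simpa [lorL_apply] using this
  obtain ⟨η, h1, h2, h3, h4⟩ := exists_implicit_function (u := (p, q)) (by simp; omega) hF hk
    (nullNormalEq_eq_zero_iff.mpr ⟨hq, hN⟩) hinj
  refine ⟨η, h1, h2, ?_, ?_⟩
  · filter_upwards [h3] with y hy
    exact nullNormalEq_eq_zero_iff.mp hy
  · filter_upwards [h4] with u hu a b
    exact hu (nullNormalEq_eq_zero_iff.mpr ⟨a, b⟩)

/-- A continuous nonzero null normal field is proportional to the regular one. -/
lemma IsNondegAt.exists_regular_null_normal_field {N : EuclideanSpace ℝ (Fin n) → Amb n}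
    (h : ∀ᶠ y in 𝓝 p, IsNondegAt Φ y) {k : ℕ∞ω} (hk : k ≠ 0)
    (hΦ : ContDiffAt ℝ k Φ p) (hdΦ : ContDiffAt ℝ k (fderiv ℝ Φ) p) (hNc : ContinuousAt N p)
    (hN : ∀ᶠ y in 𝓝 p, N y ≠ 0 ∧ amb (N y) (N y) = 0 ∧ IsNormalAt Φ y (N y)) :
    ∃ η : EuclideanSpace ℝ (Fin n) → Mink n, ContDiffAt ℝ k η p ∧
      (∀ᶠ y in 𝓝 p, lor (η y) (η y) = 1 ∧ IsNormalAt Φ y (η y, 1)) ∧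
      ∀ᶠ y in 𝓝 p, (N y).2 ≠ 0 ∧ N y = (N y).2 • ((η y, 1) : Amb n) := by
  have hloc : ∀ y, IsNondegAt Φ y → (N y ≠ 0 ∧ amb (N y) (N y) = 0 ∧ IsNormalAt Φ y (N y)) →
      (N y).2 ≠ 0 ∧ lor ((N y).2⁻¹ • (N y).1) ((N y).2⁻¹ • (N y).1) = 1 ∧
        IsNormalAt Φ y ((N y).2⁻¹ • (N y).1, 1) ∧
        N y = (N y).2 • (((N y).2⁻¹ • (N y).1, 1) : Amb n) := by
    rintro y hy ⟨h1, h2, h3⟩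
    have h4 := snd_ne_zero_of_null hy.unit h3.1 h2 h1
    obtain ⟨q, hq1, hq2, hq3⟩ := hy.exists_null_normal h3 h2 h1
    have h5 : (N y).2⁻¹ • (N y).1 = q := by
      have := congrArg Prod.fst hq3
      simp only [Prod.smul_fst] at this
      conv_lhs => rw [this]
      rw [smul_smul, inv_mul_cancel₀ h4, one_smul]
    rw [h5]
    exact ⟨h4, hq1, hq2, hq3⟩
  obtain ⟨h2p, hq, hNp, -⟩ := hloc p h.self_of_nhds hN.self_of_nhds
  obtain ⟨η, -, h2, h3, h4⟩ := h.self_of_nhds.exists_null_normal_field hk hΦ hdΦ hq hNp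
  refine ⟨η, h2, h3, ?_⟩
  -- By continuity the normalized N stays where the implicit function is the unique solution, so it
  -- coincides with η.
  have hcont : Filter.Tendsto (fun y => (y, (N y).2⁻¹ • (N y).1)) (𝓝 p)
      (𝓝 (p, (N p).2⁻¹ • (N p).1)) :=
    continuousAt_id.prodMk ((hNc.snd.inv₀ h2p).smul hNc.fst)
  filter_upwards [h, hN, hcont.eventually h4] with y y1 y2 y3
  obtain ⟨z1, z2, z3, z4⟩ := hloc y y1 y2
  have : η y = (N y).2⁻¹ • (N y).1 := y3 z2 z3
  rw [this]
  exact ⟨z1, z4⟩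

lemma lor_fderiv_null_normal {η : EuclideanSpace ℝ (Fin n) → Mink n} (hΦ : DifferentiableAt ℝ Φ p)
    (hη : DifferentiableAt ℝ η p)
    (h : ∀ᶠ y in 𝓝 p, lor (η y) (η y) = 1 ∧ IsNormalAt Φ y (η y, 1))
    (v : EuclideanSpace ℝ (Fin n)) :
    lor (fderiv ℝ η p v) (η p) = 0 ∧ lor (fderiv ℝ η p v) (Φ p).1 = - (fderiv ℝ Φ p v).2 := by
  constructor
  · exact lor_fderiv_self_eq_zero (c := 1) hη (h.mono fun y hy => hy.1) v
  · have h1 := lor_fderiv_add_eq_zero (c := 0) hη hΦ.fst (h.mono fun y hy => hy.2.1) v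
    have h2 := lor_fst_eq_snd h.self_of_nhds.2 v
    rw [differential_eq_fderiv] at h2
    rw [fderiv_fst_apply hΦ, lor_comm (η p), h2] at h1
    linarith

end NullField

/-! ### Null second fundamental forms vanish. -/

section TotallyGeodesic

variable {n : ℕ} {Φ : EuclideanSpace ℝ (Fin n) → Amb n} {p : EuclideanSpace ℝ (Fin n)}
  {η : EuclideanSpace ℝ (Fin n) → Mink n}

/-- If the derivative of a null normal is `dτ ψ`, then the height `τ` is constant. -/
lemma fderiv_snd_eq_zero (hn : 2 ≤ n) (h : IsNondegAt Φ p) (hΦ : ContDiffAt ℝ 2 Φ p)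
    (hN : IsNormalAt Φ p (η p, 1)) (hη : ∀ᶠ y in 𝓝 p, DifferentiableAt ℝ η y)
    (hd : ∀ᶠ y in 𝓝 p, ∀ v, fderiv ℝ η y v = (fderiv ℝ Φ y v).2 • (Φ y).1)
    (v : EuclideanSpace ℝ (Fin n)) : (fderiv ℝ Φ p v).2 = 0 := by
  have hΦd := hΦ.differentiableAt (by simp)
  -- η is assumed only differentiable, but dη = dτ ψ is differentiable because Φ is C².
  have hddη : HasFDerivAt (fderiv ℝ η) (fderiv ℝ (fderiv ℝ η) p) p := by
    have hddΦ : DifferentiableAt ℝ (fderiv ℝ Φ) p :=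
      (hΦ.fderiv_right (m := 1) (by norm_num)).differentiableAt (by simp)
    have hL : HasFDerivAt (fun y => ((ContinuousLinearMap.snd ℝ (Mink n) ℝ).comp
        (fderiv ℝ Φ y)).smulRight (Φ y).1) _ p :=
      (((ContinuousLinearMap.smulRightL ℝ (EuclideanSpace ℝ (Fin n))
        (Mink n)).hasFDerivAt_of_bilinear
        ((ContinuousLinearMap.compL ℝ (EuclideanSpace ℝ (Fin n)) (Amb n) ℝ
          (ContinuousLinearMap.snd ℝ (Mink n) ℝ)).hasFDerivAt.comp p hddΦ.hasFDerivAt)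
        hΦd.hasFDerivAt.fst))
    have heq : fderiv ℝ η =ᶠ[𝓝 p] fun y => ((ContinuousLinearMap.snd ℝ (Mink n) ℝ).comp
        (fderiv ℝ Φ y)).smulRight (Φ y).1 := by
      filter_upwards [hd] with y hy
      ext1 v
      simp [hy v]
    exact (hL.congr_of_eventuallyEq heq).differentiableAt.hasFDerivAt
  have hddη_apply : ∀ v w, fderiv ℝ (fderiv ℝ η) p v w =
      (fderiv ℝ Φ p w).2 • (fderiv ℝ Φ p v).1 + (fderiv ℝ (fderiv ℝ Φ) p v w).2 • (Φ p).1 := by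
    intro v w
    obtain ⟨d1, d2⟩ := ContDiffAt.hasFDerivAt_fderiv_apply hΦ w
    have h1 : HasFDerivAt (fun y => fderiv ℝ η y w) _ p := hddη.clm_apply (hasFDerivAt_const w p)
    have h2 : HasFDerivAt (fun y => fderiv ℝ η y w) _ p :=
      (d1.hasFDerivAt.snd.smul hΦd.hasFDerivAt.fst).congr_of_eventuallyEq
        (hd.mono fun y hy => hy w)
    have h3 := congrArg (fun L => L v) (h1.unique h2)
    simpa [d2] using h3
  have hpair : ∀ v w, (fderiv ℝ Φ p w).2 • (fderiv ℝ Φ p v).1 =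
      (fderiv ℝ Φ p v).2 • (fderiv ℝ Φ p w).1 := by
    intro v w
    -- Symmetry of D²η, after the symmetric term D²τ ψ is cancelled, is the equation dτ ∧ dψ = 0.
    have hsymm := second_derivative_symmetric_of_eventually
      (hη.mono fun y hy => hy.hasFDerivAt) hddη v w
    rw [hddη_apply, hddη_apply, ContDiffAt.fderiv_fderiv_symm hΦ w v] at hsymm
    exact add_right_cancel hsymm
  have hX : ∀ v w, (fderiv ℝ Φ p w).2 • v = (fderiv ℝ Φ p v).2 • w := by
    intro v w
    rw [← sub_eq_zero]
    apply h.screenPart_injective hN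
    rw [map_sub, map_smul, map_smul, screenPart_apply, screenPart_apply, differential_eq_fderiv,
      smul_sub, smul_sub, hpair, smul_smul, smul_smul, mul_comm]
    simp
  have hcoord : ∀ i, (fderiv ℝ Φ p (coordVec i)).2 = 0 := by
    intro i
    -- A second coordinate direction j is needed: the i-th and j-th vectors are independent, so both
    -- coefficients vanish.
    have : Nontrivial (Fin n) := Fin.nontrivial_iff_two_le.mpr hn
    obtain ⟨j, hj⟩ := exists_ne i
    have := congrArg (fun z : EuclideanSpace ℝ (Fin n) => z j) (hX (coordVec i) (coordVec j))
    simpa [coordVec, hj] using this.symm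
  have := eq_zero_of_forall_coordVec (D := fderiv ℝ Φ p)
      (L := ContinuousLinearMap.snd ℝ (Mink n) ℝ) (by simpa using hcoord) v
  simpa using this

/-- A nonzero value h(v₀, w₀) gives a continuous null normal field near p, hence a C¹ field η, and
all of h is orthogonal to (η, 1). This forces dη = dτ ψ and constant height, which contradicts the
nonzero vertical component of h(v₀, w₀). -/
lemma secondForm_eq_zero_flat {V : Set (EuclideanSpace ℝ (Fin n))} (hn : 2 ≤ n) (hV : IsOpen V)
    (h : IsNondegImmersionOn Φ V) (hnull : HasNullSecondFormOn Φ V) (hp : p ∈ V)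
    (v₀ w₀ : EuclideanSpace ℝ (Fin n)) : secondForm Φ p v₀ w₀ = 0 := by
  by_contra hne
  have hnd : ∀ y ∈ V, IsNondegAt Φ y := fun y hy => h.isNondegAt hV hy
  have hC2 : ∀ y ∈ V, ContDiffAt ℝ 2 Φ y := fun y hy =>
    contDiffAt_of_contMDiffOn hV h.contMDiffOn hy
  have hVp := hV.mem_nhds hp
  have hcont := (continuousAt_secondForm (hC2 p hp) (hnd p hp).det v₀ w₀).1.continuousAt
  obtain ⟨η, hη, hηN, hηh⟩ := IsNondegAt.exists_regular_null_normal_field (k := 1)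
    (N := fun y => secondForm Φ y v₀ w₀)
    (by filter_upwards [hVp] with y hy using hnd y hy) (by simp)
    ((hC2 p hp).of_le (by norm_num)) ((hC2 p hp).fderiv_right (by norm_num)) hcont (by
      filter_upwards [hVp, hcont.eventually_ne hne] with y hy hy2
      exact ⟨hy2, hnull y hy _ _, (hnd y hy).isNormalAt_normalPart _⟩)
  have hηd : ∀ᶠ y in 𝓝 p, DifferentiableAt ℝ η y :=
    (hη.eventually (by simp)).mono fun y hy => hy.differentiableAt (by simp)
  have hd : ∀ᶠ y in 𝓝 p, ∀ v, fderiv ℝ η y v = (fderiv ℝ Φ y v).2 • (Φ y).1 := by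
    filter_upwards [hVp, hηd, hηN.eventually_nhds, hηh] with y y1 y2 y3 y4 v
    have hy := hnd y y1
    have hΦd := (hC2 y y1).differentiableAt (by simp)
    obtain ⟨e1, e2⟩ := lor_fderiv_null_normal hΦd y2 y3 v
    obtain ⟨y5, y6⟩ := y3.self_of_nhds
    -- dη v - dτ(v) ψ is orthogonal to ψ and η by the constraints on η, and to dψ by the vanishing
    -- of ⟨h, (η, 1)⟩.
    rw [← sub_eq_zero]
    refine hy.eq_zero_of_orthogonal y5 y6 ?_ ?_ fun w => ?_
    · rw [lor_sub_left, lor_smul_left, e2, hy.unit]; ring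
    · have := y6.1
      simp only at this
      rw [lor_sub_left, lor_smul_left, e1, lor_comm _ (η y), this]; ring
    · have h1 := hy.amb_secondForm_eq_zero y5 y6 (hnull y y1) y4.1 y4.2 v w
      rw [amb_secondForm_null_normal (hC2 y y1) y2 (y3.mono fun z hz => hz.2)] at h1
      have h2 := hy.tangent w
      rw [differential_eq_fderiv] at h2 ⊢
      rw [lor_sub_left, lor_smul_left, lor_comm _ (fderiv ℝ Φ y w).1,
        lor_comm _ (fderiv ℝ Φ y w).1, h2]
      linarith
  have hτ : ∀ᶠ y in 𝓝 p, ∀ v, (fderiv ℝ Φ y v).2 = 0 := by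
    filter_upwards [hVp, hηd.eventually_nhds, hηN, hd.eventually_nhds] with y y1 y2 y3 y4 v
    exact fderiv_snd_eq_zero hn (hnd y y1) (hC2 y y1) y3.2 y2 y4 v
  -- With dτ = 0 near p, neither D²Φ nor the removed components have a vertical part.
  apply hηh.self_of_nhds.1
  obtain ⟨d1, d2⟩ := ContDiffAt.hasFDerivAt_fderiv_apply (hC2 p hp) w₀
  have h3 := fderiv_snd_apply d1 v₀
  rw [d2, Filter.EventuallyEq.fderiv_eq (f := fun _ => (0 : ℝ)) (hτ.mono fun y hy => hy w₀)] at h3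
  simp only [secondForm]
  rw [normalPart_eq, secondDeriv_eq_fderiv, differential_eq_fderiv, Prod.snd_sub, Prod.snd_add,
    hτ.self_of_nhds, ← h3]
  simp

variable {M : Type*} [TopologicalSpace M] [ChartedSpace (EuclideanSpace ℝ (Fin n)) M]
  [IsManifold (𝓡 n) ∞ M] {U : Set M}

theorem IsNondegImmersionOn.isTotallyGeodesicOn {Φ : M → Amb n} (hn : 2 ≤ n) (hU : IsOpen U)
    (h : IsNondegImmersionOn Φ U) (hnull : HasNullSecondFormOn Φ U) : IsTotallyGeodesicOn Φ U := by
  intro x hx v w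
  have hxs := mem_extChartAt_source (I := 𝓡 n) x
  have hnull' : HasNullSecondFormOn (TrappedHyp.inChart (n := n) x Φ)
      (chartDomain (n := n) x U) := by
    intro q hq v w
    obtain ⟨y, hyU, hy, rfl⟩ := exists_of_mem_chartDomain hq
    have hs := surjective_of_isInvertible (chartDeriv_isInvertible hy)
    obtain ⟨v, rfl⟩ := hs v
    obtain ⟨w, rfl⟩ := hs w
    rw [← secondForm_eq (h.isNondegAt hU hyU) (h.contMDiffOn.contMDiffAt (hU.mem_nhds hyU)) hy]
    exact hnull y hyU v w
  rw [secondForm_eq (x := x) (h.isNondegAt hU hx) (h.contMDiffOn.contMDiffAt (hU.mem_nhds hx)) hxs]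
  exact secondForm_eq_zero_flat hn (isOpen_chartDomain x hU) (h.inChart hU x) hnull'
    (mem_chartDomain hx hxs) _ _

end TotallyGeodesic

/-! ### Recovering the hypersurface from a null normal field. -/

section Unrotate

variable {n : ℕ} {Φ : EuclideanSpace ℝ (Fin n) → Amb n} {η : EuclideanSpace ℝ (Fin n) → Mink n}
  {b : ℝ} {p : EuclideanSpace ℝ (Fin n)}

/-- The hypersurface parallel to the horizontal part of `Φ` at the distance given by the height. -/
def unrotatedBase (Φ : EuclideanSpace ℝ (Fin n) → Amb n) (η : EuclideanSpace ℝ (Fin n) → Mink n)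
    (b : ℝ) (y : EuclideanSpace ℝ (Fin n)) : Mink n :=
  Real.cosh ((Φ y).2 + b) • (Φ y).1 - Real.sinh ((Φ y).2 + b) • η y

/-- The unit normal of the parallel hypersurface. -/
def unrotatedNormal (Φ : EuclideanSpace ℝ (Fin n) → Amb n) (η : EuclideanSpace ℝ (Fin n) → Mink n)
    (b : ℝ) (y : EuclideanSpace ℝ (Fin n)) : Mink n :=
  Real.cosh ((Φ y).2 + b) • η y - Real.sinh ((Φ y).2 + b) • (Φ y).1

/-- dφ = cosh (dψ - dτ η) - sinh (dη - dτ ψ): the terms with dτ regroup so that the first bracket is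
the screen part. For a null normal field both brackets are orthogonal to ψ and η. -/
lemma fderiv_unrotatedBase (hΦ : DifferentiableAt ℝ Φ p) (hη : DifferentiableAt ℝ η p)
    (v : EuclideanSpace ℝ (Fin n)) : fderiv ℝ (unrotatedBase Φ η b) p v =
      Real.cosh ((Φ p).2 + b) • screenPart Φ p (η p) v -
        Real.sinh ((Φ p).2 + b) • (fderiv ℝ η p v - (fderiv ℝ Φ p v).2 • (Φ p).1) := by
  have h3 := hΦ.hasFDerivAt.snd.add_const b
  have h5 := (h3.cosh.smul hΦ.hasFDerivAt.fst).sub (h3.sinh.smul hη.hasFDerivAt)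
  unfold unrotatedBase
  erw [h5.fderiv]
  rw [screenPart_apply, differential_eq_fderiv]
  simp
  module

lemma contDiffAt_unrotated {k : ℕ∞ω} (hΦ : ContDiffAt ℝ k Φ p) (hη : ContDiffAt ℝ k η p) :
    ContDiffAt ℝ k (unrotatedBase Φ η b) p ∧ ContDiffAt ℝ k (unrotatedNormal Φ η b) p := by
  have h1 := hΦ.snd.add (contDiffAt_const (c := b))
  exact ⟨(h1.cosh.smul hΦ.fst).sub (h1.sinh.smul hη), (h1.cosh.smul hη).sub (h1.sinh.smul hΦ.fst)⟩

lemma IsNondegAt.lor_unrotated (h : IsNondegAt Φ p) (hq : lor (η p) (η p) = 1)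
    (hN : IsNormalAt Φ p (η p, 1)) :
    lor (unrotatedBase Φ η b p) (unrotatedBase Φ η b p) = -1 ∧
      lor (unrotatedBase Φ η b p) (Φ p).1 < 0 ∧
      lor (unrotatedNormal Φ η b p) (unrotatedNormal Φ η b p) = 1 ∧
      lor (unrotatedNormal Φ η b p) (unrotatedBase Φ η b p) = 0 := by
  have h1 : lor (η p) (Φ p).1 = 0 := hN.1
  have h2 := lor_comm (Φ p).1 (η p)
  have hcs := Real.cosh_sq ((Φ p).2 + b)
  have hc := Real.cosh_pos ((Φ p).2 + b)
  simp only [unrotatedBase, unrotatedNormal, lor_sub_left, lor_sub_right, lor_smul_left,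
    lor_smul_right, h.unit, hq, h2, h1]
  refine ⟨?_, ?_, ?_, ?_⟩ <;> nlinarith

lemma IsNondegAt.lor_unrotatedNormal_fderiv (h : IsNondegAt Φ p) (hΦ : DifferentiableAt ℝ Φ p)
    (hη : DifferentiableAt ℝ η p)
    (hN : ∀ᶠ y in 𝓝 p, lor (η y) (η y) = 1 ∧ IsNormalAt Φ y (η y, 1))
    (v : EuclideanSpace ℝ (Fin n)) :
    lor (unrotatedNormal Φ η b p) (fderiv ℝ (unrotatedBase Φ η b) p v) = 0 := by
  obtain ⟨e1, e2⟩ := lor_fderiv_null_normal hΦ hη hN v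
  obtain ⟨hq, hNp⟩ := hN.self_of_nhds
  obtain ⟨e3, e4⟩ := h.screenPart_orthogonal hq hNp v
  have h1 : lor (η p) (Φ p).1 = 0 := hNp.1
  rw [lor_comm, fderiv_unrotatedBase hΦ hη]
  simp only [unrotatedNormal, lor_sub_left, lor_sub_right, lor_smul_left, lor_smul_right, e1, e2,
    e3, e4, h.unit, lor_comm (Φ p).1 (η p), h1]
  ring

lemma rotate_unrotated (y : EuclideanSpace ℝ (Fin n)) :
    Real.cosh ((Φ y).2 + b) • unrotatedBase Φ η b y +
        Real.sinh ((Φ y).2 + b) • unrotatedNormal Φ η b y = (Φ y).1 ∧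
      rotatedNormal (unrotatedBase Φ η b) (unrotatedNormal Φ η b) (fun z => (Φ z).2 + b) y =
        η y := by
  have hcs : Real.cosh ((Φ y).2 + b) * Real.cosh ((Φ y).2 + b) -
      Real.sinh ((Φ y).2 + b) * Real.sinh ((Φ y).2 + b) = 1 := by
    nlinarith [Real.cosh_sq ((Φ y).2 + b)]
  simp only [unrotatedBase, unrotatedNormal, rotatedNormal]
  constructor
  · calc _ = (Real.cosh ((Φ y).2 + b) * Real.cosh ((Φ y).2 + b) -
        Real.sinh ((Φ y).2 + b) * Real.sinh ((Φ y).2 + b)) • (Φ y).1 := by module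
      _ = _ := by rw [hcs, one_smul]
  · calc _ = (Real.cosh ((Φ y).2 + b) * Real.cosh ((Φ y).2 + b) -
        Real.sinh ((Φ y).2 + b) * Real.sinh ((Φ y).2 + b)) • η y := by module
      _ = _ := by rw [hcs, one_smul]

/-- For suitable small distances the parallel hypersurface is immersed. -/
lemma IsNondegAt.exists_unrotatedBase_immersion (h : IsNondegAt Φ p) (hΦ : DifferentiableAt ℝ Φ p)
    (hη : DifferentiableAt ℝ η p) (hq : lor (η p) (η p) = 1) (hN : IsNormalAt Φ p (η p, 1)) :
    ∃ b : ℝ, (Φ p).2 + b ≠ 0 ∧ (gram (n := n) lor (unrotatedBase Φ η b) p).det ≠ 0 := by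
  set X := screenPart Φ p (η p) with hX
  set Z : EuclideanSpace ℝ (Fin n) →L[ℝ] Mink n :=
    fderiv ℝ η p - ((ContinuousLinearMap.snd ℝ (Mink n) ℝ).comp (fderiv ℝ Φ p)).smulRight (Φ p).1
    with hZ
  have hcont : Continuous fun e : ℝ =>
      (gramOf lor (Real.cosh e • X - Real.sinh e • Z)).det := by
    refine Continuous.matrix_det (continuous_matrix fun i j => ?_)
    simp only [gramOf, Matrix.of_apply, sub_apply, smul_apply,
      lor_sub_left, lor_sub_right, lor_smul_left, lor_smul_right]
    fun_prop
  -- At distance zero the Gram matrix is that of Φ, since passing to the screen part subtracts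
  -- exactly dτ².
  have h0 : (gramOf lor (Real.cosh 0 • X - Real.sinh 0 • Z)).det ≠ 0 := by
    have : gramOf lor (Real.cosh 0 • X - Real.sinh 0 • Z) = gram (n := n) amb Φ p := by
      have e0 : Real.cosh 0 • X - Real.sinh 0 • Z = X := by ext1 v; simp
      rw [e0, gram_eq_gramOf]
      ext i j
      simp only [gramOf, Matrix.of_apply, hX, screenPart_apply, lor_sub_left, lor_sub_right,
        lor_smul_left, lor_smul_right, hq, lor_fst_eq_snd hN, amb,
        lor_comm (η p) (differential (n := n) Φ p _).1]
      ring
    rw [this]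
    exact h.det
  -- The distance must be small for the immersion and nonzero for coth to be defined there.
  have hev : ∀ᶠ e in 𝓝[>] (0 : ℝ), (gramOf lor (Real.cosh e • X - Real.sinh e • Z)).det ≠ 0 :=
    (hcont.continuousAt.eventually_ne h0).filter_mono nhdsWithin_le_nhds
  obtain ⟨e, he, he0⟩ := (hev.and self_mem_nhdsWithin).exists
  refine ⟨e - (Φ p).2, by simpa using (ne_of_gt he0), ?_⟩
  have : fderiv ℝ (unrotatedBase Φ η (e - (Φ p).2)) p = Real.cosh e • X - Real.sinh e • Z := by
    ext1 v
    rw [fderiv_unrotatedBase hΦ hη, add_sub_cancel]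
    simp [hX, hZ]
  rw [gram_eq_gramOf, differential_eq_fderiv, this]
  exact he

/-- An immersion with mean curvature vector along a regular null normal field is locally obtained
from a hypersurface and a root function. -/
lemma exists_hypersurface_of_null_normal {V : Set (EuclideanSpace ℝ (Fin n))} (hV : IsOpen V)
    (hp : p ∈ V) (hΦV : IsNondegImmersionOn Φ V) (hΦ5 : ∀ y ∈ V, ContDiffAt ℝ 5 Φ y)
    (hη : ContDiffAt ℝ 4 η p)
    (hN : ∀ᶠ y in 𝓝 p, lor (η y) (η y) = 1 ∧ IsNormalAt Φ y (η y, 1))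
    (hH : ∀ᶠ y in 𝓝 p, amb (meanCurv Φ y) (η y, 1) = 0) :
    ∃ (W : Set (EuclideanSpace ℝ (Fin n))) (φ ν : EuclideanSpace ℝ (Fin n) → Mink n)
      (s : EuclideanSpace ℝ (Fin n) → ℝ) (c : ℝ), IsOpen W ∧ p ∈ W ∧ W ⊆ V ∧
      IsHypersurfaceOn φ ν W ∧ ContMDiffOn (𝓡 n) 𝓘(ℝ, ℝ) 2 s W ∧ IsRootOn φ ν s W ∧
      ∀ y ∈ W, Φ y + ((0 : Mink n), c) = trapMap φ ν s y := by
  have hnd : ∀ y ∈ V, IsNondegAt Φ y := fun y hy => hΦV.isNondegAt hV hy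
  have hΦ4 : ∀ y ∈ V, ContDiffAt ℝ 4 Φ y := fun y hy => (hΦ5 y hy).of_le (by norm_num)
  have hΦd : ∀ y ∈ V, DifferentiableAt ℝ Φ y := fun y hy => (hΦ5 y hy).differentiableAt (by simp)
  obtain ⟨b, hb, hdet⟩ := (hnd p hp).exists_unrotatedBase_immersion (hΦd p hp)
    (hη.differentiableAt (by simp)) hN.self_of_nhds.1 hN.self_of_nhds.2
  have hdet' : ∀ᶠ y in 𝓝 p, (gram (n := n) lor (unrotatedBase Φ η b) y).det ≠ 0 := by
    have h1 : ∀ u, ContDiffAt ℝ 3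
        (fun y => differential (n := n) (unrotatedBase Φ η b) y u) p := fun u => by
      simp only [differential_eq_fderiv]
      exact ((contDiffAt_unrotated (hΦ4 p hp) hη).1.fderiv_right (m := 3)
        (by norm_num)).clm_apply contDiffAt_const
    exact (contDiffAt_det (A := fun y => gram (n := n) lor (unrotatedBase Φ η b) y)
      fun i j => ContDiffAt.lor (h1 _) (h1 _)).continuousAt.eventually_ne hdet
  have hb' : ∀ᶠ y in 𝓝 p, (Φ y).2 + b ≠ 0 :=
    ((hΦd p hp).continuousAt.snd.add continuousAt_const).eventually_ne hb
  have hVp : ∀ᶠ y in 𝓝 p, y ∈ V := hV.mem_nhds hp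
  have hall := (hVp.and (hb'.and (hdet'.and
    (hH.and ((hη.eventually (by simp)).and hN.eventually_nhds)))))
  obtain ⟨W, hW, hWo, hpW⟩ := eventually_nhds_iff.mp hall
  have hyp : IsHypersurfaceOn (unrotatedBase Φ η b) (unrotatedNormal Φ η b) W := by
    refine ⟨fun y hy => ?_, fun y hy => ?_, fun y hy => ?_, fun y hy => ?_, fun y hy => ?_,
      fun y hy => ?_, fun y hy v => ?_⟩ <;> obtain ⟨w1, w2, w3, w4, w5, w6⟩ := hW y hy
    · obtain ⟨a1, a2, -⟩ := (hnd y w1).lor_unrotated (b := b) w6.self_of_nhds.1 w6.self_of_nhds.2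
      exact mem_hyperbolicSpace_of_lor_neg (hΦV.mapsTo y w1) a1 a2
    · exact (contDiffAt_unrotated (hΦ4 y w1) w5).1.contMDiffAt.contMDiffWithinAt
    · rw [injective_iff_map_eq_zero]
      intro v hv
      refine eq_zero_of_gramOf_det_ne_zero (B := lorL n)
        (D := differential (n := n) (unrotatedBase Φ η b) y) ?_ fun w => ?_
      · rwa [gramOf_lorL, ← gram_eq_gramOf]
      · rw [hv, map_zero]
    · exact ((contDiffAt_unrotated (hΦ4 y w1) w5).2.of_le
        (by norm_num)).contMDiffAt.contMDiffWithinAt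
    · exact ((hnd y w1).lor_unrotated w6.self_of_nhds.1 w6.self_of_nhds.2).2.2.1
    · exact ((hnd y w1).lor_unrotated w6.self_of_nhds.1 w6.self_of_nhds.2).2.2.2
    · rw [differential_eq_fderiv]
      exact (hnd y w1).lor_unrotatedNormal_fderiv (hΦd y w1) (w5.differentiableAt (by simp)) w6 v
  have hrot : IsRotationOn (unrotatedBase Φ η b) (unrotatedNormal Φ η b)
      (fun z => (Φ z).2 + b) (-b) Φ W :=
    ⟨hWo, hyp, fun y hy => (hΦ5 y (hW y hy).1).of_le (by norm_num), fun y hy =>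
      Prod.ext (rotate_unrotated y).1.symm (by simp)⟩
  have hsinh : ∀ y ∈ W, Real.sinh ((Φ y).2 + b) ≠ 0 := fun y hy => by
    simpa using (hW y hy).2.1
  have hs1 : ∀ y ∈ W, 1 < |Real.cosh ((Φ y).2 + b) / Real.sinh ((Φ y).2 + b)| := fun y hy =>
    one_lt_abs_cosh_div_sinh (hW y hy).2.1
  refine ⟨W, unrotatedBase Φ η b, unrotatedNormal Φ η b,
    fun y => Real.cosh ((Φ y).2 + b) / Real.sinh ((Φ y).2 + b), b, hWo, hpW,
    fun y hy => (hW y hy).1, hyp, fun y hy => ?_, fun y hy => ⟨?_, hs1 y hy⟩, fun y hy => ?_⟩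
  · have h1 : ContDiffAt ℝ 2 (fun y => (Φ y).2 + b) y :=
      ((hΦ5 y (hW y hy).1).of_le (by norm_num)).snd.add contDiffAt_const
    exact (h1.cosh.div h1.sinh (hsinh y hy)).contMDiffAt.contMDiffWithinAt
  -- Non-degeneracy of Φ keeps coth off the spectrum, and H is orthogonal to the rotated normal,
  -- which is η again.
  · rw [← hrot.amb_meanCurv_eq_zero_iff hy (hsinh y hy) (hrot.not_isRoot_of_det_ne_zero hy
      (hsinh y hy) (hnd y (hW y hy).1).det), (rotate_unrotated y).2]
    exact (hW y hy).2.2.2.1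
  · rw [trapMap_eq _ _ (s := fun y => Real.cosh ((Φ y).2 + b) / Real.sinh ((Φ y).2 + b))
      (hs1 y hy), arcoth_cosh_div_sinh, (rotate_unrotated y).1]
    exact Prod.ext (add_zero _) rfl

end Unrotate

/-! ### Marginally trapped immersions are locally of the constructed form. -/

section Converse

variable {n : ℕ} {M : Type*} [TopologicalSpace M] [ChartedSpace (EuclideanSpace ℝ (Fin n)) M]
  [IsManifold (𝓡 n) ∞ M] {U : Set M} {Φ : M → Amb n} {x : M}

lemma IsNondegImmersionOn.isLocallyTrapMapAt_of_null_normal {η : EuclideanSpace ℝ (Fin n) → Mink n}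
    (hU : IsOpen U) (h : IsNondegImmersionOn Φ U)
    (h5 : ContMDiffOn (𝓡 n) 𝓘(ℝ, Amb n) 5 Φ U) (hx : x ∈ U)
    (hη : ContDiffAt ℝ 4 η (extChartAt (𝓡 n) x x))
    (hN : ∀ᶠ y in 𝓝 (extChartAt (𝓡 n) x x), lor (η y) (η y) = 1 ∧
      IsNormalAt (TrappedHyp.inChart (n := n) x Φ) y (η y, 1))
    (hH : ∀ᶠ y in 𝓝 (extChartAt (𝓡 n) x x),
      amb (meanCurv (TrappedHyp.inChart (n := n) x Φ) y) (η y, 1) = 0) :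
    IsLocallyTrapMapAt Φ x := by
  have hxs := mem_extChartAt_source (I := 𝓡 n) x
  have hV := isOpen_chartDomain (n := n) x hU
  obtain ⟨W, φ, ν, s, c, hW, hpW, -, hyp, hs, hroot, heq⟩ := exists_hypersurface_of_null_normal hV
    (mem_chartDomain hx hxs) (h.inChart hU x)
    (fun y hy => contDiffAt_of_contMDiffOn hV (contDiffOn_inChart ENat.LEInfty.out hU h5 x) hy)
    hη hN hH
  obtain ⟨hyp', hP⟩ := hyp.pullback hW x
  refine ⟨chartPreimage x W, φ ∘ extChartAt (𝓡 n) x, ν ∘ extChartAt (𝓡 n) x,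
    s ∘ extChartAt (𝓡 n) x, c, isOpen_chartPreimage x hW, ⟨hxs, hpW⟩, hyp',
    contMDiffOn_comp_extChart ENat.LEInfty.out hW hs x, fun y hy => ?_, fun y hy => ?_⟩
  · rw [hP y hy]
    exact hroot _ hy.2
  · rw [← inChart_apply Φ hy.1, heq _ hy.2]
    rfl

/-- The given null field is only continuous. It is proportional to a field (η, 1) with η of class
C⁴, since null normals are determined by dΦ, which is C⁴. -/
lemma IsNondegImmersionOn.isLocallyTrapMapAt_of_hasNullDirectionAt
    (hU : IsOpen U) (h : IsNondegImmersionOn Φ U)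
    (h5 : ContMDiffOn (𝓡 n) 𝓘(ℝ, Amb n) 5 Φ U) (hx : x ∈ U) (hdir : HasNullDirectionAt Φ x) :
    IsLocallyTrapMapAt Φ x := by
  obtain ⟨V, N, hV, hxV, hNc, hN⟩ := hdir
  have hxs := mem_extChartAt_source (I := 𝓡 n) x
  have hD := isOpen_chartDomain (n := n) x (hU.inter hV)
  have hDp := hD.mem_nhds (mem_chartDomain ⟨hx, hxV⟩ hxs)
  have h5x : ContDiffAt ℝ 5 (TrappedHyp.inChart (n := n) x Φ) (extChartAt (𝓡 n) x x) :=
    (contDiffAt_inChart_iff ENat.LEInfty.out hxs).mpr (h5.contMDiffAt (hU.mem_nhds hx))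
  have hloc : ∀ y ∈ U, y ∈ (extChartAt (𝓡 n) x).source →
      ContMDiffAt (𝓡 n) 𝓘(ℝ, Amb n) 2 Φ y := fun y hy _ =>
    h.contMDiffOn.contMDiffAt (hU.mem_nhds hy)
  have hNp : ContinuousAt (TrappedHyp.inChart (n := n) x N) (extChartAt (𝓡 n) x x) := by
    have hc := continuousAt_extChartAt_symm (I := 𝓡 n) x
    refine ContinuousAt.comp ?_ hc
    rw [(extChartAt (𝓡 n) x).left_inv hxs]
    exact hNc.continuousAt (hV.mem_nhds hxV)
  obtain ⟨η, hη, hηN, hηh⟩ := IsNondegAt.exists_regular_null_normal_field (k := 4)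
    (Φ := TrappedHyp.inChart (n := n) x Φ) (N := TrappedHyp.inChart (n := n) x N)
    (p := extChartAt (𝓡 n) x x)
    (by
      filter_upwards [hDp] with p hp
      obtain ⟨y, ⟨hyU, -⟩, hy, rfl⟩ := exists_of_mem_chartDomain hp
      exact (isNondegAt_inChart_iff ((hloc y hyU hy).of_le (by norm_num)) hy).mpr
        (h.isNondegAt hU hyU)) (by simp)
    (h5x.of_le (by norm_num)) (h5x.fderiv_right (by norm_num)) hNp (by
      filter_upwards [hDp] with p hp
      obtain ⟨y, ⟨hyU, hyV⟩, hy, rfl⟩ := exists_of_mem_chartDomain hp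
      obtain ⟨n1, n2, n3, -⟩ := hN y hyV
      rw [inChart_apply N hy, isNormalAt_inChart_iff ((hloc y hyU hy).of_le (by norm_num)) hy]
      exact ⟨n1, n2, n3⟩)
  refine h.isLocallyTrapMapAt_of_null_normal hU h5 hx hη hηN ?_
  filter_upwards [hDp, hηh] with p hp hpN
  obtain ⟨y, ⟨hyU, hyV⟩, hy, rfl⟩ := exists_of_mem_chartDomain hp
  obtain ⟨n1, n2, n3, c, hc⟩ := hN y hyV
  obtain ⟨m1, m2⟩ := hpN
  rw [inChart_apply N hy] at m1 m2
  rw [← meanCurv_eq (h.isNondegAt hU hyU) (hloc y hyU hy) hy, hc, amb_smul_left]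
  -- (η, 1) is null, because N is null and a nonzero multiple of it; hence H = c N is orthogonal to
  -- (η, 1).
  have h2 := n2
  rw [m2, amb_smul_left, amb_smul_right] at h2
  have h3 : amb ((η (extChartAt (𝓡 n) x y), (1 : ℝ)) : Amb n)
      (η (extChartAt (𝓡 n) x y), (1 : ℝ)) = 0 := by
    simpa [m1] using h2
  rw [m2, amb_smul_left, h3, mul_zero, mul_zero]

/-- H itself is the required field: it is continuous, null and normal, and it stays nonzero near x.
-/
lemma IsMarginallyTrappedOn.hasNullDirectionAt (hU : IsOpen U) (h : IsMarginallyTrappedOn Φ U)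
    (hx : x ∈ U) (hne : meanCurv Φ x ≠ 0) : HasNullDirectionAt Φ x := by
  have hcont : ContinuousOn (fun y => meanCurv Φ y) U := by
    intro y hyU
    refine ContinuousAt.continuousWithinAt ?_
    have hys := mem_extChartAt_source (I := 𝓡 n) y
    have hD := isOpen_chartDomain (n := n) y hU
    have hflat := h.toIsNondegImmersionOn.inChart hU y
    have hp := mem_chartDomain (n := n) hyU hys
    have h1 := continuousAt_meanCurv (contDiffAt_of_contMDiffOn hD hflat.contMDiffOn hp)
      (hflat.nondeg _ hp)
    refine (h1.comp (continuousAt_extChartAt (I := 𝓡 n) y)).congr ?_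
    filter_upwards [hU.mem_nhds hyU, extChartAt_source_mem_nhds (I := 𝓡 n) y] with z hz hzs
    exact (meanCurv_eq (h.isNondegAt hU hz) (h.contMDiffOn.contMDiffAt (hU.mem_nhds hz)) hzs).symm
  refine ⟨U ∩ {y | meanCurv Φ y ≠ 0}, fun y => meanCurv Φ y,
    hcont.isOpen_inter_preimage hU isOpen_compl_singleton, ⟨hx, hne⟩,
    hcont.mono Set.inter_subset_left, fun y hy => ⟨hy.2, h.null y hy.1,
      (h.isNondegAt hU hy.1).isNormalAt_meanCurv, 1, (one_smul ℝ _).symm⟩⟩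

/-- Either every neighbourhood of x contains points with H ≠ 0, or H vanishes near x. In the second
case x itself qualifies: H is orthogonal to any null normal field, and one exists because Φ is
spacelike. -/
lemma IsMarginallyTrappedOn.subset_closure_isLocallyTrapMapAt (hU : IsOpen U)
    (h : IsMarginallyTrappedOn Φ U) (h5 : ContMDiffOn (𝓡 n) 𝓘(ℝ, Amb n) 5 Φ U)
    (hs : IsSpacelikeOn Φ U) : U ⊆ closure {x ∈ U | IsLocallyTrapMapAt Φ x} := by
  intro x hx
  rw [mem_closure_iff]
  intro W hW hxW
  by_cases hne : ∃ y ∈ W ∩ U, meanCurv Φ y ≠ 0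
  · obtain ⟨y, ⟨hyW, hyU⟩, hy⟩ := hne
    exact ⟨y, hyW, hyU, h.isLocallyTrapMapAt_of_hasNullDirectionAt hU h5 hyU
      (h.hasNullDirectionAt hU hyU hy)⟩
  · push Not at hne
    refine ⟨x, hxW, hx, ?_⟩
    have hxs := mem_extChartAt_source (I := 𝓡 n) x
    have hmd : ∀ y ∈ U, ContMDiffAt (𝓡 n) 𝓘(ℝ, Amb n) 2 Φ y := fun y hy =>
      h.contMDiffOn.contMDiffAt (hU.mem_nhds hy)
    have h5x : ContDiffAt ℝ 5 (TrappedHyp.inChart (n := n) x Φ) (extChartAt (𝓡 n) x x) :=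
      (contDiffAt_inChart_iff ENat.LEInfty.out hxs).mpr (h5.contMDiffAt (hU.mem_nhds hx))
    obtain ⟨q, hq, hqN⟩ := (h.isNondegAt hU hx).exists_null_normal_of_spacelike (hs x hx)
    rw [← isNormalAt_inChart_iff ((hmd x hx).of_le (by norm_num)) hxs] at hqN
    obtain ⟨η, -, hη, hηN, -⟩ := ((isNondegAt_inChart_iff ((hmd x hx).of_le (by norm_num))
      hxs).mpr (h.isNondegAt hU hx)).exists_null_normal_field (k := 4) (by simp)
      (h5x.of_le (by norm_num)) (h5x.fderiv_right (by norm_num)) hq hqN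
    refine h.isLocallyTrapMapAt_of_null_normal hU h5 hx hη hηN ?_
    filter_upwards [(isOpen_chartDomain (n := n) x (hW.inter hU)).mem_nhds
      (mem_chartDomain ⟨hxW, hx⟩ hxs)] with p hp
    obtain ⟨y, hyWU, hy, rfl⟩ := exists_of_mem_chartDomain hp
    rw [← meanCurv_eq (h.isNondegAt hU hyWU.2) (hmd y hyWU.2) hy, hne y hyWU, amb_zero_left]

end Converse

end TrappedHyp

end

theorem theorem4 (n : ℕ) {M : Type*} [TopologicalSpace M]
    [ChartedSpace (EuclideanSpace ℝ (Fin n)) M] [IsManifold (𝓡 n) ∞ M]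
    (U : Set M) (hU : IsOpen U) :
    -- null second fundamental form implies totally geodesic
    (2 ≤ n → ∀ Φ : M → TrappedHyp.Amb n, TrappedHyp.IsNondegImmersionOn Φ U →
      TrappedHyp.HasNullSecondFormOn Φ U → TrappedHyp.IsTotallyGeodesicOn Φ U) ∧
    -- the construction from a hypersurface
    (∀ φ ν : M → TrappedHyp.Mink n, TrappedHyp.IsHypersurfaceOn φ ν U →
      -- the number of roots
      (∀ x ∈ U, TrappedHyp.trapPoly φ ν x ≠ 0 →
        {s : ℝ | (TrappedHyp.trapPoly φ ν x).IsRoot s ∧ 1 < |s|}.ncard ≤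
          (TrappedHyp.principalCurvatures φ ν x).card) ∧
      -- each root function gives a marginally trapped immersion
      (∀ s : M → ℝ, ContMDiffOn (𝓡 n) 𝓘(ℝ, ℝ) 2 s U → TrappedHyp.IsRootOn φ ν s U →
        TrappedHyp.IsMarginallyTrappedOn (TrappedHyp.trapMap φ ν s) U ∧
        TrappedHyp.IsSpacelikeOn (TrappedHyp.trapMap φ ν s) U) ∧
      -- continuous simple roots are of class C²
      (∀ s : M → ℝ, ContinuousOn s U → TrappedHyp.IsRootOn φ ν s U →
        (∀ x ∈ U, ¬ (TrappedHyp.trapPoly φ ν x).derivative.IsRoot (s x)) →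
        ContMDiffOn (𝓡 n) 𝓘(ℝ, ℝ) 2 s U) ∧
      -- each simple root at a point extends to such a root function near the point
      (∀ x ∈ U, ∀ s₀ : ℝ, (TrappedHyp.trapPoly φ ν x).IsRoot s₀ → 1 < |s₀| →
        ¬ (TrappedHyp.trapPoly φ ν x).derivative.IsRoot s₀ →
        ∃ (V : Set M) (s : M → ℝ), IsOpen V ∧ x ∈ V ∧ V ⊆ U ∧ s x = s₀ ∧
          ContMDiffOn (𝓡 n) 𝓘(ℝ, ℝ) 2 s V ∧ TrappedHyp.IsRootOn φ ν s V)) ∧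
    -- the converse
    (∀ Φ : M → TrappedHyp.Amb n, ContMDiffOn (𝓡 n) 𝓘(ℝ, TrappedHyp.Amb n) 5 Φ U →
      TrappedHyp.IsMarginallyTrappedOn Φ U → TrappedHyp.IsSpacelikeOn Φ U →
      (∀ x ∈ U, TrappedHyp.meanCurv Φ x ≠ 0 ∨ TrappedHyp.HasNullDirectionAt Φ x →
        TrappedHyp.IsLocallyTrapMapAt Φ x) ∧
      U ⊆ closure {x ∈ U | TrappedHyp.IsLocallyTrapMapAt Φ x}) ∧
    -- surfaces
    (n = 2 → ∀ (φ ν : M → TrappedHyp.Mink n) (κ₁ κ₂ a : M → ℝ),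
      TrappedHyp.IsHypersurfaceOn φ ν U →
      (∀ x ∈ U, (TrappedHyp.shapeOperator φ ν x).charpoly =
        (Polynomial.X - Polynomial.C (κ₁ x)) * (Polynomial.X - Polynomial.C (κ₂ x))) →
      (∀ x ∈ U, κ₁ x + κ₂ x ≠ 0) →
      (∀ x ∈ U, a x = (κ₁ x * κ₂ x + 1) / (κ₁ x + κ₂ x)) →
      (∀ x ∈ U, 1 < a x) →
      (∀ x ∈ U, κ₁ x = κ₂ x → κ₁ x < 1) →
      TrappedHyp.IsMarginallyTrappedOn (TrappedHyp.surfaceTrapMap φ ν a) U ∧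
      TrappedHyp.IsSpacelikeOn (TrappedHyp.surfaceTrapMap φ ν a) U) := by
  refine ⟨fun hn Φ h hnull => h.isTotallyGeodesicOn hn hU hnull, fun φ ν h => ⟨?_, ?_, ?_, ?_⟩,
    fun Φ h5 h hs => ⟨fun x hx hdir => ?_, h.subset_closure_isLocallyTrapMapAt hU h5 hs⟩, ?_⟩
  · exact fun x hx h0 => TrappedHyp.ncard_roots_le (h.isHypersurfaceAt hU hx) h0
  · exact fun s hs hroot => h.isMarginallyTrappedOn_trapMap hU hs hroot
  · exact fun s hs hroot hsimple => h.contMDiffOn_of_simple_root hU hs hroot hsimple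
  · exact fun x hx s₀ hroot hs hsimple => h.exists_root_extension hU hx hroot hs hsimple
  · exact h.isLocallyTrapMapAt_of_hasNullDirectionAt hU h5 hx
      (hdir.elim (h.hasNullDirectionAt hU hx) id)
  · intro hn φ ν κ₁ κ₂ a h hκ hsum ha ha1 humb
    subst hn
    exact h.isMarginallyTrappedOn_surfaceTrapMap hU hκ hsum ha ha1 humb
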